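/- Let $L,T>0$, $k\in\mathbb R$, $\Omega=(0,L)\times(0,L)$, and let all functions be real valued. Let $H_P^1(\Omega)$ be the set of $v\in H^1(\Omega)$ whose traces on opposite sides of $\Omega$ agree, i.e. $v(x,0)=v(x,L)$ and $v(0,y)=v(L,y)$ almost everywhere, and let $H_P^2(\Omega)=\{u\in H^2(\Omega): u,u_x,u_y\in H_P^1(\Omega)\}$. For $u\in H_P^2(\Omega)$ put $\vec V(u)=(-u_y,u_x)$. Let $(\phi_j)_{j\ge1}$ be the real orthonormal Fourier basis of $L^2(\Omega)$, consisting of the constant $1/L$ and, for every pair $\pm\xi$ with $0\ne\xi\in\mathbb Z^2$, of $\frac{\sqrt2}{L}\cos\frac{2\pi\,\xi\cdot\mathbf x}{L}$ and $\frac{\sqrt2}{L}\sin\frac{2\pi\,\xi\cdot\mathbf x}{L}$, enumerated in any order in which the eigenvalues $1+4\pi^2|\xi|^2/L^2$ of $I-\Delta$ are nondecreasing. Let $E_N=\mathrm{span}\{\phi_1,\dots,\phi_N\}$. **Theorem.** Let $u\in C([0,T],H_P^2(\Omega))$ and $w_0:=(I-\Delta)u(0)\in L^2(\Omega)$. Then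 the hyperbolic equation $w_t+\vec V(u)\cdot\nabla w=k\,u_y$ with initial value $w_0$ has a weak solution $w\in L^2(0,T;L^2(\Omega))$ in the time-integrated sense: $w$ has a representative, defined for every $t$, such that for all $v\in H_P^1(\Omega)$ and all $t\in(0,T]$ $$\langle w(t)-w_0,v\rangle_{L^2}=\int_0^t\Big(\langle \vec V(u(s))\cdot\nabla v,\,w(s)\rangle_{L^2}+k\,\langle u_y(s),v\rangle_{L^2}\Big)\,ds .$$ Here, if $\vec V(u)\cdot\nabla v\in L^2(0,t;L^2(\Omega))$, the integral of the first term is a Lebesgue integral (the integrand being integrable on $(0,t)$). For the other $v\in H_P^1(\Omega)$, for which $(\vec V(u)\cdot\nabla v)\,w$ need not be integrable, it is the limit of $\int_0^t\langle \vec V(u(s))\cdot\nabla v_n,w(s)\rangle_{L^2}\,ds$ for sequences $v_n\to v$ in $H^1(\Omega)$ with $v_n\in H_P^1(\Omega)$ and $\vec V(u)\cdot\nabla v_n\in L^2(0,t;L^2(\Omega))$; such sequences exist, and the limit exists and is the same for all of them. Moreover, for every such enumeration of the basis, such a solution $w$ is obtained as a weak limit of spectral Galerkin solutions: for every $N\ge1$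 there is $w_N\in C^1((0,T),E_N)\cap C([0,T],E_N)$ with $$\langle w_N'(t),v\rangle_{L^2}=\langle\vec V(u(t))\cdot\nabla v,\,w_N(t)\rangle_{L^2}+k\,\langle u_y(t),v\rangle_{L^2}\quad\forall v\in E_N,\ \forall t\in(0,T),\qquad w_N(0)=(I-\Delta)\,\mathrm{proj}_{E_N}u(0),$$ and a subsequence $(w_{N_j})$ that converges weakly in $L^2(0,T;L^2(\Omega))$ to a weak solution $w$ in the above sense. -/

import Mathlib

open MeasureTheory Filter Topology Set

noncomputable section

namespace HasegawaMima

/-- The open square `(0,L) × (0,L)`. -/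
def Omega (L : ℝ) : Set (ℝ × ℝ) := Ioo 0 L ×ˢ Ioo 0 L

/-- Lebesgue measure on the square. -/
def mu (L : ℝ) : Measure (ℝ × ℝ) := volume.restrict (Omega L)

instance instIsFiniteMeasureMu (L : ℝ) : IsFiniteMeasure (mu L) := by
  refine ⟨?_⟩
  rw [mu, Measure.restrict_apply_univ, Omega, Measure.volume_eq_prod, Measure.prod_prod]
  simp [ENNReal.mul_lt_top_iff]

/-- The real Hilbert space `L²(Ω)`. -/
abbrev L2Omega (L : ℝ) := Lp ℝ 2 (mu L)

/-- The space `L²(0,L)` of functions on one side of the square. -/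
abbrev L2Side (L : ℝ) := Lp ℝ 2 (volume.restrict (Ioo (0 : ℝ) L))

/-- The two coordinate directions. -/
def ex : ℝ × ℝ := (1, 0)
/-- The second coordinate direction. -/
def ey : ℝ × ℝ := (0, 1)

/-! ### Periodic Sobolev spaces -/

/-- `g` is the weak derivative of `f` in the direction `e`, on the open square. -/
def HasWeakDeriv (L : ℝ) (e : ℝ × ℝ) (f g : L2Omega L) : Prop :=
  ∀ φ : ℝ × ℝ → ℝ, ContDiff ℝ (⊤ : ℕ∞) φ → HasCompactSupport φ → tsupport φ ⊆ Omega L →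
    ∫ p in Omega L, f p * fderiv ℝ φ p e = - ∫ p in Omega L, g p * φ p

open Classical in
/-- The weak derivative in the direction `e` (and `0` if there is none in `L²`). -/
def wderiv (L : ℝ) (e : ℝ × ℝ) (f : L2Omega L) : L2Omega L :=
  if h : ∃ g, HasWeakDeriv L e f g then h.choose else 0

/-- Weak derivatives are unique. -/
theorem HasWeakDeriv.wderiv_eq {L : ℝ} {e : ℝ × ℝ} {f g : L2Omega L}
    (h : HasWeakDeriv L e f g) : wderiv L e f = g := by
  have hex : ∃ g, HasWeakDeriv L e f g := ⟨g, h⟩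
  have hc : HasWeakDeriv L e f (wderiv L e f) := by
    rw [wderiv, dif_pos hex]; exact hex.choose_spec
  have hopen : IsOpen (Omega L) := isOpen_Ioo.prod isOpen_Ioo
  have hint : ∀ q : L2Omega L, IntegrableOn q (Omega L) := fun q =>
    (Lp.memLp q).integrable (by norm_num)
  have hz : ∀ᵐ p, p ∈ Omega L → wderiv L e f p - g p = 0 := by
    refine hopen.ae_eq_zero_of_integral_contDiff_smul_eq_zero
      ((hint _).sub (hint g)).locallyIntegrableOn ?_
    intro φ hφ hcpt hsupp
    have h1 : ∀ q : L2Omega L, Integrable (fun p => q p * φ p) (volume.restrict (Omega L)) := by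
      intro q
      obtain ⟨C, hC⟩ := hcpt.exists_bound_of_continuous hφ.continuous
      exact (hint q).mul_bdd hφ.continuous.aestronglyMeasurable (ae_of_all _ hC)
    have h2 : ∫ p in Omega L, (wderiv L e f p * φ p - g p * φ p) = 0 := by
      rw [integral_sub (h1 _) (h1 _)]
      have e1 := hc φ hφ hcpt hsupp
      have e2 := h φ hφ hcpt hsupp
      linarith
    rw [← setIntegral_eq_integral_of_forall_compl_eq_zero (s := Omega L)]
    · rw [← h2]
      congr 1
      ext p
      simp only [smul_eq_mul]
      ring
    · intro p hp
      rw [image_eq_zero_of_notMem_tsupport (fun hm => hp (hsupp hm)), zero_smul]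
  refine Lp.ext ?_
  have hz' := (ae_restrict_iff' (μ := volume) hopen.measurableSet).2 hz
  filter_upwards [hz'] with p hp
  linarith

/-- `f ∈ H¹(Ω)` has the traces `l`, `r`, `b`, `t` on the left, right, bottom and top sides: some
functions that are smooth up to the boundary converge to `f` in `H¹(Ω)`, and their restrictions to
the four sides converge in `L²(0,L)` to `l`, `r`, `b`, `t`. -/
def HasBoundaryValues (L : ℝ) (f : L2Omega L) (l r b t : L2Side L) : Prop :=
  ∃ φ : ℕ → ℝ × ℝ → ℝ, (∀ n, ContDiff ℝ (⊤ : ℕ∞) (φ n)) ∧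
    Tendsto (fun n => eLpNorm (fun p => φ n p - f p) 2 (mu L)) atTop (𝓝 0) ∧
    (∀ e ∈ ({ex, ey} : Set (ℝ × ℝ)),
      Tendsto (fun n => eLpNorm (fun p => fderiv ℝ (φ n) p e - wderiv L e f p) 2 (mu L))
        atTop (𝓝 0)) ∧
    Tendsto (fun n => eLpNorm (fun y => φ n (0, y) - l y) 2 (volume.restrict (Ioo 0 L)))
      atTop (𝓝 0) ∧
    Tendsto (fun n => eLpNorm (fun y => φ n (L, y) - r y) 2 (volume.restrict (Ioo 0 L)))
      atTop (𝓝 0) ∧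
    Tendsto (fun n => eLpNorm (fun x => φ n (x, 0) - b x) 2 (volume.restrict (Ioo 0 L)))
      atTop (𝓝 0) ∧
    Tendsto (fun n => eLpNorm (fun x => φ n (x, L) - t x) 2 (volume.restrict (Ioo 0 L)))
      atTop (𝓝 0)

/-- `f ∈ H¹(Ω)`. -/
def MemH1 (L : ℝ) (f : L2Omega L) : Prop :=
  ∀ e ∈ ({ex, ey} : Set (ℝ × ℝ)), ∃ g, HasWeakDeriv L e f g

/-- `f ∈ H_P¹(Ω)`: the traces on opposite sides agree. -/
def MemHP1 (L : ℝ) (f : L2Omega L) : Prop :=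
  MemH1 L f ∧ ∃ s s' : L2Side L, HasBoundaryValues L f s s s' s'

/-- `f ∈ H_P²(Ω)`: `f`, `f_x` and `f_y` are in `H_P¹(Ω)`. -/
def MemHP2 (L : ℝ) (f : L2Omega L) : Prop :=
  MemHP1 L f ∧ MemHP1 L (wderiv L ex f) ∧ MemHP1 L (wderiv L ey f)

/-- `u ∈ C([0,T], H_P²(Ω))`; continuity in the `H²` norm is continuity in `L²` of all
derivatives of order at most two. -/
def MemCHP2 (L T : ℝ) (u : ℝ → L2Omega L) : Prop :=
  (∀ t ∈ Icc 0 T, MemHP2 L (u t)) ∧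
  ContinuousOn u (Icc 0 T) ∧
  (∀ e ∈ ({ex, ey} : Set (ℝ × ℝ)), ContinuousOn (fun t => wderiv L e (u t)) (Icc 0 T)) ∧
  (∀ e ∈ ({ex, ey} : Set (ℝ × ℝ)), ∀ e' ∈ ({ex, ey} : Set (ℝ × ℝ)),
    ContinuousOn (fun t => wderiv L e' (wderiv L e (u t))) (Icc 0 T))

/-- `(I - Δ) f`. -/
def helmholtz (L : ℝ) (f : L2Omega L) : L2Omega L :=
  f - (wderiv L ex (wderiv L ex f) + wderiv L ey (wderiv L ey f))

/-! ### The hyperbolic equation -/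

/-- `V(u) · ∇v = - u_y v_x + u_x v_y`. -/
def advect (L : ℝ) (u v : L2Omega L) (p : ℝ × ℝ) : ℝ :=
  - wderiv L ey u p * wderiv L ex v p + wderiv L ex u p * wderiv L ey v p

/-- `w ∈ L²(0,T; L²(Ω))`. -/
def MemL2L2 (L T : ℝ) (w : ℝ → L2Omega L) : Prop :=
  MemLp w 2 (volume.restrict (Ioc 0 T))

/-- `V(u) · ∇v ∈ L²(0,t; L²(Ω))`. -/
def AdvectMemL2 (L t : ℝ) (u : ℝ → L2Omega L) (v : L2Omega L) : Prop :=
  ∃ G : ℝ → L2Omega L, MemL2L2 L t G ∧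
    ∀ᵐ s ∂(volume.restrict (Ioc 0 t)), G s =ᵐ[mu L] advect L (u s) v

/-- `(V(u(s)) · ∇v, w(s))`. -/
def advectPairing (L : ℝ) (u w : ℝ → L2Omega L) (v : L2Omega L) (s : ℝ) : ℝ :=
  ∫ p in Omega L, advect L (u s) v p * w s p

/-- `I` is the value of `∫₀ᵗ (V(u(s)) · ∇v, w(s)) ds`, understood as the limit of the same
integral along test functions `vₙ → v` in `H_P¹(Ω)` with `V(u) · ∇vₙ ∈ L²(0,t; L²(Ω))`;
such a sequence exists, and every such sequence gives the value `I`. -/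
def HasAdvectIntegral (L : ℝ) (u w : ℝ → L2Omega L) (v : L2Omega L) (t I : ℝ) : Prop :=
  let Approx : (ℕ → L2Omega L) → Prop := fun vs =>
    (∀ n, MemHP1 L (vs n) ∧ AdvectMemL2 L t u (vs n)) ∧
    Tendsto vs atTop (𝓝 v) ∧
    ∀ e ∈ ({ex, ey} : Set (ℝ × ℝ)),
      Tendsto (fun n => wderiv L e (vs n)) atTop (𝓝 (wderiv L e v))
  (∃ vs, Approx vs) ∧
  ∀ vs, Approx vs → Tendsto (fun n => ∫ s in (0 : ℝ)..t, advectPairing L u w (vs n) s) atTop (𝓝 I)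

/-- `w` is a weak solution, in the time-integrated sense, of `w_t + V(u) · ∇w = k u_y` with
`w(0) = (I - Δ) u(0)`. For `v ∈ H_P¹(Ω)` with `V(u) · ∇v ∈ L²(0,t; L²(Ω))` the integral of
`(V(u) · ∇v, w)` is a Lebesgue integral; for the other `v ∈ H_P¹(Ω)` the product
`(V(u) · ∇v) w` need not be integrable, and the integral is the limit above. -/
def IsWeakSolution (L T k : ℝ) (u w : ℝ → L2Omega L) : Prop :=
  MemL2L2 L T w ∧
  ∀ v : L2Omega L, MemHP1 L v → ∀ t ∈ Ioc 0 T,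
    (∃ I : ℝ, HasAdvectIntegral L u w v t I ∧
      inner ℝ (w t - helmholtz L (u 0)) v
        = I + ∫ s in (0 : ℝ)..t, k * inner ℝ (wderiv L ey (u s)) v) ∧
    (AdvectMemL2 L t u v →
      IntervalIntegrable (advectPairing L u w v) volume 0 t ∧
      inner ℝ (w t - helmholtz L (u 0)) v
        = ∫ s in (0 : ℝ)..t, (advectPairing L u w v s + k * inner ℝ (wderiv L ey (u s)) v))

/-! ### Spectral Galerkin solutions -/

/-- The real Fourier basis of `L²(Ω)`, made of the real and imaginary parts of the exponentials
`exp (2 π i ξ · x / L)`: the cosine for one and the sine for the other of `ξ` and `-ξ`. -/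
def fourierFun (L : ℝ) (ξ : ℤ × ℤ) (p : ℝ × ℝ) : ℝ :=
  if ξ = 0 then 1 / L
  else if 0 < ξ.1 ∨ (ξ.1 = 0 ∧ 0 < ξ.2) then
    √2 / L * Real.cos (2 * Real.pi * (ξ.1 * p.1 + ξ.2 * p.2) / L)
  else √2 / L * Real.sin (2 * Real.pi * (ξ.1 * p.1 + ξ.2 * p.2) / L)

theorem memLp_fourierFun (L : ℝ) (ξ : ℤ × ℤ) : MemLp (fourierFun L ξ) 2 (mu L) := by
  unfold fourierFun
  split_ifs
  · exact memLp_const _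
  · refine MemLp.of_bound (Continuous.aestronglyMeasurable (by fun_prop)) |√2 / L|
      (ae_of_all _ fun p => ?_)
    rw [Real.norm_eq_abs, abs_mul]
    exact mul_le_of_le_one_right (abs_nonneg _) (Real.abs_cos_le_one _)
  · refine MemLp.of_bound (Continuous.aestronglyMeasurable (by fun_prop)) |√2 / L|
      (ae_of_all _ fun p => ?_)
    rw [Real.norm_eq_abs, abs_mul]
    exact mul_le_of_le_one_right (abs_nonneg _) (Real.abs_sin_le_one _)

/-- The basis function as an element of `L²(Ω)`. -/
def fourierVec (L : ℝ) (ξ : ℤ × ℤ) : L2Omega L := (memLp_fourierFun L ξ).toLp _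

/-- The eigenvalue of `I - Δ` on the basis function with index `ξ`. -/
def eigenvalue (L : ℝ) (ξ : ℤ × ℤ) : ℝ :=
  1 + 4 * Real.pi ^ 2 * ((ξ.1 : ℝ) ^ 2 + (ξ.2 : ℝ) ^ 2) / L ^ 2

/-- An enumeration of the basis by nondecreasing eigenvalue. -/
def IsEigenOrdering (L : ℝ) (σ : ℕ ≃ ℤ × ℤ) : Prop :=
  Monotone fun j => eigenvalue L (σ j)

/-- Such enumerations exist. -/
theorem exists_isEigenOrdering (L : ℝ) : ∃ σ : ℕ ≃ ℤ × ℤ, IsEigenOrdering L σ := by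
  let n : ℤ × ℤ → ℤ := fun ξ => ξ.1 ^ 2 + ξ.2 ^ 2
  let c : ℤ × ℤ → ℤ := fun ξ => (ξ.1 + n ξ) * (2 * n ξ + 1) + (ξ.2 + n ξ)
  let f : ℤ × ℤ → ℤ := fun ξ => (2 * n ξ + 1) ^ 3 + c ξ
  have hself : ∀ a : ℤ, |a| ≤ a ^ 2 := fun a => by
    rw [← sq_abs]
    rcases (abs_nonneg a).eq_or_lt with h | h
    · rw [← h]; norm_num
    · nlinarith
  have hb : ∀ ξ : ℤ × ℤ, 0 ≤ n ξ ∧ 0 ≤ ξ.1 + n ξ ∧ ξ.1 + n ξ ≤ 2 * n ξ ∧ 0 ≤ ξ.2 + n ξ ∧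
      ξ.2 + n ξ ≤ 2 * n ξ := by
    intro ξ
    have h1 := abs_le.1 (hself ξ.1)
    have h2 := abs_le.1 (hself ξ.2)
    have h3 := sq_nonneg ξ.1
    have h4 := sq_nonneg ξ.2
    simp only [n]
    refine ⟨?_, ?_, ?_, ?_, ?_⟩ <;> linarith [h1.1, h1.2, h2.1, h2.2]
  have hc : ∀ ξ, 0 ≤ c ξ ∧ c ξ < (2 * n ξ + 1) ^ 2 := by
    intro ξ
    obtain ⟨h0, h1, h2, h3, h4⟩ := hb ξ
    have := mul_nonneg h1 (by linarith : 0 ≤ 2 * n ξ + 1)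
    have := mul_le_mul_of_nonneg_right h2 (by linarith : 0 ≤ 2 * n ξ + 1)
    simp only [c]
    constructor <;> nlinarith
  have hlt : ∀ ξ η, n ξ < n η → f ξ < f η := by
    intro ξ η h
    have h0 := (hb ξ).1
    have h1 := (hc ξ).2
    have h2 := (hc η).1
    have h3 : (2 * n ξ + 1 + 2) ^ 3 ≤ (2 * n η + 1) ^ 3 :=
      pow_le_pow_left₀ (by linarith) (by linarith) 3
    simp only [f]
    nlinarith [pow_nonneg h0 2]
  have hinj : Function.Injective f := by
    intro ξ η h
    have hn : n ξ = n η := by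
      rcases lt_trichotomy (n ξ) (n η) with h' | h' | h'
      · exact absurd h (hlt _ _ h').ne
      · exact h'
      · exact absurd h (hlt _ _ h').ne'
    obtain ⟨h0, h1, h2, h3, h4⟩ := hb ξ
    obtain ⟨k0, k1, k2, k3, k4⟩ := hb η
    have hcc : c ξ = c η := by
      simp only [f, hn] at h
      linarith
    simp only [c] at hcc
    rw [hn] at hcc h3 h4
    have key : ξ.1 = η.1 := by
      rcases lt_trichotomy ξ.1 η.1 with h' | h' | h'
      · nlinarith
      · exact h'
      · nlinarith
    refine Prod.ext key ?_
    rw [key] at hcc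
    linarith
  have hpos : ∀ ξ, 0 ≤ f ξ := fun ξ => by
    have := (hc ξ).1
    have := pow_nonneg (by linarith [(hb ξ).1] : 0 ≤ 2 * n ξ + 1) 3
    simp only [f]
    linarith
  let F : ℤ × ℤ → ℕ := fun ξ => (f ξ).toNat
  have hF : ∀ ξ, (F ξ : ℤ) = f ξ := fun ξ => Int.toNat_of_nonneg (hpos ξ)
  have hFinj : Function.Injective F := fun ξ η h => hinj (by rw [← hF, ← hF, h])
  have : Infinite (Set.range F) := Set.infinite_coe_iff.2 (Set.infinite_range_of_injective hFinj)
  classical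
  let o := Nat.Subtype.orderIsoOfNat (Set.range F)
  let τ := Equiv.ofInjective F hFinj
  refine ⟨o.toEquiv.trans τ.symm, fun i j hij => ?_⟩
  have hτ : ∀ i, F (τ.symm (o i)) = (o i : ℕ) := fun i =>
    congrArg Subtype.val (τ.apply_symm_apply (o i))
  have hle : n (τ.symm (o i)) ≤ n (τ.symm (o j)) := by
    by_contra hcon
    have h1 := hlt _ _ (not_le.1 hcon)
    rw [← hF, ← hF, hτ, hτ] at h1
    have h2 : (o i : ℕ) ≤ (o j : ℕ) := o.monotone hij
    omega
  have hle' : ((τ.symm (o i)).1 : ℝ) ^ 2 + ((τ.symm (o i)).2 : ℝ) ^ 2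
      ≤ ((τ.symm (o j)).1 : ℝ) ^ 2 + ((τ.symm (o j)).2 : ℝ) ^ 2 := by
    exact_mod_cast hle
  simp only [eigenvalue, Equiv.trans_apply]
  have h4 : 0 ≤ 4 * Real.pi ^ 2 := by positivity
  exact (add_le_add_iff_left 1).2
    (div_le_div_of_nonneg_right (mul_le_mul_of_nonneg_left hle' h4) (sq_nonneg L))

/-- `E_N`, the span of the first `N` basis functions. -/
def galerkinSpace (L : ℝ) (σ : ℕ ≃ ℤ × ℤ) (N : ℕ) : Submodule ℝ (L2Omega L) :=
  Submodule.span ℝ (Set.range fun j : Fin N => fourierVec L (σ j))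

instance instFiniteDimensionalGalerkinSpace (L : ℝ) (σ : ℕ ≃ ℤ × ℤ) (N : ℕ) :
    FiniteDimensional ℝ (galerkinSpace L σ N) :=
  FiniteDimensional.span_of_finite ℝ (Set.finite_range _)

/-- `W ∈ C¹((0,T), E_N) ∩ C([0,T], E_N)` solves the Galerkin system associated to `u`:
`(W', v) = (V(u) · ∇v, W) + k (u_y, v)` for `v ∈ E_N`, `t ∈ (0,T)`, and
`W(0) = (I - Δ) proj_{E_N} u(0)`. -/
def IsSpectralSolution (L T k : ℝ) (σ : ℕ ≃ ℤ × ℤ) (N : ℕ) (u W : ℝ → L2Omega L) : Prop :=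
  (∀ t ∈ Icc 0 T, W t ∈ galerkinSpace L σ N) ∧
  ContinuousOn W (Icc 0 T) ∧
  DifferentiableOn ℝ W (Ioo 0 T) ∧
  ContinuousOn (deriv W) (Ioo 0 T) ∧
  (∀ v ∈ galerkinSpace L σ N, ∀ t ∈ Ioo 0 T,
    inner ℝ (deriv W t) v
      = advectPairing L u W v t + k * inner ℝ (wderiv L ey (u t)) v) ∧
  W 0 = helmholtz L ((galerkinSpace L σ N).starProjection (u 0))

/-- `Wⱼ` converges weakly to `w` in `L²(0,T; L²(Ω))`. -/
def WeaklyConvergesL2L2 (L T : ℝ) (W : ℕ → ℝ → L2Omega L) (w : ℝ → L2Omega L) : Prop :=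
  ∀ g : ℝ → L2Omega L, MemL2L2 L T g →
    Tendsto (fun j => ∫ s in (0 : ℝ)..T, inner ℝ (W j s) (g s)) atTop
      (𝓝 (∫ s in (0 : ℝ)..T, inner ℝ (w s) (g s)))

end HasegawaMima

end

/-!
The proof is a spectral Galerkin method together with a passage to the limit in which the only
delicate point is the class of test functions.

**Approximation.** On `E_N` the Galerkin system is a linear ordinary differential equation with
continuous coefficients, solvable on all of `[0,T]` (`exists_solution_linear_ode`). The field `V(u)`
is divergence free, so `(V(u) · ∇w, w) = 0` for smooth periodic `w` (`inner_advectVec_self`), and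
since `I - Δ` commutes with the projection to `E_N`, the energy estimate
`IsSpectralSolution.norm_le` bounds the approximations uniformly in `N` and `t`. Each of their
Fourier coefficients is Lipschitz in time uniformly in `N`, so a subsequence converges weakly in
`L²(Ω)` at *every* time (`exists_subseq_tendsto_of_lipschitz`, `exists_weak_limit`). The limit `w`
satisfies the integrated equation for all trigonometric polynomials `v`.

**Test functions.** It remains to replace trigonometric polynomials by an arbitrary `v ∈ H_P¹(Ω)`
with `V(u) · ∇v ∈ L²(0,t; L²(Ω))`; the equation for the other `v`, as a limit, follows from this
case because the remaining terms of the equation are continuous in `v`. Let `mollify L n` be the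
Fourier multiplier whose kernel `kernel L n x y` is proportional to
`cos^{2n}(π (x₁ - y₁) / L) cos^{2n}(π (x₂ - y₂) / L)`. The kernel is a nonnegative trigonometric
polynomial, its height is `O(n)`, and its symbol differs from `1` by at most `|ξ|² / n`.
For `f ∈ H_P¹(Ω)` and `g ∈ L²(Ω)` the commutator `f (K g) - K (f g)`, with `K` the smoothing
operator, is at `x` the integral of `kernel L n x y * (f x - f y) * g y` over `y`, and by the
Cauchy-Schwarz inequality its square is at most
`(∫ kernel L n x y * (f x - f y)² dy) * (sup kernel) * ‖g‖²`.
The integral of the first factor over `x` is `2 (‖f‖² - (f, K f)) = O(‖∇f‖² / n)`, so that the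
commutator has `L²(Ω)` norm `O(‖g‖ ‖∇f‖)`, uniformly in `n` (`exists_commutator`). With
`f` a component of `V(u)` and `g` one of `∇v` this shows that `V(u) · ∇(mollify L n v)` stays
bounded by `‖V(u) · ∇v‖` plus a constant (`norm_advectVec_mollify_le`). Hence it converges weakly to
`V(u) · ∇v` at almost every time, and dominated convergence in time gives the equation for `v`.

The same kernel yields the completeness of the Fourier basis
(`eq_zero_of_inner_fourierVec_eq_zero`).
-/

namespace HasegawaMima

/-! ### Normalised central binomial weights -/

/-- The weight `C(2n, n + |k|) / C(2n, n)`, the `k`-th Fourier coefficient of the kernel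
proportional to `((1 + cos θ) / 2) ^ n`, normalised to have mean one. -/
noncomputable def binomWeight (n : ℕ) (k : ℤ) : ℝ :=
  ((2 * n).choose (n + k.natAbs) : ℝ) / n.centralBinom

theorem binomWeight_nonneg (n : ℕ) (k : ℤ) : 0 ≤ binomWeight n k := by
  unfold binomWeight; positivity

theorem binomWeight_neg (n : ℕ) (k : ℤ) : binomWeight n (-k) = binomWeight n k := by
  simp [binomWeight]

theorem binomWeight_zero (n : ℕ) : binomWeight n 0 = 1 := by
  have : (n.centralBinom : ℝ) ≠ 0 := by exact_mod_cast n.centralBinom_ne_zero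
  simp only [binomWeight, Int.natAbs_zero, add_zero, ← Nat.centralBinom_eq_two_mul_choose]
  exact div_self this

theorem binomWeight_le_one (n : ℕ) (k : ℤ) : binomWeight n k ≤ 1 := by
  have : (0 : ℝ) < n.centralBinom := by exact_mod_cast n.centralBinom_pos
  rw [binomWeight, div_le_one this]
  exact_mod_cast Nat.choose_le_centralBinom _ n

/-- The weights are close to one at low frequencies: consecutive weights have the ratio
`1 - (2j + 1) / (n + j + 1)`. -/
theorem one_sub_binomWeight_le {n : ℕ} (hn : 1 ≤ n) (k : ℤ) :
    1 - binomWeight n k ≤ (k : ℝ) ^ 2 / n := by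
  have hn' : (0 : ℝ) < n := by exact_mod_cast hn
  have key : ∀ j : ℕ, 1 - binomWeight n j ≤ (j : ℝ) ^ 2 / n := by
    intro j
    induction j with
    | zero => simp [binomWeight_zero]
    | succ j ih =>
      have h0 := binomWeight_nonneg n j
      have h1 := binomWeight_le_one n j
      have hrec : binomWeight n (j + 1 : ℕ) * (n + j + 1) = binomWeight n j * (n - j) := by
        have hc := Nat.choose_succ_right_eq (2 * n) (n + j)
        have hc' : ((2 * n).choose (n + j + 1) : ℝ) * (n + j + 1)
            = (2 * n).choose (n + j) * (n - j) := by
          rcases le_or_gt j n with hj | hj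
          · have : 2 * n - (n + j) = n - j := by omega
            rw [this] at hc
            have := congrArg (Nat.cast : ℕ → ℝ) hc
            push_cast [Nat.cast_sub hj] at this
            exact this
          · rw [Nat.choose_eq_zero_of_lt (by omega : 2 * n < n + j + 1),
              Nat.choose_eq_zero_of_lt (by omega : 2 * n < n + j)]
            simp
        simp only [binomWeight, Int.natAbs_natCast]
        rw [div_mul_eq_mul_div, div_mul_eq_mul_div, ← add_assoc, hc']
      have hpos : (0 : ℝ) < n + j + 1 := by positivity
      have h2 : binomWeight n j - binomWeight n (j + 1 : ℕ) ≤ (2 * j + 1) / n := by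
        have e : binomWeight n j - binomWeight n (j + 1 : ℕ)
            = binomWeight n j * (2 * j + 1) / (n + j + 1) := by
          rw [eq_div_iff hpos.ne', sub_mul, hrec]; ring
        rw [e]
        apply div_le_div₀ (by positivity) _ hn' (by linarith [(Nat.cast_nonneg j : (0:ℝ) ≤ j)])
        exact mul_le_of_le_one_left (by positivity) h1
      have h3 : ((j + 1 : ℕ) : ℝ) ^ 2 / n = (j : ℝ) ^ 2 / n + (2 * j + 1) / n := by
        push_cast; ring
      linarith
  have h := key k.natAbs
  have e : binomWeight n k = binomWeight n (k.natAbs : ℤ) := by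
    simp only [binomWeight, Int.natAbs_natCast]
  rw [e]
  refine h.trans (le_of_eq ?_)
  rw [Nat.cast_natAbs, Int.cast_abs, sq_abs]

/-- The height of the one-dimensional kernel grows like `√n`. -/
theorem four_pow_div_centralBinom_sq_le (n : ℕ) :
    ((4 : ℝ) ^ n / n.centralBinom) ^ 2 ≤ 4 * n + 1 := by
  induction n with
  | zero => simp
  | succ n ih =>
    have h0 : (0 : ℝ) < n.centralBinom := by exact_mod_cast n.centralBinom_pos
    have h1 : (0 : ℝ) < (n + 1).centralBinom := by exact_mod_cast (n + 1).centralBinom_pos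
    have hs : ((n : ℝ) + 1) * (n + 1).centralBinom = 2 * (2 * n + 1) * n.centralBinom := by
      exact_mod_cast Nat.succ_mul_centralBinom_succ n
    have e : (4 : ℝ) ^ (n + 1) / (n + 1).centralBinom
        = (4 ^ n / n.centralBinom) * ((2 * n + 2) / (2 * n + 1)) := by
      rw [div_mul_div_comm, div_eq_div_iff h1.ne' (by positivity), pow_succ]
      linear_combination (2 * (4 : ℝ) ^ n) * (-hs)
    rw [e, mul_pow, div_pow (2 * (n : ℝ) + 2)]
    have h2 : (0 : ℝ) < (2 * n + 1) ^ 2 := by positivity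
    calc ((4 : ℝ) ^ n / n.centralBinom) ^ 2 * ((2 * n + 2) ^ 2 / (2 * n + 1) ^ 2)
        ≤ (4 * n + 1) * ((2 * n + 2) ^ 2 / (2 * n + 1) ^ 2) := by gcongr
      _ ≤ 4 * ((n + 1 : ℕ) : ℝ) + 1 := by
          rw [← mul_div_assoc, div_le_iff₀ h2]
          push_cast
          nlinarith

/-- The weights are the Fourier coefficients of a power of `(1 + cos θ) / 2`. -/
theorem sum_binomWeight_mul_exp (n : ℕ) (θ : ℝ) :
    ∑ k ∈ Finset.Icc (-n : ℤ) n, (binomWeight n k : ℂ) * Complex.exp (k * θ * Complex.I)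
      = (((4 : ℝ) ^ n / n.centralBinom * ((1 + Real.cos θ) / 2) ^ n : ℝ) : ℂ) := by
  set z := Complex.exp (θ * Complex.I) with hz
  have hz0 : z ≠ 0 := Complex.exp_ne_zero _
  have hexp : ∀ k : ℤ, Complex.exp (k * θ * Complex.I) = z ^ k := by
    intro k
    rw [hz, ← Complex.exp_int_mul]; ring_nf
  have hcos : ((1 + Real.cos θ) / 2 : ℂ) = (1 + z) ^ 2 / (4 * z) := by
    rw [Complex.ofReal_cos, Complex.cos]
    have : Complex.exp (-(θ : ℂ) * Complex.I) = z⁻¹ := by rw [hz, ← Complex.exp_neg]; ring_nf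
    rw [this, ← hz]
    field_simp
    ring
  have hsum : ∑ k ∈ Finset.Icc (-n : ℤ) n, ((2 * n).choose (n + k.natAbs) : ℂ) * z ^ k
      = (1 + z) ^ (2 * n) / z ^ n := by
    rw [add_comm 1 z, add_pow, Finset.sum_div]
    refine Finset.sum_nbij' (fun k => (k + n).toNat) (fun j => (j : ℤ) - n) ?_ ?_ ?_ ?_ ?_
    · intro k hk; simp only [Finset.mem_Icc, Finset.mem_range] at *; omega
    · intro k hk; simp only [Finset.mem_Icc, Finset.mem_range] at *; omega
    · intro k hk; simp only [Finset.mem_Icc] at *; omega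
    · intro k hk; simp only [Finset.mem_range] at *; omega
    · intro k hk
      simp only [Finset.mem_Icc] at hk
      obtain ⟨j, hj⟩ : ∃ j : ℕ, k + n = j := ⟨(k + n).toNat, by omega⟩
      have hk' : k = j - n := by omega
      have hch : (2 * n).choose (n + k.natAbs) = (2 * n).choose j := by
        rcases le_total 0 k with h | h
        · congr 1; omega
        · rw [← Nat.choose_symm (by omega : j ≤ 2 * n)]; congr 1; omega
      rw [hch, hj, Int.toNat_natCast, one_pow, mul_one, hk', zpow_sub₀ hz0]
      simp only [zpow_natCast]
      ring
  have : ∀ k : ℤ, (binomWeight n k : ℂ) * Complex.exp (k * θ * Complex.I)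
      = ((2 * n).choose (n + k.natAbs) : ℂ) * z ^ k / n.centralBinom := by
    intro k
    rw [hexp, binomWeight]
    push_cast
    ring
  simp_rw [this]
  rw [← Finset.sum_div, hsum]
  push_cast
  push_cast at hcos
  rw [hcos, div_pow, ← pow_mul, mul_pow]
  have h4 : (4 : ℂ) ^ n ≠ 0 := by simp
  have hc : (n.centralBinom : ℂ) ≠ 0 := by exact_mod_cast n.centralBinom_ne_zero
  field_simp

/-- The two-dimensional cosine sum is the real part of a product of two exponential sums, which are
real. -/
theorem sum_binomWeight_mul_cos (n : ℕ) (θ θ' : ℝ) :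
    ∑ ξ ∈ Finset.Icc (-n : ℤ) n ×ˢ Finset.Icc (-n : ℤ) n,
        binomWeight n ξ.1 * binomWeight n ξ.2 * Real.cos (ξ.1 * θ + ξ.2 * θ')
      = ((4 : ℝ) ^ n / n.centralBinom) ^ 2
          * (((1 + Real.cos θ) / 2) ^ n * ((1 + Real.cos θ') / 2) ^ n) := by
  have h := congrArg₂ (· * ·) (sum_binomWeight_mul_exp n θ) (sum_binomWeight_mul_exp n θ')
  simp only [Finset.sum_mul_sum] at h
  rw [← Finset.sum_product', ← Complex.ofReal_mul] at h
  have h' := congrArg Complex.re h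
  rw [Complex.ofReal_re, Complex.re_sum] at h'
  calc _ = _ := Finset.sum_congr rfl fun ξ _ => ?_
    _ = _ := h'
    _ = _ := by ring
  have e : (binomWeight n ξ.1 : ℂ) * Complex.exp (ξ.1 * θ * Complex.I)
      * ((binomWeight n ξ.2 : ℂ) * Complex.exp (ξ.2 * θ' * Complex.I))
      = ((binomWeight n ξ.1 * binomWeight n ξ.2 : ℝ) : ℂ)
        * Complex.exp (((ξ.1 * θ + ξ.2 * θ' : ℝ) : ℂ) * Complex.I) := by
    rw [mul_mul_mul_comm, ← Complex.exp_add]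
    push_cast
    ring_nf
  rw [e, Complex.re_ofReal_mul, Complex.exp_ofReal_mul_I_re]


/-! ### Integrals over the square and the `L²` pairing -/

theorem _root_.Continuous.memLp_mu {L : ℝ} {q : ENNReal} {g : ℝ × ℝ → ℝ} (hg : Continuous g) :
    MemLp g q (mu L) := by
  obtain ⟨C, hC⟩ := ((isCompact_Icc (a := (0 : ℝ)) (b := L)).prod
    (isCompact_Icc (a := (0 : ℝ)) (b := L))).exists_bound_of_continuousOn hg.continuousOn
  refine MemLp.of_bound hg.aestronglyMeasurable C ?_
  refine (ae_restrict_iff' (measurableSet_Ioo.prod measurableSet_Ioo)).2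
    (ae_of_all _ fun p hp => ?_)
  exact hC p ⟨Ioo_subset_Icc_self hp.1, Ioo_subset_Icc_self hp.2⟩

theorem _root_.Continuous.memLp_side {L : ℝ} {q : ENNReal} {g : ℝ → ℝ} (hg : Continuous g) :
    MemLp g q (volume.restrict (Ioo (0 : ℝ) L)) := by
  obtain ⟨C, hC⟩ := (isCompact_Icc (a := (0 : ℝ)) (b := L)).exists_bound_of_continuousOn
    hg.continuousOn
  refine MemLp.of_bound hg.aestronglyMeasurable C ?_
  exact (ae_restrict_iff' measurableSet_Ioo).2 (ae_of_all _ fun p hp =>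
    hC p (Ioo_subset_Icc_self hp))

theorem inner_eq_integral {L : ℝ} (f g : L2Omega L) :
    inner ℝ f g = ∫ p in Omega L, f p * g p := by
  rw [L2.inner_def]
  exact integral_congr_ae (ae_of_all _ fun p => by simp [mul_comm])

theorem integrable_mul {L : ℝ} (f g : L2Omega L) : Integrable (fun p => f p * g p) (mu L) :=
  (Lp.memLp f).integrable_mul (Lp.memLp g)

theorem norm_sq_eq_integral {L : ℝ} (f : L2Omega L) :
    ‖f‖ ^ 2 = ∫ p in Omega L, f p ^ 2 := by
  rw [← real_inner_self_eq_norm_sq, inner_eq_integral]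
  simp_rw [sq]

theorem tendsto_integral_mul_of_tendsto_eLpNorm {α : Type*} [MeasurableSpace α] {μ : Measure α}
    {F : ℕ → α → ℝ} {f h : α → ℝ} (hF : ∀ n, MemLp (F n) 2 μ) (hf : MemLp f 2 μ)
    (hh : MemLp h 2 μ) (hlim : Tendsto (fun n => eLpNorm (fun p => F n p - f p) 2 μ) atTop (𝓝 0)) :
    Tendsto (fun n => ∫ p, F n p * h p ∂μ) atTop (𝓝 (∫ p, f p * h p ∂μ)) := by
  have key : ∀ {a : α → ℝ} (ha : MemLp a 2 μ),
      ∫ p, a p * h p ∂μ = inner ℝ (ha.toLp a) (hh.toLp h) := by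
    intro a ha
    rw [L2.inner_def]
    refine integral_congr_ae ?_
    filter_upwards [ha.coeFn_toLp, hh.coeFn_toLp] with p h1 h2
    simp [h1, h2, mul_comm]
  simp_rw [key (hF _), key hf]
  exact ((Lp.tendsto_Lp_iff_tendsto_eLpNorm'' F hF f hf).2 hlim).inner tendsto_const_nhds

/-- The fundamental theorem of calculus in the first variable. -/
theorem integral_fderiv_ex {L : ℝ} (hL : 0 < L) {g : ℝ × ℝ → ℝ} (hg : ContDiff ℝ 1 g) :
    ∫ p in Omega L, fderiv ℝ g p ex = ∫ y in Ioo 0 L, (g (L, y) - g (0, y)) := by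
  have hc : Continuous fun p => fderiv ℝ g p ex :=
    (hg.continuous_fderiv one_ne_zero).clm_apply continuous_const
  have hint : IntegrableOn (fun p => fderiv ℝ g p ex) (Ioo 0 L ×ˢ Ioo 0 L) (volume.prod volume) :=
    memLp_one_iff_integrable.1 (hc.memLp_mu (L := L))
  rw [Omega, Measure.volume_eq_prod, ← Measure.prod_restrict,
    integral_prod_symm _ (by rw [Measure.prod_restrict]; exact hint)]
  refine integral_congr_ae (ae_of_all _ fun y => ?_)
  simp only
  rw [← integral_Ioc_eq_integral_Ioo, ← intervalIntegral.integral_of_le hL.le]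
  refine intervalIntegral.integral_eq_sub_of_hasDerivAt (f := fun x => g (x, y)) (fun x _ => ?_)
    (Continuous.intervalIntegrable (by fun_prop) _ _)
  have h1 : HasFDerivAt g (fderiv ℝ g (x, y)) (x, y) :=
    (hg.differentiable one_ne_zero).differentiableAt.hasFDerivAt
  exact h1.comp_hasDerivAt x ((hasDerivAt_id x).prodMk (hasDerivAt_const x y))

/-- The fundamental theorem of calculus in the second variable. -/
theorem integral_fderiv_ey {L : ℝ} (hL : 0 < L) {g : ℝ × ℝ → ℝ} (hg : ContDiff ℝ 1 g) :
    ∫ p in Omega L, fderiv ℝ g p ey = ∫ x in Ioo 0 L, (g (x, L) - g (x, 0)) := by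
  have hc : Continuous fun p => fderiv ℝ g p ey :=
    (hg.continuous_fderiv one_ne_zero).clm_apply continuous_const
  have hint : IntegrableOn (fun p => fderiv ℝ g p ey) (Ioo 0 L ×ˢ Ioo 0 L) (volume.prod volume) :=
    memLp_one_iff_integrable.1 (hc.memLp_mu (L := L))
  rw [Omega, Measure.volume_eq_prod, setIntegral_prod _ hint]
  refine integral_congr_ae (ae_of_all _ fun x => ?_)
  simp only
  rw [← integral_Ioc_eq_integral_Ioo, ← intervalIntegral.integral_of_le hL.le]
  refine intervalIntegral.integral_eq_sub_of_hasDerivAt (f := fun y => g (x, y)) (fun y _ => ?_)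
    (Continuous.intervalIntegrable (by fun_prop) _ _)
  have h1 : HasFDerivAt g (fderiv ℝ g (x, y)) (x, y) :=
    (hg.differentiable one_ne_zero).differentiableAt.hasFDerivAt
  exact h1.comp_hasDerivAt y ((hasDerivAt_const y x).prodMk (hasDerivAt_id y))

/-! ### Smooth periodic functions -/

/-- `g` is smooth on the plane and `L`-periodic in both variables. -/
def PerSmooth (L : ℝ) (g : ℝ × ℝ → ℝ) : Prop :=
  ContDiff ℝ (⊤ : ℕ∞) g ∧ ∀ p, g (p + (L, 0)) = g p ∧ g (p + (0, L)) = g p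

namespace PerSmooth

variable {L : ℝ} {g h : ℝ × ℝ → ℝ}

theorem continuous (hg : PerSmooth L g) : Continuous g := hg.1.continuous

theorem contDiff_one (hg : PerSmooth L g) : ContDiff ℝ 1 g := hg.1.of_le (by exact_mod_cast le_top)

theorem differentiableAt (hg : PerSmooth L g) (p : ℝ × ℝ) : DifferentiableAt ℝ g p :=
  hg.contDiff_one.differentiable one_ne_zero p

theorem right_eq_left (hg : PerSmooth L g) (y : ℝ) : g (L, y) = g (0, y) := by
  simpa using (hg.2 (0, y)).1

theorem top_eq_bottom (hg : PerSmooth L g) (x : ℝ) : g (x, L) = g (x, 0) := by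
  simpa using (hg.2 (x, 0)).2

theorem add (hg : PerSmooth L g) (hh : PerSmooth L h) : PerSmooth L (fun p => g p + h p) :=
  ⟨hg.1.add hh.1, fun p => by simp only [hg.2 p, hh.2 p, and_self]⟩

theorem mul (hg : PerSmooth L g) (hh : PerSmooth L h) : PerSmooth L (fun p => g p * h p) :=
  ⟨hg.1.mul hh.1, fun p => by simp only [hg.2 p, hh.2 p, and_self]⟩

theorem const (c : ℝ) : PerSmooth L (fun _ => c) :=
  ⟨contDiff_const, fun _ => ⟨rfl, rfl⟩⟩

theorem fderiv (hg : PerSmooth L g) (e : ℝ × ℝ) : PerSmooth L (fun p => fderiv ℝ g p e) := by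
  refine ⟨(hg.1.fderiv_right (m := (⊤ : ℕ∞)) (by simp)).clm_apply contDiff_const, fun p => ?_⟩
  constructor
  · beta_reduce; rw [← fderiv_comp_add_right]; simp only [(hg.2 _).1]
  · beta_reduce; rw [← fderiv_comp_add_right]; simp only [(hg.2 _).2]

end PerSmooth

/-- `f ∈ L²(Ω)` has a smooth periodic representative. -/
def HasPerSmoothRep (L : ℝ) (f : L2Omega L) : Prop :=
  ∃ g, PerSmooth L g ∧ f =ᵐ[mu L] g

theorem HasPerSmoothRep.add {L : ℝ} {f g : L2Omega L} (hf : HasPerSmoothRep L f)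
    (hg : HasPerSmoothRep L g) : HasPerSmoothRep L (f + g) := by
  obtain ⟨a, ha, ha'⟩ := hf
  obtain ⟨b, hb, hb'⟩ := hg
  refine ⟨_, ha.add hb, ?_⟩
  filter_upwards [ha', hb', Lp.coeFn_add f g] with p h1 h2 h3
  rw [h3, Pi.add_apply, h1, h2]

theorem HasPerSmoothRep.smul {L : ℝ} {f : L2Omega L} (c : ℝ) (hf : HasPerSmoothRep L f) :
    HasPerSmoothRep L (c • f) := by
  obtain ⟨a, ha, ha'⟩ := hf
  refine ⟨_, (PerSmooth.const c).mul ha, ?_⟩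
  filter_upwards [ha', Lp.coeFn_smul c f] with p h1 h3
  rw [h3, Pi.smul_apply, h1, smul_eq_mul]

theorem HasPerSmoothRep.zero {L : ℝ} : HasPerSmoothRep L 0 :=
  ⟨_, PerSmooth.const 0, by filter_upwards [Lp.coeFn_zero ℝ 2 (mu L)] with p h; rw [h]; rfl⟩

theorem HasPerSmoothRep.hasWeakDeriv {L : ℝ} (hL : 0 < L) {f d : L2Omega L} {g : ℝ × ℝ → ℝ}
    (hg : PerSmooth L g) (hf : f =ᵐ[mu L] g) {e : ℝ × ℝ} (he : e ∈ ({ex, ey} : Set (ℝ × ℝ)))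
    (hd : d =ᵐ[mu L] fun p => fderiv ℝ g p e) : HasWeakDeriv L e f d := by
  intro φ hφ _ hsupp
  have hφ1 : ContDiff ℝ 1 φ := hφ.of_le (by exact_mod_cast le_top)
  have hz : ∀ p, p ∉ Omega L → φ p = 0 := fun p hp =>
    image_eq_zero_of_notMem_tsupport fun hm => hp (hsupp hm)
  have hprod : ContDiff ℝ 1 fun p => g p * φ p := hg.contDiff_one.mul hφ1
  have h0 : ∫ p in Omega L, fderiv ℝ (fun p => g p * φ p) p e = 0 := by
    rcases he with rfl | rfl
    · rw [integral_fderiv_ex hL hprod]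
      refine integral_eq_zero_of_ae (ae_of_all _ fun y => ?_)
      have h1 := hz (L, y) (by simp [Omega])
      have h2 := hz (0, y) (by simp [Omega])
      simp [h1, h2]
    · rw [integral_fderiv_ey hL hprod]
      refine integral_eq_zero_of_ae (ae_of_all _ fun y => ?_)
      have h1 := hz (y, L) (by simp [Omega])
      have h2 := hz (y, 0) (by simp [Omega])
      simp [h1, h2]
  have e1 : ∀ p, fderiv ℝ (fun p => g p * φ p) p e
      = g p * fderiv ℝ φ p e + fderiv ℝ g p e * φ p := by
    intro p
    rw [fderiv_fun_mul (hg.differentiableAt p) (hφ1.differentiable one_ne_zero p)]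
    simp [mul_comm]
  have hcφ : Continuous fun p => fderiv ℝ φ p e :=
    (hφ1.continuous_fderiv one_ne_zero).clm_apply continuous_const
  have i1 : Integrable (fun p => g p * fderiv ℝ φ p e) (mu L) :=
    memLp_one_iff_integrable.1 (hg.continuous.mul hcφ).memLp_mu
  have i2 : Integrable (fun p => fderiv ℝ g p e * φ p) (mu L) :=
    memLp_one_iff_integrable.1 ((hg.fderiv e).continuous.mul hφ.continuous).memLp_mu
  simp_rw [e1] at h0
  have h0' := (integral_add i1 i2).symm.trans h0
  have e2 : ∫ p in Omega L, f p * fderiv ℝ φ p e = ∫ p, g p * fderiv ℝ φ p e ∂(mu L) :=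
    integral_congr_ae (by filter_upwards [hf] with p hp; rw [hp])
  have e3 : ∫ p in Omega L, d p * φ p = ∫ p, fderiv ℝ g p e * φ p ∂(mu L) :=
    integral_congr_ae (by filter_upwards [hd] with p hp; rw [hp])
  rw [e2, e3]
  linarith

theorem HasPerSmoothRep.exists_hasWeakDeriv {L : ℝ} (hL : 0 < L) {f : L2Omega L}
    {g : ℝ × ℝ → ℝ} (hg : PerSmooth L g) (hf : f =ᵐ[mu L] g) {e : ℝ × ℝ}
    (he : e ∈ ({ex, ey} : Set (ℝ × ℝ))) :
    ∃ d : L2Omega L, HasWeakDeriv L e f d ∧ d =ᵐ[mu L] fun p => fderiv ℝ g p e :=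
  have hm : MemLp (fun p => fderiv ℝ g p e) 2 (mu L) := (hg.fderiv e).continuous.memLp_mu
  ⟨hm.toLp _, HasPerSmoothRep.hasWeakDeriv hL hg hf he hm.coeFn_toLp, hm.coeFn_toLp⟩

theorem HasPerSmoothRep.wderiv_ae_eq {L : ℝ} (hL : 0 < L) {f : L2Omega L}
    {g : ℝ × ℝ → ℝ} (hg : PerSmooth L g) (hf : f =ᵐ[mu L] g) {e : ℝ × ℝ}
    (he : e ∈ ({ex, ey} : Set (ℝ × ℝ))) :
    wderiv L e f =ᵐ[mu L] fun p => fderiv ℝ g p e := by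
  obtain ⟨d, h1, h2⟩ := HasPerSmoothRep.exists_hasWeakDeriv hL hg hf he
  rwa [h1.wderiv_eq]

theorem HasPerSmoothRep.wderiv {L : ℝ} (hL : 0 < L) {f : L2Omega L} (hf : HasPerSmoothRep L f)
    {e : ℝ × ℝ} (he : e ∈ ({ex, ey} : Set (ℝ × ℝ))) : HasPerSmoothRep L (wderiv L e f) := by
  obtain ⟨g, hg, hf⟩ := hf
  exact ⟨_, hg.fderiv e, HasPerSmoothRep.wderiv_ae_eq hL hg hf he⟩

/-- The smooth representative serves as a constant approximating sequence for the traces. -/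
theorem HasPerSmoothRep.memHP1 {L : ℝ} (hL : 0 < L) {f : L2Omega L} (hf : HasPerSmoothRep L f) :
    MemHP1 L f := by
  obtain ⟨g, hg, hf⟩ := hf
  refine ⟨fun e he => ?_, ?_⟩
  · obtain ⟨d, h1, -⟩ := HasPerSmoothRep.exists_hasWeakDeriv hL hg hf he
    exact ⟨d, h1⟩
  have m1 : MemLp (fun y => g (0, y)) 2 (volume.restrict (Ioo (0 : ℝ) L)) :=
    (hg.continuous.comp (by fun_prop)).memLp_side
  have m2 : MemLp (fun x => g (x, 0)) 2 (volume.restrict (Ioo (0 : ℝ) L)) :=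
    (hg.continuous.comp (by fun_prop)).memLp_side
  have side : ∀ {a : ℝ → ℝ} (ha : MemLp a 2 (volume.restrict (Ioo (0 : ℝ) L))),
      eLpNorm (fun y => a y - ha.toLp a y) 2 (volume.restrict (Ioo (0 : ℝ) L)) = 0 := by
    intro a ha
    have : (fun y => a y - ha.toLp a y) =ᵐ[volume.restrict (Ioo (0 : ℝ) L)] 0 := by
      filter_upwards [ha.coeFn_toLp] with y hy
      simp [hy]
    rw [eLpNorm_congr_ae this, eLpNorm_zero]
  refine ⟨m1.toLp _, m2.toLp _, fun _ => g, fun _ => hg.1, ?_, fun e he => ?_, ?_, ?_, ?_, ?_⟩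
  · have : (fun p => g p - f p) =ᵐ[mu L] 0 := by
      filter_upwards [hf] with p hp
      simp [hp]
    simp [eLpNorm_congr_ae this]
  · have : (fun p => fderiv ℝ g p e - HasegawaMima.wderiv L e f p) =ᵐ[mu L] 0 := by
      filter_upwards [HasPerSmoothRep.wderiv_ae_eq hL hg hf he] with p hp
      simp [hp]
    simp [eLpNorm_congr_ae this]
  · simp [side m1]
  · simp [hg.right_eq_left, side m1]
  · simp [side m2]
  · simp [hg.top_eq_bottom, side m2]

theorem HasPerSmoothRep.memHP2 {L : ℝ} (hL : 0 < L) {f : L2Omega L} (hf : HasPerSmoothRep L f) :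
    MemHP2 L f :=
  ⟨hf.memHP1 hL, (hf.wderiv hL (by simp)).memHP1 hL, (hf.wderiv hL (by simp)).memHP1 hL⟩

/-- Integration by parts of a function in `H_P¹(Ω)` against a smooth periodic function: the
boundary terms on opposite sides cancel. -/
theorem MemHP1.integral_mul_fderiv {L : ℝ} (hL : 0 < L) {f : L2Omega L} (hf : MemHP1 L f)
    {g : ℝ × ℝ → ℝ} (hg : PerSmooth L g) {e : ℝ × ℝ} (he : e ∈ ({ex, ey} : Set (ℝ × ℝ))) :
    ∫ p in Omega L, f p * fderiv ℝ g p e = - ∫ p in Omega L, wderiv L e f p * g p := by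
  obtain ⟨-, s, s', φ, hφ, h0, h1, hl, hr, hb, ht⟩ := hf
  have hφ1 : ∀ n, ContDiff ℝ 1 (φ n) := fun n => (hφ n).of_le (by exact_mod_cast le_top)
  have hcφ : ∀ n, Continuous fun p => fderiv ℝ (φ n) p e := fun n =>
    ((hφ1 n).continuous_fderiv one_ne_zero).clm_apply continuous_const
  have lim1 := tendsto_integral_mul_of_tendsto_eLpNorm (fun n => (hφ n).continuous.memLp_mu)
    (Lp.memLp f) ((hg.fderiv e).continuous.memLp_mu) h0
  have lim2 := tendsto_integral_mul_of_tendsto_eLpNorm (fun n => (hcφ n).memLp_mu)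
    (Lp.memLp (wderiv L e f)) (hg.continuous.memLp_mu) (h1 e he)
  have e1 : ∀ n p, fderiv ℝ (fun p => φ n p * g p) p e
      = φ n p * fderiv ℝ g p e + fderiv ℝ (φ n) p e * g p := by
    intro n p
    rw [fderiv_fun_mul ((hφ1 n).differentiable one_ne_zero p) (hg.differentiableAt p)]
    simp [mul_comm]
  have hsum : ∀ n, ∫ p, φ n p * fderiv ℝ g p e ∂(mu L) + ∫ p, fderiv ℝ (φ n) p e * g p ∂(mu L)
      = ∫ p in Omega L, fderiv ℝ (fun p => φ n p * g p) p e := by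
    intro n
    simp_rw [e1]
    exact (integral_add (memLp_one_iff_integrable.1
      ((hφ n).continuous.mul (hg.fderiv e).continuous).memLp_mu)
      (memLp_one_iff_integrable.1 ((hcφ n).mul hg.continuous).memLp_mu)).symm
  have hbd : Tendsto (fun n => ∫ p in Omega L, fderiv ℝ (fun p => φ n p * g p) p e) atTop
      (𝓝 0) := by
    have hside : ∀ {a b : ℕ → ℝ → ℝ} {c : L2Side L} {d : ℝ → ℝ}, (∀ n, Continuous (a n)) →
        (∀ n, Continuous (b n)) → Continuous d →
        Tendsto (fun n => eLpNorm (fun y => a n y - c y) 2 (volume.restrict (Ioo 0 L)))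
          atTop (𝓝 0) →
        Tendsto (fun n => eLpNorm (fun y => b n y - c y) 2 (volume.restrict (Ioo 0 L)))
          atTop (𝓝 0) →
        Tendsto (fun n => ∫ y in Ioo 0 L, (a n y * d y - b n y * d y)) atTop (𝓝 0) := by
      intro a b c d ha hb hd hac hbc
      have l1 := tendsto_integral_mul_of_tendsto_eLpNorm (fun n => (ha n).memLp_side)
        (Lp.memLp c) hd.memLp_side hac
      have l2 := tendsto_integral_mul_of_tendsto_eLpNorm (fun n => (hb n).memLp_side)
        (Lp.memLp c) hd.memLp_side hbc
      have := l1.sub l2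
      rw [sub_self] at this
      refine this.congr fun n => ?_
      exact (integral_sub (memLp_one_iff_integrable.1 ((ha n).mul hd).memLp_side)
        (memLp_one_iff_integrable.1 ((hb n).mul hd).memLp_side)).symm
    have hc : ∀ n, ContDiff ℝ 1 fun p => φ n p * g p := fun n => (hφ1 n).mul hg.contDiff_one
    rcases he with rfl | rfl
    · simp_rw [integral_fderiv_ex hL (hc _), hg.right_eq_left]
      have c1 : ∀ x, Continuous fun y : ℝ => ((x, y) : ℝ × ℝ) := fun x : ℝ => by fun_prop
      exact hside (fun n => (hφ n).continuous.comp (c1 L)) (fun n => (hφ n).continuous.comp (c1 0))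
        (hg.continuous.comp (c1 0)) hr hl
    · simp_rw [integral_fderiv_ey hL (hc _), hg.top_eq_bottom]
      have c1 : ∀ y : ℝ, Continuous fun x : ℝ => (x, y) :=
        fun y => continuous_id.prodMk continuous_const
      exact hside (fun n => (hφ n).continuous.comp (c1 L)) (fun n => (hφ n).continuous.comp (c1 0))
        (hg.continuous.comp (c1 0)) ht hb
  have := tendsto_nhds_unique ((lim1.add lim2).congr hsum) hbd
  change ∫ p, f p * fderiv ℝ g p e ∂(mu L) = - ∫ p, wderiv L e f p * g p ∂(mu L)
  linarith

/-! ### The Fourier basis -/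

theorem perSmooth_fourierFun {L : ℝ} (hL : 0 < L) (ξ : ℤ × ℤ) : PerSmooth L (fourierFun L ξ) := by
  have a1 : ∀ p : ℝ × ℝ, 2 * Real.pi * (ξ.1 * (p + (L, 0)).1 + ξ.2 * (p + (L, 0)).2) / L
      = 2 * Real.pi * (ξ.1 * p.1 + ξ.2 * p.2) / L + ξ.1 * (2 * Real.pi) := by
    intro p; simp only [Prod.fst_add, Prod.snd_add]; field_simp; ring
  have a2 : ∀ p : ℝ × ℝ, 2 * Real.pi * (ξ.1 * (p + (0, L)).1 + ξ.2 * (p + (0, L)).2) / L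
      = 2 * Real.pi * (ξ.1 * p.1 + ξ.2 * p.2) / L + ξ.2 * (2 * Real.pi) := by
    intro p; simp only [Prod.fst_add, Prod.snd_add]; field_simp; ring
  unfold fourierFun
  split_ifs
  · exact PerSmooth.const _
  · refine ⟨by fun_prop, fun p => ?_⟩
    beta_reduce
    rw [a1, a2, Real.cos_add_int_mul_two_pi, Real.cos_add_int_mul_two_pi]
    simp
  · refine ⟨by fun_prop, fun p => ?_⟩
    beta_reduce
    rw [a1, a2, Real.sin_add_int_mul_two_pi, Real.sin_add_int_mul_two_pi]
    simp

/-- Differentiation exchanges the cosine and the sine of `±ξ`, with the same factor for both. -/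
theorem fderiv_fourierFun (L : ℝ) (ξ : ℤ × ℤ) (p e : ℝ × ℝ) :
    fderiv ℝ (fourierFun L ξ) p e
      = 2 * Real.pi * (ξ.1 * e.1 + ξ.2 * e.2) / L * fourierFun L (-ξ) p := by
  have hθ : HasFDerivAt (fun p : ℝ × ℝ => 2 * Real.pi * (ξ.1 * p.1 + ξ.2 * p.2) / L)
      ((2 * Real.pi / L) • ((ξ.1 : ℝ) • ContinuousLinearMap.fst ℝ ℝ ℝ
        + (ξ.2 : ℝ) • ContinuousLinearMap.snd ℝ ℝ ℝ)) p := by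
    have := (((ξ.1 : ℝ) • ContinuousLinearMap.fst ℝ ℝ ℝ
        + (ξ.2 : ℝ) • ContinuousLinearMap.snd ℝ ℝ ℝ).hasFDerivAt (x := p)).const_mul
        (2 * Real.pi / L)
    refine this.congr_of_eventuallyEq (Eventually.of_forall fun q => ?_)
    simp
    ring
  by_cases h0 : ξ = 0
  · subst h0
    have : fourierFun L 0 = fun _ => 1 / L := by ext; simp [fourierFun]
    rw [this]
    simp
  have hn0 : -ξ ≠ 0 := neg_ne_zero.2 h0
  have hξ : ξ.1 ≠ 0 ∨ ξ.2 ≠ 0 := by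
    by_contra! h
    exact h0 (Prod.ext h.1 h.2)
  have harg : 2 * Real.pi * (((-ξ).1 : ℤ) * p.1 + ((-ξ).2 : ℤ) * p.2) / L
      = -(2 * Real.pi * (ξ.1 * p.1 + ξ.2 * p.2) / L) := by
    simp only [Prod.fst_neg, Prod.snd_neg]; push_cast; ring
  by_cases h1 : 0 < ξ.1 ∨ (ξ.1 = 0 ∧ 0 < ξ.2)
  · have h2 : ¬ (0 < (-ξ).1 ∨ ((-ξ).1 = 0 ∧ 0 < (-ξ).2)) := by
      simp only [Prod.fst_neg, Prod.snd_neg]; omega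
    have e1 : fourierFun L ξ
        = fun p => √2 / L * Real.cos (2 * Real.pi * (ξ.1 * p.1 + ξ.2 * p.2) / L) := by
      ext q; rw [fourierFun, if_neg h0, if_pos h1]
    rw [e1, (hθ.cos.const_mul _).fderiv, fourierFun, if_neg hn0, if_neg h2, harg, Real.sin_neg]
    simp
    ring
  · have h2 : 0 < (-ξ).1 ∨ ((-ξ).1 = 0 ∧ 0 < (-ξ).2) := by
      simp only [Prod.fst_neg, Prod.snd_neg]; omega
    have e1 : fourierFun L ξ
        = fun p => √2 / L * Real.sin (2 * Real.pi * (ξ.1 * p.1 + ξ.2 * p.2) / L) := by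
      ext q; rw [fourierFun, if_neg h0, if_neg h1]
    rw [e1, (hθ.sin.const_mul _).fderiv, fourierFun, if_neg hn0, if_pos h2, harg, Real.cos_neg]
    simp
    ring


theorem PerSmooth.integral_fderiv {L : ℝ} (hL : 0 < L) {g : ℝ × ℝ → ℝ} (hg : PerSmooth L g)
    {e : ℝ × ℝ} (he : e ∈ ({ex, ey} : Set (ℝ × ℝ))) :
    ∫ p in Omega L, _root_.fderiv ℝ g p e = 0 := by
  rcases he with rfl | rfl
  · rw [integral_fderiv_ex hL hg.contDiff_one]
    simp [hg.right_eq_left]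
  · rw [integral_fderiv_ey hL hg.contDiff_one]
    simp [hg.top_eq_bottom]

theorem integral_const_Omega {L : ℝ} (hL : 0 < L) (c : ℝ) : ∫ _ in Omega L, c = L ^ 2 * c := by
  rw [setIntegral_const, Omega, Measure.volume_eq_prod, measureReal_prod_prod]
  simp [hL.le, sq]

theorem integral_cos_sub {L : ℝ} (hL : 0 < L) (ξ : ℤ × ℤ) (δ : ℝ) :
    ∫ p in Omega L, Real.cos (2 * Real.pi * (ξ.1 * p.1 + ξ.2 * p.2) / L - δ)
      = if ξ = 0 then L ^ 2 * Real.cos δ else 0 := by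
  split_ifs with h0
  · subst h0
    simp [integral_const_Omega hL]
  have hper : PerSmooth L
      fun p => Real.sin (2 * Real.pi * (ξ.1 * p.1 + ξ.2 * p.2) / L - δ) := by
    refine ⟨by fun_prop, fun p => ?_⟩
    have a1 : 2 * Real.pi * (ξ.1 * (p + (L, 0)).1 + ξ.2 * (p + (L, 0)).2) / L - δ
        = 2 * Real.pi * (ξ.1 * p.1 + ξ.2 * p.2) / L - δ + ξ.1 * (2 * Real.pi) := by
      simp only [Prod.fst_add, Prod.snd_add]; field_simp; ring
    have a2 : 2 * Real.pi * (ξ.1 * (p + (0, L)).1 + ξ.2 * (p + (0, L)).2) / L - δ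
        = 2 * Real.pi * (ξ.1 * p.1 + ξ.2 * p.2) / L - δ + ξ.2 * (2 * Real.pi) := by
      simp only [Prod.fst_add, Prod.snd_add]; field_simp; ring
    beta_reduce
    rw [a1, a2, Real.sin_add_int_mul_two_pi, Real.sin_add_int_mul_two_pi]
    simp
  have hd : ∀ p e : ℝ × ℝ,
      fderiv ℝ (fun p : ℝ × ℝ => Real.sin (2 * Real.pi * (ξ.1 * p.1 + ξ.2 * p.2) / L - δ)) p e
        = 2 * Real.pi * (ξ.1 * e.1 + ξ.2 * e.2) / L
          * Real.cos (2 * Real.pi * (ξ.1 * p.1 + ξ.2 * p.2) / L - δ) := by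
    intro p e
    have hθ : HasFDerivAt (fun p : ℝ × ℝ => 2 * Real.pi * (ξ.1 * p.1 + ξ.2 * p.2) / L - δ)
        ((2 * Real.pi / L) • ((ξ.1 : ℝ) • ContinuousLinearMap.fst ℝ ℝ ℝ
          + (ξ.2 : ℝ) • ContinuousLinearMap.snd ℝ ℝ ℝ)) p := by
      have := ((((ξ.1 : ℝ) • ContinuousLinearMap.fst ℝ ℝ ℝ
          + (ξ.2 : ℝ) • ContinuousLinearMap.snd ℝ ℝ ℝ).hasFDerivAt (x := p)).const_mul
          (2 * Real.pi / L)).sub_const δ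
      refine this.congr_of_eventuallyEq (Eventually.of_forall fun q => ?_)
      simp
      ring
    rw [hθ.sin.fderiv]
    simp
    ring
  have main : ∀ e ∈ ({ex, ey} : Set (ℝ × ℝ)), (ξ.1 * e.1 + ξ.2 * e.2 : ℝ) ≠ 0 →
      ∫ p in Omega L, Real.cos (2 * Real.pi * (ξ.1 * p.1 + ξ.2 * p.2) / L - δ) = 0 := by
    intro e he hne
    have := hper.integral_fderiv hL he
    simp_rw [hd] at this
    rw [integral_const_mul] at this
    refine (mul_eq_zero.1 this).resolve_left ?_
    have := Real.pi_ne_zero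
    positivity
  by_cases h1 : ξ.1 = 0
  · refine main ey (by simp) ?_
    have : ξ.2 ≠ 0 := fun h2 => h0 (Prod.ext h1 h2)
    simpa [ey] using this
  · exact main ex (by simp) (by simpa [ex] using h1)

theorem integral_fourierFun_mul {L : ℝ} (hL : 0 < L) (ξ η : ℤ × ℤ) :
    ∫ p in Omega L, fourierFun L ξ p * fourierFun L η p = if ξ = η then 1 else 0 := by
  -- every basis function is a cosine with amplitude `A` and phase `δ`
  let A : ℤ × ℤ → ℝ := fun ξ => if ξ = 0 then 1 / L else √2 / L
  let δ : ℤ × ℤ → ℝ := fun ξ =>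
    if ξ = 0 ∨ (0 < ξ.1 ∨ (ξ.1 = 0 ∧ 0 < ξ.2)) then 0 else Real.pi / 2
  have rep : ∀ ξ p, fourierFun L ξ p
      = A ξ * Real.cos (2 * Real.pi * (ξ.1 * p.1 + ξ.2 * p.2) / L - δ ξ) := by
    intro ξ p
    simp only [fourierFun, A, δ]
    by_cases h0 : ξ = 0
    · simp [h0]
    · by_cases h1 : 0 < ξ.1 ∨ (ξ.1 = 0 ∧ 0 < ξ.2)
      · simp [h0, h1]
      · simp [h0, h1, Real.cos_sub_pi_div_two]
  have hprod : ∀ p, fourierFun L ξ p * fourierFun L η p = A ξ * A η / 2 *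
      (Real.cos (2 * Real.pi * ((ξ - η).1 * p.1 + (ξ - η).2 * p.2) / L - (δ ξ - δ η))
        + Real.cos (2 * Real.pi * ((ξ + η).1 * p.1 + (ξ + η).2 * p.2) / L - (δ ξ + δ η))) := by
    intro p
    rw [rep, rep]
    have e1 : 2 * Real.pi * (((ξ - η).1 : ℤ) * p.1 + ((ξ - η).2 : ℤ) * p.2) / L - (δ ξ - δ η)
        = (2 * Real.pi * (ξ.1 * p.1 + ξ.2 * p.2) / L - δ ξ)
          - (2 * Real.pi * (η.1 * p.1 + η.2 * p.2) / L - δ η) := by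
      simp only [Prod.fst_sub, Prod.snd_sub]; push_cast; ring
    have e2 : 2 * Real.pi * (((ξ + η).1 : ℤ) * p.1 + ((ξ + η).2 : ℤ) * p.2) / L - (δ ξ + δ η)
        = (2 * Real.pi * (ξ.1 * p.1 + ξ.2 * p.2) / L - δ ξ)
          + (2 * Real.pi * (η.1 * p.1 + η.2 * p.2) / L - δ η) := by
      simp only [Prod.fst_add, Prod.snd_add]; push_cast; ring
    rw [e1, e2]
    generalize 2 * Real.pi * (ξ.1 * p.1 + ξ.2 * p.2) / L - δ ξ = a
    generalize 2 * Real.pi * (η.1 * p.1 + η.2 * p.2) / L - δ η = b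
    rw [Real.cos_sub, Real.cos_add]
    ring
  simp_rw [hprod]
  have hi : ∀ (ζ : ℤ × ℤ) (d : ℝ), Integrable
      (fun p : ℝ × ℝ => Real.cos (2 * Real.pi * (ζ.1 * p.1 + ζ.2 * p.2) / L - d)) (mu L) :=
    fun ζ d => memLp_one_iff_integrable.1 (Continuous.memLp_mu (by fun_prop))
  have hadd := integral_add (hi (ξ - η) (δ ξ - δ η)) (hi (ξ + η) (δ ξ + δ η))
  have e1 := integral_cos_sub hL (ξ - η) (δ ξ - δ η)
  have e2 := integral_cos_sub hL (ξ + η) (δ ξ + δ η)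
  rw [mu] at hadd
  rw [integral_const_mul, hadd, e1, e2]
  have hs : √2 * √2 = (2 : ℝ) := Real.mul_self_sqrt (by norm_num)
  by_cases h : ξ = η
  · subst h
    by_cases h0 : ξ = 0
    · simp [h0, A, δ]
      field_simp
      norm_num
    · have : ξ + ξ ≠ 0 := fun h => h0 (by
        have h1 := congrArg Prod.fst h
        have h2 := congrArg Prod.snd h
        simp only [Prod.fst_add, Prod.snd_add, Prod.fst_zero, Prod.snd_zero] at h1 h2
        exact Prod.ext (by simp; omega) (by simp; omega))
      rw [if_pos (sub_self ξ), if_neg this]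
      simp only [A, if_neg h0, sub_self, Real.cos_zero, if_true]
      field_simp
      linear_combination L ^ 2 * hs
  · rw [if_neg h, if_neg (sub_ne_zero.2 h)]
    split_ifs with h2
    · have hη : η = -ξ := (neg_eq_of_add_eq_zero_right h2).symm
      have hδ : δ ξ + δ η = Real.pi / 2 := by
        have h0 : ξ ≠ 0 := fun h0 => h (by rw [hη, h0, neg_zero])
        have h0' : -ξ ≠ 0 := neg_ne_zero.2 h0
        have hξ : ξ.1 ≠ 0 ∨ ξ.2 ≠ 0 := by
          by_contra! h
          exact h0 (Prod.ext h.1 h.2)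
        simp only [hη, δ, h0, h0', false_or, Prod.fst_neg, Prod.snd_neg]
        split_ifs with a b b
        · omega
        · ring
        · ring
        · omega
      rw [hδ, Real.cos_pi_div_two]
      ring
    · ring

theorem coeFn_fourierVec (L : ℝ) (ξ : ℤ × ℤ) : fourierVec L ξ =ᵐ[mu L] fourierFun L ξ :=
  (memLp_fourierFun L ξ).coeFn_toLp

theorem hasPerSmoothRep_fourierVec {L : ℝ} (hL : 0 < L) (ξ : ℤ × ℤ) :
    HasPerSmoothRep L (fourierVec L ξ) :=
  ⟨_, perSmooth_fourierFun hL ξ, coeFn_fourierVec L ξ⟩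

theorem inner_fourierVec (L : ℝ) (ξ : ℤ × ℤ) (f : L2Omega L) :
    inner ℝ (fourierVec L ξ) f = ∫ p in Omega L, fourierFun L ξ p * f p := by
  rw [inner_eq_integral]
  exact integral_congr_ae (by filter_upwards [coeFn_fourierVec L ξ] with p hp; rw [hp])

theorem orthonormal_fourierVec {L : ℝ} (hL : 0 < L) : Orthonormal ℝ (fourierVec L) := by
  classical
  rw [orthonormal_iff_ite]
  intro ξ η
  rw [inner_fourierVec, ← integral_fourierFun_mul hL]
  exact integral_congr_ae (by filter_upwards [coeFn_fourierVec L η] with p hp; rw [hp])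

/-- The Fourier coefficients of a weak derivative. -/
theorem MemHP1.inner_wderiv {L : ℝ} (hL : 0 < L) {f : L2Omega L} (hf : MemHP1 L f)
    {e : ℝ × ℝ} (he : e ∈ ({ex, ey} : Set (ℝ × ℝ))) (ξ : ℤ × ℤ) :
    inner ℝ (fourierVec L ξ) (wderiv L e f)
      = - (2 * Real.pi * (ξ.1 * e.1 + ξ.2 * e.2) / L) * inner ℝ (fourierVec L (-ξ)) f := by
  have h := hf.integral_mul_fderiv hL (perSmooth_fourierFun hL ξ) he
  simp_rw [fderiv_fourierFun] at h
  rw [inner_fourierVec, inner_fourierVec, ← integral_const_mul]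
  simp_rw [mul_comm (fourierFun L ξ _)]
  rw [← neg_eq_iff_eq_neg.2 h, ← integral_neg]
  exact integral_congr_ae (ae_of_all _ fun p => by simp only; ring)

/-! ### The smoothing kernel -/

/-- The frequencies `ξ` with `|ξ₁|, |ξ₂| ≤ n`. -/
noncomputable def box (n : ℕ) : Finset (ℤ × ℤ) := Finset.Icc (-n : ℤ) n ×ˢ Finset.Icc (-n : ℤ) n

theorem neg_mem_box {n : ℕ} {ξ : ℤ × ℤ} (h : ξ ∈ box n) : -ξ ∈ box n := by
  simp only [box, Finset.mem_product, Finset.mem_Icc, Prod.fst_neg, Prod.snd_neg] at *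
  omega

/-- The two-dimensional weight, a product of two one-dimensional ones. -/
noncomputable def weight (n : ℕ) (ξ : ℤ × ℤ) : ℝ := binomWeight n ξ.1 * binomWeight n ξ.2

theorem weight_nonneg (n : ℕ) (ξ : ℤ × ℤ) : 0 ≤ weight n ξ :=
  mul_nonneg (binomWeight_nonneg _ _) (binomWeight_nonneg _ _)

theorem weight_le_one (n : ℕ) (ξ : ℤ × ℤ) : weight n ξ ≤ 1 :=
  mul_le_one₀ (binomWeight_le_one _ _) (binomWeight_nonneg _ _) (binomWeight_le_one _ _)

theorem weight_neg (n : ℕ) (ξ : ℤ × ℤ) : weight n (-ξ) = weight n ξ := by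
  simp [weight, binomWeight_neg]

theorem weight_zero (n : ℕ) : weight n 0 = 1 := by simp [weight, binomWeight_zero]

theorem weight_eq_zero {n : ℕ} {ξ : ℤ × ℤ} (h : ξ ∉ box n) : weight n ξ = 0 := by
  have key : ∀ k : ℤ, k ∉ Finset.Icc (-n : ℤ) n → binomWeight n k = 0 := by
    intro k hk
    rw [Finset.mem_Icc] at hk
    rw [binomWeight, Nat.choose_eq_zero_of_lt (by omega)]
    simp
  rw [box, Finset.mem_product, not_and_or] at h
  rcases h with h | h
  · rw [weight, key _ h, zero_mul]
  · rw [weight, key _ h, mul_zero]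

theorem one_sub_weight_le {n : ℕ} (hn : 1 ≤ n) (ξ : ℤ × ℤ) :
    1 - weight n ξ ≤ ((ξ.1 : ℝ) ^ 2 + (ξ.2 : ℝ) ^ 2) / n := by
  have h1 := one_sub_binomWeight_le hn ξ.1
  have h2 := one_sub_binomWeight_le hn ξ.2
  rw [add_div, weight]
  nlinarith [mul_nonneg (sub_nonneg.2 (binomWeight_le_one n ξ.1))
    (sub_nonneg.2 (binomWeight_le_one n ξ.2))]

theorem tendsto_weight (ξ : ℤ × ℤ) : Tendsto (fun n => weight n ξ) atTop (𝓝 1) := by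
  have h : Tendsto (fun n : ℕ => 1 - ((ξ.1 : ℝ) ^ 2 + (ξ.2 : ℝ) ^ 2) / n) atTop (𝓝 (1 - 0)) :=
    tendsto_const_nhds.sub (tendsto_const_div_atTop_nhds_zero_nat _)
  rw [sub_zero] at h
  refine tendsto_of_tendsto_of_tendsto_of_le_of_le' h tendsto_const_nhds ?_
    (Eventually.of_forall fun n => weight_le_one n ξ)
  filter_upwards [eventually_ge_atTop 1] with n hn
  linarith [one_sub_weight_le hn ξ]

/-- The kernel whose integral operator multiplies the `ξ`-th Fourier coefficient by `weight n ξ`. -/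
noncomputable def kernel (L : ℝ) (n : ℕ) (x y : ℝ × ℝ) : ℝ :=
  ∑ ξ ∈ box n, weight n ξ * fourierFun L ξ x * fourierFun L ξ y

/-- Each pair `±ξ` of basis functions contributes a function of `x - y` to the kernel. -/
theorem fourierFun_mul_add_neg {L : ℝ} (ξ : ℤ × ℤ) (x y : ℝ × ℝ) :
    fourierFun L ξ x * fourierFun L ξ y + fourierFun L (-ξ) x * fourierFun L (-ξ) y
      = 2 / L ^ 2 * Real.cos (ξ.1 * (2 * Real.pi * (x.1 - y.1) / L)
          + ξ.2 * (2 * Real.pi * (x.2 - y.2) / L)) := by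
  have hs : √2 ^ 2 = (2 : ℝ) := Real.sq_sqrt (by norm_num)
  by_cases h0 : ξ = 0
  · subst h0
    simp [fourierFun]
    ring
  have hn0 : -ξ ≠ 0 := neg_ne_zero.2 h0
  have hξ : ξ.1 ≠ 0 ∨ ξ.2 ≠ 0 := by
    by_contra! h
    exact h0 (Prod.ext h.1 h.2)
  have harg : ∀ p : ℝ × ℝ, 2 * Real.pi * (((-ξ).1 : ℤ) * p.1 + ((-ξ).2 : ℤ) * p.2) / L
      = -(2 * Real.pi * (ξ.1 * p.1 + ξ.2 * p.2) / L) := by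
    intro p; simp only [Prod.fst_neg, Prod.snd_neg]; push_cast; ring
  have hcos : Real.cos (ξ.1 * (2 * Real.pi * (x.1 - y.1) / L)
          + ξ.2 * (2 * Real.pi * (x.2 - y.2) / L))
      = Real.cos (2 * Real.pi * (ξ.1 * x.1 + ξ.2 * x.2) / L
          - 2 * Real.pi * (ξ.1 * y.1 + ξ.2 * y.2) / L) := by
    congr 1; ring
  rw [hcos, Real.cos_sub]
  by_cases h1 : 0 < ξ.1 ∨ (ξ.1 = 0 ∧ 0 < ξ.2)
  · have h2 : ¬ (0 < (-ξ).1 ∨ ((-ξ).1 = 0 ∧ 0 < (-ξ).2)) := by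
      simp only [Prod.fst_neg, Prod.snd_neg]; omega
    simp only [fourierFun, if_neg h0, if_pos h1, if_neg hn0, if_neg h2, harg, Real.sin_neg]
    linear_combination (Real.cos (2 * Real.pi * (ξ.1 * x.1 + ξ.2 * x.2) / L)
      * Real.cos (2 * Real.pi * (ξ.1 * y.1 + ξ.2 * y.2) / L)
      + Real.sin (2 * Real.pi * (ξ.1 * x.1 + ξ.2 * x.2) / L)
      * Real.sin (2 * Real.pi * (ξ.1 * y.1 + ξ.2 * y.2) / L)) / L ^ 2 * hs
  · have h2 : 0 < (-ξ).1 ∨ ((-ξ).1 = 0 ∧ 0 < (-ξ).2) := by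
      simp only [Prod.fst_neg, Prod.snd_neg]; omega
    simp only [fourierFun, if_neg h0, if_neg h1, if_neg hn0, if_pos h2, harg, Real.cos_neg]
    linear_combination (Real.cos (2 * Real.pi * (ξ.1 * x.1 + ξ.2 * x.2) / L)
      * Real.cos (2 * Real.pi * (ξ.1 * y.1 + ξ.2 * y.2) / L)
      + Real.sin (2 * Real.pi * (ξ.1 * x.1 + ξ.2 * x.2) / L)
      * Real.sin (2 * Real.pi * (ξ.1 * y.1 + ξ.2 * y.2) / L)) / L ^ 2 * hs

/-- The kernel in closed form, from which its sign and its height can be read off. -/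
theorem kernel_eq (L : ℝ) (n : ℕ) (x y : ℝ × ℝ) :
    kernel L n x y = 1 / L ^ 2 * (((4 : ℝ) ^ n / n.centralBinom) ^ 2
      * (((1 + Real.cos (2 * Real.pi * (x.1 - y.1) / L)) / 2) ^ n
        * ((1 + Real.cos (2 * Real.pi * (x.2 - y.2) / L)) / 2) ^ n)) := by
  rw [← sum_binomWeight_mul_cos, Finset.mul_sum]
  have hneg : kernel L n x y
      = ∑ ξ ∈ box n, weight n ξ * fourierFun L (-ξ) x * fourierFun L (-ξ) y := by
    rw [kernel]
    refine Finset.sum_nbij' (fun ξ => -ξ) (fun ξ => -ξ) (fun _ => neg_mem_box)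
      (fun _ => neg_mem_box) (fun _ _ => neg_neg _) (fun _ _ => neg_neg _) fun ξ _ => ?_
    rw [weight_neg, neg_neg]
  -- average the sum over `ξ` and the same sum over `-ξ`
  have h2 : 2 * kernel L n x y = 2 * ∑ ξ ∈ box n, 1 / L ^ 2 * (weight n ξ *
      Real.cos (ξ.1 * (2 * Real.pi * (x.1 - y.1) / L)
          + ξ.2 * (2 * Real.pi * (x.2 - y.2) / L))) := by
    rw [two_mul, Finset.mul_sum]
    nth_rewrite 2 [hneg]
    rw [kernel, ← Finset.sum_add_distrib]
    refine Finset.sum_congr rfl fun ξ _ => ?_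
    have := fourierFun_mul_add_neg (L := L) ξ x y
    linear_combination weight n ξ * this
  exact mul_left_cancel₀ two_ne_zero h2

theorem kernel_nonneg (L : ℝ) (n : ℕ) (x y : ℝ × ℝ) : 0 ≤ kernel L n x y := by
  rw [kernel_eq]
  have h1 := Real.neg_one_le_cos (2 * Real.pi * (x.1 - y.1) / L)
  have h2 := Real.neg_one_le_cos (2 * Real.pi * (x.2 - y.2) / L)
  have h3 : 0 ≤ (1 + Real.cos (2 * Real.pi * (x.1 - y.1) / L)) / 2 := by linarith
  have h4 : 0 ≤ (1 + Real.cos (2 * Real.pi * (x.2 - y.2) / L)) / 2 := by linarith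
  positivity

theorem kernel_le (L : ℝ) (n : ℕ) (x y : ℝ × ℝ) : kernel L n x y ≤ (4 * n + 1) / L ^ 2 := by
  rw [kernel_eq]
  have h1 := Real.neg_one_le_cos (2 * Real.pi * (x.1 - y.1) / L)
  have h2 := Real.neg_one_le_cos (2 * Real.pi * (x.2 - y.2) / L)
  have h3 := Real.cos_le_one (2 * Real.pi * (x.1 - y.1) / L)
  have h4 := Real.cos_le_one (2 * Real.pi * (x.2 - y.2) / L)
  have h5 : ((1 + Real.cos (2 * Real.pi * (x.1 - y.1) / L)) / 2) ^ n ≤ 1 :=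
    pow_le_one₀ (by linarith) (by linarith)
  have h6 : ((1 + Real.cos (2 * Real.pi * (x.2 - y.2) / L)) / 2) ^ n ≤ 1 :=
    pow_le_one₀ (by linarith) (by linarith)
  have h7 : 0 ≤ ((1 + Real.cos (2 * Real.pi * (x.2 - y.2) / L)) / 2) ^ n :=
    pow_nonneg (by linarith) _
  have h8 := four_pow_div_centralBinom_sq_le n
  rw [div_mul_eq_mul_div, one_mul]
  gcongr
  exact (mul_le_of_le_one_right (sq_nonneg _) (mul_le_one₀ h5 h7 h6)).trans h8

theorem continuous_fourierFun {L : ℝ} (hL : 0 < L) (ξ : ℤ × ℤ) : Continuous (fourierFun L ξ) :=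
  (perSmooth_fourierFun hL ξ).continuous

theorem continuous_kernel {L : ℝ} (hL : 0 < L) (n : ℕ) (x : ℝ × ℝ) :
    Continuous (kernel L n x) := by
  have := continuous_fourierFun hL
  unfold kernel
  fun_prop

/-- The integral operator with kernel `kernel L n`, on functions. -/
noncomputable def kerInt (L : ℝ) (n : ℕ) (h : ℝ × ℝ → ℝ) (x : ℝ × ℝ) : ℝ :=
  ∫ y in Omega L, kernel L n x y * h y

theorem integrable_continuous_mul {L : ℝ} {h g : ℝ × ℝ → ℝ} (hg : Continuous g)
    (hh : Integrable h (mu L)) : Integrable (fun y => g y * h y) (mu L) :=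
  hh.mul_of_top_right hg.memLp_mu


/-! ### Smoothing operators -/

/-- The smoothing operator: the Fourier multiplier with the symbol `weight n`. -/
noncomputable def mollify (L : ℝ) (n : ℕ) (f : L2Omega L) : L2Omega L :=
  ∑ ξ ∈ box n, (weight n ξ * inner ℝ (fourierVec L ξ) f) • fourierVec L ξ

theorem inner_fourierVec_mollify {L : ℝ} (hL : 0 < L) (n : ℕ) (f : L2Omega L) (ξ : ℤ × ℤ) :
    inner ℝ (fourierVec L ξ) (mollify L n f) = weight n ξ * inner ℝ (fourierVec L ξ) f := by
  classical
  rw [mollify, inner_sum]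
  simp_rw [inner_smul_right, orthonormal_iff_ite.1 (orthonormal_fourierVec hL)]
  simp only [mul_ite, mul_one, mul_zero, Finset.sum_ite_eq]
  split_ifs with h
  · rfl
  · rw [weight_eq_zero h, zero_mul]

theorem inner_mollify_right {L : ℝ} (n : ℕ) (f g : L2Omega L) :
    inner ℝ g (mollify L n f)
      = ∑ ξ ∈ box n, weight n ξ * inner ℝ (fourierVec L ξ) f * inner ℝ (fourierVec L ξ) g := by
  rw [mollify, inner_sum]
  simp_rw [inner_smul_right, real_inner_comm g]

theorem norm_sq_mollify_le_inner {L : ℝ} (hL : 0 < L) (n : ℕ) (f : L2Omega L) :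
    ‖mollify L n f‖ ^ 2 ≤ inner ℝ f (mollify L n f) := by
  rw [← real_inner_self_eq_norm_sq, inner_mollify_right, inner_mollify_right]
  refine Finset.sum_le_sum fun ξ _ => ?_
  rw [inner_fourierVec_mollify hL]
  have h0 := weight_nonneg n ξ
  have h1 := weight_le_one n ξ
  have h2 := mul_nonneg h0 (sq_nonneg (inner ℝ (fourierVec L ξ) f))
  nlinarith

theorem norm_mollify_le {L : ℝ} (hL : 0 < L) (n : ℕ) (f : L2Omega L) : ‖mollify L n f‖ ≤ ‖f‖ := by
  have h := (norm_sq_mollify_le_inner hL n f).trans (real_inner_le_norm _ _)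
  by_contra! hc
  nlinarith [norm_nonneg f]

theorem norm_mollify_sub_sq_le {L : ℝ} (hL : 0 < L) (n : ℕ) (f : L2Omega L) :
    ‖mollify L n f - f‖ ^ 2 ≤ ‖f‖ ^ 2 - inner ℝ f (mollify L n f) := by
  rw [norm_sub_sq_real, real_inner_comm]
  linarith [norm_sq_mollify_le_inner hL n f]

theorem integral_fourierFun {L : ℝ} (hL : 0 < L) (ξ : ℤ × ℤ) :
    ∫ p in Omega L, fourierFun L ξ p = if ξ = 0 then L else 0 := by
  have h := integral_fourierFun_mul hL ξ 0
  have e : fourierFun L 0 = fun _ => 1 / L := by ext; simp [fourierFun]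
  rw [e, integral_mul_const] at h
  split_ifs at h ⊢ <;> field_simp at h <;> linarith

theorem kerInt_eq_sum {L : ℝ} (hL : 0 < L) (n : ℕ) {h : ℝ × ℝ → ℝ} (hh : Integrable h (mu L))
    (x : ℝ × ℝ) :
    kerInt L n h x
      = ∑ ξ ∈ box n, weight n ξ * (∫ y in Omega L, fourierFun L ξ y * h y) * fourierFun L ξ x := by
  simp only [kerInt, kernel, Finset.sum_mul]
  rw [integral_finsetSum]
  · refine Finset.sum_congr rfl fun ξ _ => ?_
    rw [← integral_const_mul, ← integral_mul_const]
    exact integral_congr_ae (ae_of_all _ fun y => by simp only; ring)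
  · intro ξ _
    simp_rw [mul_assoc]
    exact ((integrable_continuous_mul (continuous_fourierFun hL ξ) hh).const_mul _).const_mul _

theorem continuous_kerInt {L : ℝ} (hL : 0 < L) (n : ℕ) {h : ℝ × ℝ → ℝ}
    (hh : Integrable h (mu L)) : Continuous (kerInt L n h) := by
  have := continuous_fourierFun hL
  rw [funext (kerInt_eq_sum hL n hh)]
  fun_prop

theorem mollify_ae_eq {L : ℝ} (hL : 0 < L) (n : ℕ) (f : L2Omega L) :
    mollify L n f =ᵐ[mu L] kerInt L n f := by
  have hf : Integrable f (mu L) := (Lp.memLp f).integrable (by norm_num)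
  have hs := Lp.coeFn_finsetSum (box n)
    (fun ξ => (weight n ξ * inner ℝ (fourierVec L ξ) f) • fourierVec L ξ)
  have hall : ∀ᵐ p ∂(mu L), ∀ ξ : ℤ × ℤ,
      ((weight n ξ * inner ℝ (fourierVec L ξ) f) • fourierVec L ξ : L2Omega L) p
        = (weight n ξ * inner ℝ (fourierVec L ξ) f) * fourierFun L ξ p := by
    rw [ae_all_iff]
    intro ξ
    filter_upwards [Lp.coeFn_smul (weight n ξ * inner ℝ (fourierVec L ξ) f) (fourierVec L ξ),
      coeFn_fourierVec L ξ] with p h1 h2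
    rw [h1, Pi.smul_apply, h2, smul_eq_mul]
  filter_upwards [hs, hall] with p h1 h2
  rw [mollify, h1, kerInt_eq_sum hL n hf, Finset.sum_apply]
  refine Finset.sum_congr rfl fun ξ _ => ?_
  rw [h2, inner_fourierVec]

theorem hasPerSmoothRep_mollify {L : ℝ} (hL : 0 < L) (n : ℕ) (f : L2Omega L) :
    HasPerSmoothRep L (mollify L n f) :=
  Finset.sum_induction _ _ (fun _ _ => HasPerSmoothRep.add) HasPerSmoothRep.zero
    fun ξ _ => (hasPerSmoothRep_fourierVec hL ξ).smul _

theorem kerInt_fourierFun {L : ℝ} (hL : 0 < L) (n : ℕ) (ξ : ℤ × ℤ) (x : ℝ × ℝ) :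
    kerInt L n (fourierFun L ξ) x = weight n ξ * fourierFun L ξ x := by
  rw [kerInt_eq_sum hL n (memLp_one_iff_integrable.1 (continuous_fourierFun hL ξ).memLp_mu)]
  simp_rw [integral_fourierFun_mul hL]
  simp only [mul_ite, mul_one, mul_zero, ite_mul, zero_mul, Finset.sum_ite_eq']
  split_ifs with h
  · rfl
  · rw [weight_eq_zero h, zero_mul]

theorem integral_kernel_mul_cos {L : ℝ} (hL : 0 < L) (n : ℕ) (ξ : ℤ × ℤ) (x : ℝ × ℝ) :
    ∫ y in Omega L, kernel L n x y * Real.cos (ξ.1 * (2 * Real.pi * (x.1 - y.1) / L)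
          + ξ.2 * (2 * Real.pi * (x.2 - y.2) / L)) = weight n ξ := by
  have hi : ∀ ξ, Integrable (fun y => kernel L n x y * fourierFun L ξ y) (mu L) := fun ξ =>
    memLp_one_iff_integrable.1
      ((continuous_kernel hL n x).mul (continuous_fourierFun hL ξ)).memLp_mu
  have h1 : ∀ y, kernel L n x y * Real.cos (ξ.1 * (2 * Real.pi * (x.1 - y.1) / L)
          + ξ.2 * (2 * Real.pi * (x.2 - y.2) / L))
      = L ^ 2 / 2 * (fourierFun L ξ x * (kernel L n x y * fourierFun L ξ y)
        + fourierFun L (-ξ) x * (kernel L n x y * fourierFun L (-ξ) y)) := by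
    intro y
    have h := fourierFun_mul_add_neg (L := L) ξ x y
    have e : Real.cos (ξ.1 * (2 * Real.pi * (x.1 - y.1) / L)
          + ξ.2 * (2 * Real.pi * (x.2 - y.2) / L))
        = L ^ 2 / 2 * (fourierFun L ξ x * fourierFun L ξ y
          + fourierFun L (-ξ) x * fourierFun L (-ξ) y) := by
      rw [h]; field_simp
    rw [e]; ring
  simp_rw [h1]
  have hadd := integral_add ((hi ξ).const_mul (fourierFun L ξ x))
    ((hi (-ξ)).const_mul (fourierFun L (-ξ) x))
  rw [mu] at hadd
  rw [integral_const_mul, hadd, integral_const_mul, integral_const_mul]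
  have e1 := kerInt_fourierFun hL n ξ x
  have e2 := kerInt_fourierFun hL n (-ξ) x
  rw [kerInt] at e1 e2
  rw [e1, e2, weight_neg]
  have h := fourierFun_mul_add_neg (L := L) ξ x x
  simp only [sub_self, mul_zero, zero_div, add_zero, Real.cos_zero, mul_one] at h
  have hL2 : L ^ 2 / 2 * (2 / L ^ 2) = 1 := by field_simp
  linear_combination weight n ξ * (L ^ 2 / 2) * h + weight n ξ * hL2

theorem integral_kernel {L : ℝ} (hL : 0 < L) (n : ℕ) (x : ℝ × ℝ) :
    ∫ y in Omega L, kernel L n x y = 1 := by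
  simpa [weight_zero] using integral_kernel_mul_cos hL n 0 x

theorem integral_kerInt {L : ℝ} (hL : 0 < L) (n : ℕ) {h : ℝ × ℝ → ℝ}
    (hh : Integrable h (mu L)) : ∫ x in Omega L, kerInt L n h x = ∫ x in Omega L, h x := by
  simp_rw [kerInt_eq_sum hL n hh]
  rw [integral_finsetSum]
  · simp_rw [integral_const_mul, integral_fourierFun hL]
    have h0 : (0 : ℤ × ℤ) ∈ box n := by simp [box]
    simp only [mul_ite, mul_zero, Finset.sum_ite_eq', h0, if_true, weight_zero, one_mul]
    have e : fourierFun L 0 = fun _ => 1 / L := by ext; simp [fourierFun]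
    rw [e, integral_const_mul]
    field_simp
  · intro ξ _
    have hi : Integrable (fourierFun L ξ) (mu L) :=
      memLp_one_iff_integrable.1 (continuous_fourierFun hL ξ).memLp_mu
    exact hi.const_mul _

/-- The mean square oscillation of `f` around `x`, weighted by the kernel. -/
noncomputable def osc (L : ℝ) (n : ℕ) (f : ℝ × ℝ → ℝ) (x : ℝ × ℝ) : ℝ :=
  ∫ y in Omega L, kernel L n x y * (f x - f y) ^ 2

theorem osc_eq {L : ℝ} (hL : 0 < L) (n : ℕ) {f : ℝ × ℝ → ℝ} (hf : MemLp f 2 (mu L)) (x : ℝ × ℝ) :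
    osc L n f x = f x ^ 2 - 2 * (f x * kerInt L n f x) + kerInt L n (fun y => f y ^ 2) x := by
  have i0 : Integrable (kernel L n x) (mu L) :=
    memLp_one_iff_integrable.1 (continuous_kernel hL n x).memLp_mu
  have i1 : Integrable (fun y => kernel L n x y * f y) (mu L) :=
    integrable_continuous_mul (continuous_kernel hL n x) (hf.integrable (by norm_num))
  have i2 : Integrable (fun y => kernel L n x y * f y ^ 2) (mu L) :=
    integrable_continuous_mul (continuous_kernel hL n x) hf.integrable_sq
  have e : ∀ y, kernel L n x y * (f x - f y) ^ 2 = f x ^ 2 * kernel L n x y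
      - 2 * f x * (kernel L n x y * f y) + kernel L n x y * f y ^ 2 := fun y => by ring
  have h1 := integral_add ((i0.const_mul (f x ^ 2)).sub (i1.const_mul (2 * f x))) i2
  have h2 := integral_sub (i0.const_mul (f x ^ 2)) (i1.const_mul (2 * f x))
  simp only [Pi.sub_apply] at h1 h2
  rw [mu] at h1 h2
  simp only [osc, e]
  rw [h1, h2, integral_const_mul, integral_const_mul, integral_kernel hL]
  simp only [kerInt]
  ring

theorem integrable_osc {L : ℝ} (hL : 0 < L) (n : ℕ) {f : ℝ × ℝ → ℝ} (hf : MemLp f 2 (mu L)) :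
    Integrable (osc L n f) (mu L) := by
  rw [funext (osc_eq hL n hf)]
  have hf1 := hf.integrable (q := 2) (by norm_num)
  refine (hf.integrable_sq.sub (Integrable.const_mul ?_ 2)).add
    (memLp_one_iff_integrable.1 (continuous_kerInt hL n hf.integrable_sq).memLp_mu)
  simp_rw [mul_comm (f _)]
  exact integrable_continuous_mul (continuous_kerInt hL n hf1) hf1

/-- The total oscillation is twice the smoothing defect, since the kernel has mean one in both
variables. -/
theorem integral_osc {L : ℝ} (hL : 0 < L) (n : ℕ) (f : L2Omega L) :
    ∫ x in Omega L, osc L n f x = 2 * (‖f‖ ^ 2 - inner ℝ f (mollify L n f)) := by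
  have hf := Lp.memLp f
  have hf1 : Integrable f (mu L) := hf.integrable (by norm_num)
  have i1 : Integrable (fun x => f x * kerInt L n f x) (mu L) := by
    simp_rw [mul_comm (f _)]
    exact integrable_continuous_mul (continuous_kerInt hL n hf1) hf1
  have i2 : Integrable (kerInt L n fun y => f y ^ 2) (mu L) :=
    memLp_one_iff_integrable.1 (continuous_kerInt hL n hf.integrable_sq).memLp_mu
  have h1 : ∫ x in Omega L, (f x ^ 2 - 2 * (f x * kerInt L n f x) + kerInt L n (fun y => f y ^ 2) x)
      = (∫ x in Omega L, (f x ^ 2 - 2 * (f x * kerInt L n f x)))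
        + ∫ x in Omega L, kerInt L n (fun y => f y ^ 2) x :=
    integral_add (hf.integrable_sq.sub (i1.const_mul 2)) i2
  have h2 : ∫ x in Omega L, (f x ^ 2 - 2 * (f x * kerInt L n f x))
      = (∫ x in Omega L, f x ^ 2) - ∫ x in Omega L, 2 * (f x * kerInt L n f x) :=
    integral_sub hf.integrable_sq (i1.const_mul 2)
  simp_rw [osc_eq hL n hf]
  rw [h1, h2, integral_const_mul, integral_kerInt hL n hf.integrable_sq, norm_sq_eq_integral,
    inner_eq_integral]
  have : ∫ p in Omega L, f p * mollify L n f p = ∫ p in Omega L, f p * kerInt L n f p :=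
    integral_congr_ae (by
      have : mollify L n f =ᵐ[volume.restrict (Omega L)] kerInt L n f := mollify_ae_eq hL n f
      filter_upwards [this] with p hp
      rw [hp])
  rw [this]
  ring

/-! ### Completeness of the Fourier basis -/

/-- A Lipschitz function on `[0,L]` vanishing at both ends is Lipschitz for the distance on the
circle, here expressed by the chord. -/
theorem sq_sub_le_one_sub_cos {L C : ℝ} (hL : 0 < L) {h : ℝ → ℝ}
    (hC : ∀ a b, |h a - h b| ≤ C * |a - b|) (h0 : h 0 = 0) (h1 : h L = 0) {a b : ℝ}
    (ha : a ∈ Icc 0 L) (hb : b ∈ Icc 0 L) :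
    (h a - h b) ^ 2 ≤ (C * L) ^ 2 * (1 - Real.cos (2 * Real.pi * (a - b) / L)) := by
  wlog hab : b ≤ a generalizing a b
  · have := this hb ha (le_of_not_ge hab)
    have e : 2 * Real.pi * (a - b) / L = -(2 * Real.pi * (b - a) / L) := by ring
    rw [e, Real.cos_neg]
    linarith [sq_abs (h a - h b), sq_abs (h b - h a), abs_sub_comm (h a) (h b),
      congrArg (· ^ 2) (abs_sub_comm (h a) (h b))]
  have hC0 : 0 ≤ C := by
    have := (abs_nonneg _).trans (hC 1 0)
    simpa using this
  set s := (a - b) / L with hs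
  have hsL : a - b = s * L := by rw [hs]; field_simp
  have hs0 : 0 ≤ s := div_nonneg (by linarith) hL.le
  have hs1 : s ≤ 1 := by rw [hs, div_le_one hL]; linarith [ha.2, hb.1]
  have hcos : 1 - Real.cos (2 * Real.pi * (a - b) / L) = 2 * Real.sin (Real.pi * s) ^ 2 := by
    have : 2 * Real.pi * (a - b) / L = 2 * (Real.pi * s) := by rw [hs]; ring
    rw [this, Real.cos_two_mul, Real.sin_sq]
    ring
  have hpi := Real.pi_pos
  rw [hcos]
  have bound : ∀ m : ℝ, 0 ≤ m → 2 * m ≤ Real.sin (Real.pi * s) → |h a - h b| ≤ C * L * m →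
      (h a - h b) ^ 2 ≤ (C * L) ^ 2 * (2 * Real.sin (Real.pi * s) ^ 2) := by
    intro m hm hsin hh
    have h3 : (h a - h b) ^ 2 ≤ (C * L * m) ^ 2 := by
      rw [← sq_abs]; exact pow_le_pow_left₀ (abs_nonneg _) hh 2
    have h4 : (2 * m) ^ 2 ≤ Real.sin (Real.pi * s) ^ 2 :=
      pow_le_pow_left₀ (by linarith) hsin 2
    have h5 : m ^ 2 ≤ 2 * Real.sin (Real.pi * s) ^ 2 := by nlinarith
    calc _ ≤ _ := h3
      _ = (C * L) ^ 2 * m ^ 2 := by ring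
      _ ≤ _ := by gcongr
  -- the short arc is `[b, a]` itself, or its complement, which passes through the end points
  rcases le_total s (1 / 2) with hh | hh
  · refine bound s hs0 ?_ ?_
    · have := Real.mul_le_sin (x := Real.pi * s) (by positivity) (by nlinarith)
      have e : 2 / Real.pi * (Real.pi * s) = 2 * s := by field_simp
      linarith
    · have := hC a b
      rwa [abs_of_nonneg (by linarith : 0 ≤ a - b), hsL, mul_comm s, ← mul_assoc] at this
  · refine bound (1 - s) (by linarith) ?_ ?_
    · have := Real.mul_le_sin (x := Real.pi * (1 - s)) (mul_nonneg hpi.le (by linarith))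
        (by nlinarith)
      have e : 2 / Real.pi * (Real.pi * (1 - s)) = 2 * (1 - s) := by field_simp
      have e2 : Real.pi * (1 - s) = Real.pi - Real.pi * s := by ring
      rw [e2, Real.sin_pi_sub, ← e2] at this
      linarith
    · have i1 := hC a L
      have i2 := hC b 0
      rw [h1, sub_zero] at i1
      rw [h0, sub_zero, sub_zero, abs_of_nonneg hb.1] at i2
      rw [abs_sub_comm, abs_of_nonneg (by linarith [ha.2] : 0 ≤ L - a)] at i1
      have i3 : |h a - h b| ≤ |h a| + |h b| := abs_sub _ _
      have e : C * L * (1 - s) = C * (L - a) + C * b := by linear_combination C * hsL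
      linarith

/-- For test functions the convergence follows from the concentration of the kernel on the
diagonal, without the completeness of the basis, which is deduced from it. -/
theorem tendsto_mollify_testFunction {L : ℝ} (hL : 0 < L) {g : ℝ × ℝ → ℝ}
    (hg : ContDiff ℝ (⊤ : ℕ∞) g) (hcpt : HasCompactSupport g) (hsupp : tsupport g ⊆ Omega L)
    {G : L2Omega L} (hG : G =ᵐ[mu L] g) :
    Tendsto (fun n => mollify L n G) atTop (𝓝 G) := by
  have hz : ∀ p, p ∉ Omega L → g p = 0 := fun p hp =>
    image_eq_zero_of_notMem_tsupport fun hm => hp (hsupp hm)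
  obtain ⟨C, hC⟩ := ContDiff.lipschitzWith_of_hasCompactSupport hcpt
    (hg.of_le (by exact_mod_cast le_top) : ContDiff ℝ 1 g) one_ne_zero
  set c : ℝ × ℝ → ℝ × ℝ → ℝ := fun x y => (1 - Real.cos (2 * Real.pi * (x.1 - y.1) / L))
    + (1 - Real.cos (2 * Real.pi * (x.2 - y.2) / L)) with hc
  have hpt : ∀ x ∈ Omega L, ∀ y ∈ Omega L, (g x - g y) ^ 2 ≤ 2 * (C * L) ^ 2 * c x y := by
    intro x hx y hy
    have k1 : (g (x.1, x.2) - g (y.1, x.2)) ^ 2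
        ≤ (C * L) ^ 2 * (1 - Real.cos (2 * Real.pi * (x.1 - y.1) / L)) := by
      refine sq_sub_le_one_sub_cos (h := fun a => g (a, x.2)) hL (fun a b => ?_)
        (hz _ (by simp [Omega])) (hz _ (by simp [Omega])) (Ioo_subset_Icc_self hx.1)
        (Ioo_subset_Icc_self hy.1)
      have := hC.dist_le_mul (a, x.2) (b, x.2)
      simpa [Real.dist_eq, Prod.dist_eq] using this
    have k2 : (g (y.1, x.2) - g (y.1, y.2)) ^ 2
        ≤ (C * L) ^ 2 * (1 - Real.cos (2 * Real.pi * (x.2 - y.2) / L)) := by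
      refine sq_sub_le_one_sub_cos (h := fun a => g (y.1, a)) hL (fun a b => ?_)
        (hz _ (by simp [Omega])) (hz _ (by simp [Omega])) (Ioo_subset_Icc_self hx.2)
        (Ioo_subset_Icc_self hy.2)
      have := hC.dist_le_mul (y.1, a) (y.1, b)
      simpa [Real.dist_eq, Prod.dist_eq] using this
    -- go from `x` to `y` through the corner `(y.1, x.2)`, which is again in the square
    have k3 : (g x - g y) ^ 2 ≤ 2 * ((g (x.1, x.2) - g (y.1, x.2)) ^ 2
        + (g (y.1, x.2) - g (y.1, y.2)) ^ 2) := by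
      nlinarith [sq_nonneg ((g (x.1, x.2) - g (y.1, x.2)) - (g (y.1, x.2) - g (y.1, y.2)))]
    rw [hc]
    linarith
  have hgm : MemLp g 2 (mu L) := hg.continuous.memLp_mu
  have hcc : ∀ x, Continuous (c x) := fun x => by simp only [hc]; fun_prop
  have hmeas : MeasurableSet (Omega L) := measurableSet_Ioo.prod measurableSet_Ioo
  have hosc : ∀ n, ∀ x ∈ Omega L,
      osc L n g x ≤ 2 * (C * L) ^ 2 * ((1 - weight n (1, 0)) + (1 - weight n (0, 1))) := by
    intro n x hx
    have iK : ∀ a : ℝ × ℝ → ℝ, Continuous a →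
        Integrable (fun y => kernel L n x y * a y) (mu L) := fun a ha =>
      memLp_one_iff_integrable.1 ((continuous_kernel hL n x).mul ha).memLp_mu
    have e1 := integral_kernel_mul_cos hL n (1, 0) x
    have e2 := integral_kernel_mul_cos hL n (0, 1) x
    simp only [Int.cast_one, Int.cast_zero, one_mul, zero_mul, add_zero, zero_add] at e1 e2
    have i0 : Integrable (kernel L n x) (mu L) :=
      memLp_one_iff_integrable.1 (continuous_kernel hL n x).memLp_mu
    have i1 := iK (fun y => Real.cos (2 * Real.pi * (x.1 - y.1) / L)) (by fun_prop)
    have i2 := iK (fun y => Real.cos (2 * Real.pi * (x.2 - y.2) / L)) (by fun_prop)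
    have hK : ∫ y in Omega L, kernel L n x y * c x y
        = (1 - weight n (1, 0)) + (1 - weight n (0, 1)) := by
      have j1 := integral_add (i0.sub i1) (i0.sub i2)
      have j2 := integral_sub i0 i1
      have j3 := integral_sub i0 i2
      simp only [Pi.sub_apply] at j1 j2 j3
      rw [mu] at j1 j2 j3
      rw [j2, j3, e1, e2, integral_kernel hL] at j1
      rw [← j1]
      exact integral_congr_ae (ae_of_all _ fun y => by simp only [hc]; ring)
    rw [← hK, ← integral_const_mul]
    refine setIntegral_mono_on ?_ ((iK _ (hcc x)).const_mul _) hmeas fun y hy => ?_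
    · exact iK (fun y => (g x - g y) ^ 2) (by have := hg.continuous; fun_prop)
    · have := mul_le_mul_of_nonneg_left (hpt x hx y hy) (kernel_nonneg L n x y)
      linarith
  have hbd : ∀ n, ‖mollify L n G - G‖ ^ 2
      ≤ L ^ 2 * ((C * L) ^ 2 * ((1 - weight n (1, 0)) + (1 - weight n (0, 1)))) := by
    intro n
    refine (norm_mollify_sub_sq_le hL n G).trans ?_
    have h1 := integral_osc hL n G
    have h2 : ∫ x in Omega L, osc L n G x = ∫ x in Omega L, osc L n g x := by
      have hG' : G =ᵐ[volume.restrict (Omega L)] g := hG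
      refine integral_congr_ae ?_
      filter_upwards [hG'] with x hx
      simp only [osc]
      refine integral_congr_ae ?_
      filter_upwards [hG'] with y hy
      rw [hx, hy]
    have h3 : ∫ x in Omega L, osc L n g x ≤ ∫ x in Omega L,
        2 * (C * L) ^ 2 * ((1 - weight n (1, 0)) + (1 - weight n (0, 1))) :=
      setIntegral_mono_on (integrable_osc hL n hgm) (integrable_const (μ := mu L) _) hmeas (hosc n)
    rw [integral_const_Omega hL] at h3
    linarith
  have hlim : Tendsto (fun n => L ^ 2 * ((C * L : ℝ) ^ 2 * ((1 - weight n (1, 0))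
      + (1 - weight n (0, 1))))) atTop (𝓝 0) := by
    have := (((tendsto_const_nhds (x := (1 : ℝ))).sub (tendsto_weight (1, 0))).add
      ((tendsto_const_nhds (x := (1 : ℝ))).sub (tendsto_weight (0, 1)))).const_mul ((C * L : ℝ) ^ 2)
    simpa using this.const_mul (L ^ 2)
  have h0 := squeeze_zero (fun n => sq_nonneg _) hbd hlim
  rw [tendsto_iff_norm_sub_tendsto_zero]
  have := h0.sqrt
  simpa using this

/-- A square integrable function with vanishing Fourier coefficients is zero. -/
theorem eq_zero_of_inner_fourierVec_eq_zero {L : ℝ} (hL : 0 < L) {f : L2Omega L}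
    (hf : ∀ ξ, inner ℝ (fourierVec L ξ) f = 0) : f = 0 := by
  have hopen : IsOpen (Omega L) := isOpen_Ioo.prod isOpen_Ioo
  have hint : IntegrableOn f (Omega L) := (Lp.memLp f).integrable (by norm_num)
  have hz : ∀ᵐ p, p ∈ Omega L → f p = 0 := by
    refine hopen.ae_eq_zero_of_integral_contDiff_smul_eq_zero hint.locallyIntegrableOn ?_
    intro φ hφ hcpt hsupp
    have hm : MemLp φ 2 (mu L) := hφ.continuous.memLp_mu
    have hlim := (tendsto_mollify_testFunction hL hφ hcpt hsupp hm.coeFn_toLp).inner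
      (𝕜 := ℝ) (tendsto_const_nhds (x := f))
    have h0 : ∀ n, inner ℝ (mollify L n (hm.toLp φ)) f = 0 := by
      intro n
      rw [real_inner_comm, inner_mollify_right]
      exact Finset.sum_eq_zero fun ξ _ => by rw [hf, mul_zero]
    simp only [h0] at hlim
    have h1 := tendsto_nhds_unique tendsto_const_nhds hlim
    rw [inner_eq_integral] at h1
    rw [← setIntegral_eq_integral_of_forall_compl_eq_zero (s := Omega L)]
    · rw [h1]
      have hc : hm.toLp φ =ᵐ[volume.restrict (Omega L)] φ := hm.coeFn_toLp
      refine integral_congr_ae ?_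
      filter_upwards [hc] with p hp
      rw [hp, smul_eq_mul]
    · intro p hp
      rw [image_eq_zero_of_notMem_tsupport (fun hm => hp (hsupp hm)), zero_smul]
  refine Lp.ext ?_
  have hz' := (ae_restrict_iff' (μ := volume) hopen.measurableSet).2 hz
  filter_upwards [hz', Lp.coeFn_zero ℝ 2 (mu L)] with p hp h0
  rw [hp, h0, Pi.zero_apply]

theorem ext_inner_fourierVec {L : ℝ} (hL : 0 < L) {f g : L2Omega L}
    (h : ∀ ξ, inner ℝ (fourierVec L ξ) f = inner ℝ (fourierVec L ξ) g) : f = g :=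
  sub_eq_zero.1 (eq_zero_of_inner_fourierVec_eq_zero hL fun ξ => by
    rw [inner_sub_right, h, sub_self])

/-- The Fourier basis as a Hilbert basis. -/
noncomputable def fourierBasis {L : ℝ} (hL : 0 < L) : HilbertBasis (ℤ × ℤ) ℝ (L2Omega L) :=
  HilbertBasis.mkOfOrthogonalEqBot (orthonormal_fourierVec hL) (by
    rw [Submodule.eq_bot_iff]
    intro f hf
    refine eq_zero_of_inner_fourierVec_eq_zero hL fun ξ => ?_
    exact (Submodule.mem_orthogonal _ _).1 hf _ (Submodule.subset_span ⟨ξ, rfl⟩))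

theorem coe_fourierBasis {L : ℝ} (hL : 0 < L) : ⇑(fourierBasis hL) = fourierVec L :=
  HilbertBasis.coe_mkOfOrthogonalEqBot _ _

theorem hasSum_inner_fourierVec {L : ℝ} (hL : 0 < L) (f g : L2Omega L) :
    HasSum (fun ξ => inner ℝ (fourierVec L ξ) f * inner ℝ (fourierVec L ξ) g) (inner ℝ f g) := by
  have := (fourierBasis hL).hasSum_inner_mul_inner f g
  simp_rw [coe_fourierBasis, real_inner_comm (fourierVec L _) f] at this
  exact this


/-! ### Weak and strong approximation in `L²(Ω)` -/

/-- For bounded sequences, convergence of the Fourier coefficients is weak convergence. -/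
theorem tendsto_inner_of_tendsto_coeff {L : ℝ} (hL : 0 < L) {F : ℕ → L2Omega L} {f : L2Omega L}
    {M : ℝ} (hb : ∀ n, ‖F n‖ ≤ M)
    (hc : ∀ ξ, Tendsto (fun n => inner ℝ (fourierVec L ξ) (F n)) atTop
      (𝓝 (inner ℝ (fourierVec L ξ) f))) (g : L2Omega L) :
    Tendsto (fun n => inner ℝ g (F n)) atTop (𝓝 (inner ℝ g f)) := by
  have hspan : ∀ h ∈ Submodule.span ℝ (Set.range (fourierVec L)),
      Tendsto (fun n => inner ℝ h (F n)) atTop (𝓝 (inner ℝ h f)) := by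
    intro h hh
    induction hh using Submodule.span_induction with
    | mem x hx => obtain ⟨ξ, rfl⟩ := hx; exact hc ξ
    | zero => simp
    | add x y _ _ h1 h2 => simp_rw [inner_add_left]; exact h1.add h2
    | smul a x _ h1 => simp_rw [real_inner_smul_left]; exact h1.const_mul a
  have hdense : g ∈ closure (Submodule.span ℝ (Set.range (fourierVec L)) : Set (L2Omega L)) := by
    have := (fourierBasis hL).dense_span
    rw [coe_fourierBasis] at this
    have h2 : g ∈ (Submodule.span ℝ (Set.range (fourierVec L))).topologicalClosure := by
      rw [this]; trivial
    exact h2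
  have hM : 0 ≤ M := (norm_nonneg _).trans (hb 0)
  -- approximate `g` by a trigonometric polynomial `h`
  rw [Metric.tendsto_atTop]
  intro ε hε
  obtain ⟨h, hh, hgh⟩ := Metric.mem_closure_iff.1 hdense (ε / (2 * (M + ‖f‖ + 1))) (by positivity)
  obtain ⟨n₀, hn₀⟩ := Metric.tendsto_atTop.1 (hspan h hh) (ε / 2) (by positivity)
  refine ⟨n₀, fun n hn => ?_⟩
  have h1 := hn₀ n hn
  rw [Real.dist_eq] at h1 ⊢
  have e : inner ℝ g (F n) - inner ℝ g f
      = inner ℝ (g - h) (F n - f) + (inner ℝ h (F n) - inner ℝ h f) := by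
    simp only [inner_sub_left, inner_sub_right]; ring
  have h2 : |inner ℝ (g - h) (F n - f)| ≤ ε / (2 * (M + ‖f‖ + 1)) * (M + ‖f‖) := by
    refine (abs_real_inner_le_norm _ _).trans ?_
    rw [dist_eq_norm] at hgh
    exact mul_le_mul hgh.le ((norm_sub_le _ _).trans (add_le_add_left (hb n) _)) (norm_nonneg _)
      (by positivity)
  have h3 : ε / (2 * (M + ‖f‖ + 1)) * (M + ‖f‖) ≤ ε / 2 := by
    rw [div_mul_eq_mul_div, div_le_div_iff₀ (by positivity) (by norm_num)]
    nlinarith [norm_nonneg f]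
  rw [e]
  linarith [abs_add_le (inner ℝ (g - h) (F n - f)) (inner ℝ h (F n) - inner ℝ h f)]

theorem tendsto_mollify {L : ℝ} (hL : 0 < L) (f : L2Omega L) :
    Tendsto (fun n => mollify L n f) atTop (𝓝 f) := by
  have hw := tendsto_inner_of_tendsto_coeff hL (F := fun n => mollify L n f) (f := f)
    (fun n => norm_mollify_le hL n f) (fun ξ => by
      simp_rw [inner_fourierVec_mollify hL]
      simpa using (tendsto_weight ξ).mul_const (inner ℝ (fourierVec L ξ) f)) f
  rw [real_inner_self_eq_norm_sq] at hw
  have hw' := (tendsto_const_nhds (x := ‖f‖ ^ 2)).sub hw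
  rw [sub_self] at hw'
  have h0 := squeeze_zero (fun n => sq_nonneg _) (fun n => norm_mollify_sub_sq_le hL n f) hw'
  rw [tendsto_iff_norm_sub_tendsto_zero]
  simpa using h0.sqrt

theorem MemHP1.wderiv_mollify {L : ℝ} (hL : 0 < L) {f : L2Omega L} (hf : MemHP1 L f) (n : ℕ)
    {e : ℝ × ℝ} (he : e ∈ ({ex, ey} : Set (ℝ × ℝ))) :
    wderiv L e (mollify L n f) = mollify L n (wderiv L e f) := by
  refine ext_inner_fourierVec hL fun ξ => ?_
  rw [((hasPerSmoothRep_mollify hL n f).memHP1 hL).inner_wderiv hL he, inner_fourierVec_mollify hL,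
    inner_fourierVec_mollify hL, hf.inner_wderiv hL he, weight_neg]
  ring

/-! ### The commutator estimate -/

theorem sq_integral_mul_le {α : Type*} [MeasurableSpace α] {μ : Measure α} {a b : α → ℝ}
    (ha : MemLp a 2 μ) (hb : MemLp b 2 μ) :
    (∫ x, a x * b x ∂μ) ^ 2 ≤ (∫ x, a x ^ 2 ∂μ) * ∫ x, b x ^ 2 ∂μ := by
  have key : ∀ {a b : α → ℝ} (ha : MemLp a 2 μ) (hb : MemLp b 2 μ),
      ∫ x, a x * b x ∂μ = inner ℝ (ha.toLp a) (hb.toLp b) := by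
    intro a b ha hb
    rw [L2.inner_def]
    refine integral_congr_ae ?_
    filter_upwards [ha.coeFn_toLp, hb.coeFn_toLp] with p h1 h2
    simp [h1, h2, mul_comm]
  simp_rw [sq]
  rw [key ha hb, key ha ha, key hb hb]
  exact real_inner_mul_inner_self_le _ _

/-- The smoothing defect `‖f‖² - ⟨f, mollify f⟩` is of order `1 / n` for `f ∈ H_P¹(Ω)`. -/
theorem MemHP1.norm_sq_sub_inner_mollify_le {L : ℝ} (hL : 0 < L) {f : L2Omega L}
    (hf : MemHP1 L f) {n : ℕ} (hn : 1 ≤ n) :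
    ‖f‖ ^ 2 - inner ℝ f (mollify L n f)
      ≤ L ^ 2 / (4 * Real.pi ^ 2 * n) * (‖wderiv L ex f‖ ^ 2 + ‖wderiv L ey f‖ ^ 2) := by
  have hn' : (0 : ℝ) < n := by exact_mod_cast hn
  have hpi := Real.pi_pos
  have s1 := hasSum_inner_fourierVec hL f f
  have s2 := hasSum_inner_fourierVec hL f (mollify L n f)
  have s3 := hasSum_inner_fourierVec hL (wderiv L ex f) (wderiv L ex f)
  have s4 := hasSum_inner_fourierVec hL (wderiv L ey f) (wderiv L ey f)
  rw [real_inner_self_eq_norm_sq] at s1 s3 s4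
  have s5 := (Equiv.neg (ℤ × ℤ)).hasSum_iff.2 ((s3.add s4).mul_left (L ^ 2 / (4 * Real.pi ^ 2 * n)))
  refine hasSum_le (fun ξ => ?_) (s1.sub s2) s5
  simp only [Function.comp_apply, Equiv.neg_apply]
  rw [inner_fourierVec_mollify hL, hf.inner_wderiv hL (by simp), hf.inner_wderiv hL (by simp),
    neg_neg]
  simp only [ex, ey, Prod.fst_neg, Prod.snd_neg, Int.cast_neg, mul_one, mul_zero, add_zero,
    zero_add]
  have h := mul_le_mul_of_nonneg_right (one_sub_weight_le hn ξ)
    (mul_self_nonneg (inner ℝ (fourierVec L ξ) f))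
  have e : L ^ 2 / (4 * Real.pi ^ 2 * n) *
      (-(2 * Real.pi * -(ξ.1 : ℝ) / L) * inner ℝ (fourierVec L ξ) f *
          (-(2 * Real.pi * -(ξ.1 : ℝ) / L) * inner ℝ (fourierVec L ξ) f) +
        -(2 * Real.pi * -(ξ.2 : ℝ) / L) * inner ℝ (fourierVec L ξ) f *
          (-(2 * Real.pi * -(ξ.2 : ℝ) / L) * inner ℝ (fourierVec L ξ) f))
      = ((ξ.1 : ℝ) ^ 2 + (ξ.2 : ℝ) ^ 2) / n
        * (inner ℝ (fourierVec L ξ) f * inner ℝ (fourierVec L ξ) f) := by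
    field_simp
    ring
  rw [e]
  refine le_trans (le_of_eq ?_) h
  ring

/-- The commutator of multiplication by `f` and smoothing, applied to `g`. -/
noncomputable def commFun (L : ℝ) (n : ℕ) (f g : ℝ × ℝ → ℝ) (x : ℝ × ℝ) : ℝ :=
  f x * kerInt L n g x - kerInt L n (fun y => f y * g y) x

/-- By the Cauchy-Schwarz inequality, the commutator is controlled by the oscillation of `f` and
the height of the kernel. -/
theorem commFun_sq_le {L : ℝ} (hL : 0 < L) (n : ℕ) (f g : L2Omega L) (x : ℝ × ℝ) :
    commFun L n f g x ^ 2 ≤ osc L n f x * ((4 * n + 1) / L ^ 2 * ‖g‖ ^ 2) := by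
  have hf := Lp.memLp f
  have hg := Lp.memLp g
  have hK := continuous_kernel hL n x
  have hsq : ∀ y, √(kernel L n x y) * √(kernel L n x y) = kernel L n x y := fun y =>
    Real.mul_self_sqrt (kernel_nonneg L n x y)
  have hsK : MemLp (fun y => √(kernel L n x y)) ⊤ (mu L) := hK.sqrt.memLp_mu
  have ha : MemLp (fun y => √(kernel L n x y) * (f x - f y)) 2 (mu L) :=
    ((memLp_const (f x)).sub hf).mul hsK
  have hb : MemLp (fun y => √(kernel L n x y) * g y) 2 (mu L) := hg.mul hsK
  have h := sq_integral_mul_le ha hb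
  have i1 : Integrable (fun y => kernel L n x y * g y) (mu L) :=
    integrable_continuous_mul hK (hg.integrable (by norm_num))
  have i2 : Integrable (fun y => kernel L n x y * (f y * g y)) (mu L) :=
    integrable_continuous_mul hK (integrable_mul f g)
  have e1 : ∫ y, √(kernel L n x y) * (f x - f y) * (√(kernel L n x y) * g y) ∂(mu L)
      = commFun L n f g x := by
    have e : ∀ y, √(kernel L n x y) * (f x - f y) * (√(kernel L n x y) * g y)
        = f x * (kernel L n x y * g y) - kernel L n x y * (f y * g y) := by
      intro y; linear_combination (f x - f y) * g y * hsq y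
    simp_rw [e]
    rw [integral_sub (i1.const_mul _) i2, integral_const_mul]
    rfl
  have e2 : ∫ y, (√(kernel L n x y) * (f x - f y)) ^ 2 ∂(mu L) = osc L n f x := by
    have e : ∀ y, (√(kernel L n x y) * (f x - f y)) ^ 2 = kernel L n x y * (f x - f y) ^ 2 := by
      intro y; linear_combination (f x - f y) ^ 2 * hsq y
    simp_rw [e]
    rfl
  have e3 : ∫ y, (√(kernel L n x y) * g y) ^ 2 ∂(mu L) ≤ (4 * n + 1) / L ^ 2 * ‖g‖ ^ 2 := by
    have e : ∀ y, (√(kernel L n x y) * g y) ^ 2 = kernel L n x y * g y ^ 2 := by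
      intro y; linear_combination g y ^ 2 * hsq y
    simp_rw [e]
    rw [norm_sq_eq_integral, ← integral_const_mul]
    refine integral_mono (integrable_continuous_mul hK hg.integrable_sq)
      (hg.integrable_sq.const_mul _) fun y => ?_
    exact mul_le_mul_of_nonneg_right (kernel_le L n x y) (sq_nonneg _)
  rw [e1, e2] at h
  have hosc : 0 ≤ osc L n f x :=
    integral_nonneg fun y => mul_nonneg (kernel_nonneg L n x y) (sq_nonneg _)
  exact h.trans (mul_le_mul_of_nonneg_left e3 hosc)

/-- Multiplication by a function that is continuous on the plane, hence bounded on the square. -/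
noncomputable def mulL {L : ℝ} {b : ℝ × ℝ → ℝ} (hb : Continuous b) : L2Omega L →L[ℝ] L2Omega L :=
  (ContinuousLinearMap.mul ℝ ℝ).holderL (mu L) ⊤ 2 2 ((hb.memLp_mu (q := ⊤)).toLp b)

theorem coeFn_mulL {L : ℝ} {b : ℝ × ℝ → ℝ} (hb : Continuous b) (f : L2Omega L) :
    mulL hb f =ᵐ[mu L] fun p => b p * f p := by
  have h1 := ContinuousLinearMap.coeFn_holder (r := 2) (ContinuousLinearMap.mul ℝ ℝ)
    ((hb.memLp_mu (q := ⊤) (L := L)).toLp b) f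
  filter_upwards [h1, (hb.memLp_mu (q := ⊤) (L := L)).coeFn_toLp] with p h1 h2
  rw [mulL, ContinuousLinearMap.holderL_apply_apply, h1, h2]
  rfl

/-- The commutator is bounded in `L²(Ω)` uniformly in `n`: the height `O(n)` of the kernel is
compensated by the smoothing defect `O(1 / n)` of `f`. -/
theorem exists_commutator {L : ℝ} (hL : 0 < L) {f : L2Omega L} (hf : MemHP1 L f)
    (g : L2Omega L) {n : ℕ} (hn : 1 ≤ n) :
    ∃ R : L2Omega L, R =ᵐ[mu L] commFun L n f g ∧
      ‖R‖ ≤ ‖g‖ * (‖wderiv L ex f‖ + ‖wderiv L ey f‖) := by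
  have hn' : (1 : ℝ) ≤ n := by exact_mod_cast hn
  have hg1 : Integrable g (mu L) := (Lp.memLp g).integrable (by norm_num)
  have hmem : MemLp (commFun L n f g) 2 (mu L) := by
    refine MemLp.sub ?_ (continuous_kerInt hL n (integrable_mul f g)).memLp_mu
    have : MemLp (kerInt L n g) ⊤ (mu L) := (continuous_kerInt hL n hg1).memLp_mu
    have h2 := (Lp.memLp f).mul this (r := 2)
    refine h2.ae_eq (ae_of_all _ fun p => ?_)
    simp [mul_comm]
  refine ⟨hmem.toLp _, hmem.coeFn_toLp, ?_⟩
  set c := (4 * n + 1) / L ^ 2 * ‖g‖ ^ 2 with hc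
  have hc0 : 0 ≤ c := by positivity
  have h1 : ‖hmem.toLp _‖ ^ 2 ≤ 2 * (‖f‖ ^ 2 - inner ℝ f (mollify L n f)) * c := by
    rw [norm_sq_eq_integral, ← integral_osc hL, ← integral_mul_const]
    have e : ∫ p in Omega L, (hmem.toLp _ : L2Omega L) p ^ 2
        = ∫ p, commFun L n f g p ^ 2 ∂(mu L) :=
      integral_congr_ae (by filter_upwards [hmem.coeFn_toLp] with p hp; rw [hp])
    rw [e]
    exact integral_mono hmem.integrable_sq ((integrable_osc hL n (Lp.memLp f)).mul_const _)
      fun x => commFun_sq_le hL n f g x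
  have h2 := hf.norm_sq_sub_inner_mollify_le hL hn
  set D := ‖wderiv L ex f‖ ^ 2 + ‖wderiv L ey f‖ ^ 2 with hD
  have hD0 : 0 ≤ D := by positivity
  have h3 : ‖hmem.toLp _‖ ^ 2 ≤ ‖g‖ ^ 2 * D := by
    refine h1.trans ?_
    calc 2 * (‖f‖ ^ 2 - inner ℝ f (mollify L n f)) * c
        ≤ 2 * (L ^ 2 / (4 * Real.pi ^ 2 * n) * D) * c := by gcongr
      _ = (2 * (4 * n + 1) / (4 * Real.pi ^ 2 * n)) * (‖g‖ ^ 2 * D) := by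
          rw [hc]; field_simp
      _ ≤ 1 * (‖g‖ ^ 2 * D) := by
          gcongr
          have hpi : (9 : ℝ) ≤ Real.pi ^ 2 := by nlinarith [Real.pi_gt_three]
          rw [div_le_one (by positivity)]
          nlinarith
      _ = _ := one_mul _
  refine abs_le_of_sq_le_sq' ?_ (by positivity) |>.2
  refine h3.trans ?_
  rw [mul_pow]
  gcongr
  rw [hD]
  nlinarith [norm_nonneg (wderiv L ex f), norm_nonneg (wderiv L ey f)]

/-! ### The advection term -/

open Classical in
/-- `V(u) · ∇v` as an element of `L²(Ω)`, and `0` if it is not square integrable. -/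
noncomputable def advectVec (L : ℝ) (u v : L2Omega L) : L2Omega L :=
  if h : MemLp (advect L u v) 2 (mu L) then h.toLp _ else 0

/-- For smooth periodic `v`, the function `V(u) · ∇v` depends on `∇u` through bounded operators. -/
theorem exists_advect_eq {L : ℝ} (hL : 0 < L) {v : L2Omega L} (hv : HasPerSmoothRep L v) :
    ∃ A B : L2Omega L →L[ℝ] L2Omega L, ∀ u,
      A (wderiv L ex u) - B (wderiv L ey u) =ᵐ[mu L] advect L u v := by
  obtain ⟨a, ha, ha'⟩ := hv.wderiv hL (e := ey) (by simp)
  obtain ⟨b, hb, hb'⟩ := hv.wderiv hL (e := ex) (by simp)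
  refine ⟨mulL ha.continuous, mulL hb.continuous, fun u => ?_⟩
  filter_upwards [ha', hb', coeFn_mulL ha.continuous (wderiv L ex u),
    coeFn_mulL hb.continuous (wderiv L ey u),
    Lp.coeFn_sub (mulL ha.continuous (wderiv L ex u)) (mulL hb.continuous (wderiv L ey u))]
    with p h1 h2 h3 h4 h5
  rw [h5, Pi.sub_apply, h3, h4, advect, h1, h2]
  ring

theorem coeFn_advectVec_of_ae_eq {L : ℝ} {u v G : L2Omega L} (hG : G =ᵐ[mu L] advect L u v) :
    advectVec L u v = G := by
  have h : MemLp (advect L u v) 2 (mu L) := (Lp.memLp G).ae_eq hG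
  rw [advectVec, dif_pos h]
  exact Lp.ext (h.coeFn_toLp.trans hG.symm)

theorem coeFn_advectVec {L : ℝ} (hL : 0 < L) (u : L2Omega L) {v : L2Omega L}
    (hv : HasPerSmoothRep L v) : advectVec L u v =ᵐ[mu L] advect L u v := by
  obtain ⟨A, B, h⟩ := exists_advect_eq hL hv
  rw [coeFn_advectVec_of_ae_eq (h u)]
  exact h u

/-- The trilinear form `(V(u) · ∇v, w)` is an `L²` pairing as soon as `V(u) · ∇v ∈ L²(Ω)`. -/
theorem integral_advect_mul {L : ℝ} {u v G : L2Omega L} (hG : G =ᵐ[mu L] advect L u v)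
    (w : L2Omega L) : ∫ p in Omega L, advect L u v p * w p = inner ℝ G w := by
  rw [inner_eq_integral]
  have hG' : G =ᵐ[volume.restrict (Omega L)] advect L u v := hG
  exact integral_congr_ae (by filter_upwards [hG'] with p hp; rw [hp])

theorem advect_mollify_ae_eq {L : ℝ} (hL : 0 < L) (u : L2Omega L) {v : L2Omega L}
    (hv : MemHP1 L v) (n : ℕ) :
    advect L u (mollify L n v) =ᵐ[mu L] fun p =>
      - wderiv L ey u p * kerInt L n (wderiv L ex v) p
        + wderiv L ex u p * kerInt L n (wderiv L ey v) p := by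
  filter_upwards [mollify_ae_eq hL n (wderiv L ex v), mollify_ae_eq hL n (wderiv L ey v)]
    with p h1 h2
  rw [advect, hv.wderiv_mollify hL n (by simp), hv.wderiv_mollify hL n (by simp), h1, h2]

/-- If `V(u) · ∇v` is square integrable, smoothing `v` keeps it bounded in `L²(Ω)`, uniformly in
`n`. -/
theorem norm_advectVec_mollify_le {L : ℝ} (hL : 0 < L) {u v G : L2Omega L} (hu : MemHP2 L u)
    (hv : MemHP1 L v) (hG : G =ᵐ[mu L] advect L u v) {n : ℕ} (hn : 1 ≤ n) :
    ‖advectVec L u (mollify L n v)‖ ≤ ‖G‖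
      + (‖wderiv L ex v‖ * (‖wderiv L ex (wderiv L ey u)‖ + ‖wderiv L ey (wderiv L ey u)‖)
        + ‖wderiv L ey v‖ * (‖wderiv L ex (wderiv L ex u)‖ + ‖wderiv L ey (wderiv L ex u)‖)) := by
  obtain ⟨R, hR, hRn⟩ := exists_commutator hL hu.2.2 (wderiv L ex v) hn
  obtain ⟨S, hS, hSn⟩ := exists_commutator hL hu.2.1 (wderiv L ey v) hn
  have hker : ∀ x, kerInt L n G x = - kerInt L n (fun y => wderiv L ey u y * wderiv L ex v y) x
      + kerInt L n (fun y => wderiv L ex u y * wderiv L ey v y) x := by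
    intro x
    have i1 := integrable_continuous_mul (continuous_kernel hL n x)
      (integrable_mul (wderiv L ey u) (wderiv L ex v))
    have i2 := integrable_continuous_mul (continuous_kernel hL n x)
      (integrable_mul (wderiv L ex u) (wderiv L ey v))
    have e := integral_add i1.neg i2
    simp only [Pi.neg_apply] at e
    rw [integral_neg] at e
    simp only [kerInt]
    refine Eq.trans ?_ e
    refine integral_congr_ae ?_
    have hG' : G =ᵐ[volume.restrict (Omega L)] advect L u v := hG
    filter_upwards [hG'] with y hy
    rw [hy, advect]
    ring
  have key : advectVec L u (mollify L n v) = mollify L n G + (S - R) := by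
    refine coeFn_advectVec_of_ae_eq ?_
    filter_upwards [advect_mollify_ae_eq hL u hv n, mollify_ae_eq hL n G, hR, hS,
      Lp.coeFn_add (mollify L n G) (S - R), Lp.coeFn_sub S R] with p h1 h2 h3 h4 h5 h6
    rw [h1, h5, Pi.add_apply, h6, Pi.sub_apply, h2, h3, h4, hker, commFun, commFun]
    ring
  rw [key]
  calc _ ≤ ‖mollify L n G‖ + (‖S‖ + ‖R‖) :=
        (norm_add_le _ _).trans (by gcongr; exact norm_sub_le _ _)
    _ ≤ _ := by linarith [norm_mollify_le hL n G]

/-- If `V(u) · ∇v` is square integrable, it is the weak limit in `L²(Ω)` of `V(u) · ∇vₙ` for the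
smoothed `vₙ`. -/
theorem tendsto_inner_advectVec_mollify {L : ℝ} (hL : 0 < L) {u v G : L2Omega L}
    (hu : MemHP2 L u) (hv : MemHP1 L v) (hG : G =ᵐ[mu L] advect L u v) (w : L2Omega L) :
    Tendsto (fun n => inner ℝ w (advectVec L u (mollify L n v))) atTop (𝓝 (inner ℝ w G)) := by
  -- the uniform bound holds for `1 ≤ n` only
  rw [← tendsto_add_atTop_iff_nat 1]
  refine tendsto_inner_of_tendsto_coeff hL
    (fun n => norm_advectVec_mollify_le hL hu hv hG (Nat.le_add_left 1 n)) (fun ξ => ?_) w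
  rw [tendsto_add_atTop_iff_nat (f := fun n =>
    inner ℝ (fourierVec L ξ) (advectVec L u (mollify L n v))) 1]
  have hcf := continuous_fourierFun hL ξ
  have key : ∀ F a b : L2Omega L, (F =ᵐ[mu L] fun p => - wderiv L ey u p * a p
      + wderiv L ex u p * b p) → inner ℝ (fourierVec L ξ) F
        = - inner ℝ (mulL hcf (wderiv L ey u)) a + inner ℝ (mulL hcf (wderiv L ex u)) b := by
    intro F a b hF
    rw [inner_fourierVec, inner_eq_integral, inner_eq_integral, ← integral_neg]
    refine Eq.trans ?_ (integral_add (integrable_mul (mulL hcf (wderiv L ey u)) a).neg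
      (integrable_mul (mulL hcf (wderiv L ex u)) b))
    refine integral_congr_ae ?_
    filter_upwards [hF, coeFn_mulL hcf (wderiv L ey u), coeFn_mulL hcf (wderiv L ex u)]
      with p h1 h2 h3
    rw [h1]
    simp only [h2, h3]
    ring
  have hn : ∀ n, inner ℝ (fourierVec L ξ) (advectVec L u (mollify L n v))
      = - inner ℝ (mulL hcf (wderiv L ey u)) (mollify L n (wderiv L ex v))
        + inner ℝ (mulL hcf (wderiv L ex u)) (mollify L n (wderiv L ey v)) := by
    intro n
    refine key _ _ _ ?_
    filter_upwards [coeFn_advectVec hL u (hasPerSmoothRep_mollify hL n v)] with p hp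
    rw [hp, advect, hv.wderiv_mollify hL n (by simp), hv.wderiv_mollify hL n (by simp)]
  simp_rw [hn]
  rw [key G _ _ hG]
  exact (tendsto_const_nhds.inner (tendsto_mollify hL _)).neg.add
    (tendsto_const_nhds.inner (tendsto_mollify hL _))

/-- The transport by the divergence-free field `V(u)` is skew-symmetric. -/
theorem inner_advectVec_self {L : ℝ} (hL : 0 < L) {u w : L2Omega L} (hu : MemHP1 L u)
    (hw : HasPerSmoothRep L w) : inner ℝ (advectVec L u w) w = 0 := by
  have hadv := coeFn_advectVec hL u hw
  obtain ⟨g, hg, hwg⟩ := hw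
  have hx := HasPerSmoothRep.wderiv_ae_eq hL hg hwg (e := ex) (by simp)
  have hy := HasPerSmoothRep.wderiv_ae_eq hL hg hwg (e := ey) (by simp)
  have hgg := hg.mul hg
  have hd : ∀ p e, fderiv ℝ (fun p => g p * g p) p e = 2 * (fderiv ℝ g p e * g p) := by
    intro p e
    rw [fderiv_fun_mul (hg.differentiableAt p) (hg.differentiableAt p)]
    simp
    ring
  -- both terms are integrals of `u` against the mixed second derivative of `w²`
  have i1 := hu.integral_mul_fderiv hL (hgg.fderiv ex) (e := ey) (by simp)
  have i2 := hu.integral_mul_fderiv hL (hgg.fderiv ey) (e := ex) (by simp)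
  have hsymm : ∀ p, fderiv ℝ (fun q => fderiv ℝ (fun p => g p * g p) q ex) p ey
      = fderiv ℝ (fun q => fderiv ℝ (fun p => g p * g p) q ey) p ex := by
    intro p
    have hcd : ContDiff ℝ (⊤ : ℕ∞) (fun p => g p * g p) := hgg.1
    have hdd : DifferentiableAt ℝ (fderiv ℝ fun p => g p * g p) p :=
      ((hcd.fderiv_right (m := (⊤ : ℕ∞)) (by simp)).differentiable (by simp)) p
    have hs : IsSymmSndFDerivAt ℝ (fun p => g p * g p) p :=
      hcd.contDiffAt.isSymmSndFDerivAt (by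
        rw [minSmoothness_of_isRCLikeNormedField]
        exact WithTop.coe_le_coe.2 (le_top (a := (2 : ℕ∞))))
    rw [fderiv_clm_apply hdd (differentiableAt_const _),
      fderiv_clm_apply hdd (differentiableAt_const _)]
    simpa using hs ey ex
  have hii : ∫ p in Omega L, wderiv L ey u p * fderiv ℝ (fun p => g p * g p) p ex
      = ∫ p in Omega L, wderiv L ex u p * fderiv ℝ (fun p => g p * g p) p ey := by
    simp_rw [hsymm] at i1
    linarith
  have hi : ∀ (e : ℝ × ℝ) (f : L2Omega L),
      Integrable (fun p => f p * fderiv ℝ (fun p => g p * g p) p e) (mu L) := by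
    intro e f
    simp_rw [mul_comm (f _)]
    exact integrable_continuous_mul (hgg.fderiv e).continuous
      ((Lp.memLp f).integrable (by norm_num))
  have hsub := integral_sub (hi ey (wderiv L ex u)) (hi ex (wderiv L ey u))
  have h0 : ∫ p, (wderiv L ex u p * fderiv ℝ (fun p => g p * g p) p ey
      - wderiv L ey u p * fderiv ℝ (fun p => g p * g p) p ex) ∂(mu L) = 0 :=
    hsub.trans (sub_eq_zero.2 hii.symm)
  have e : inner ℝ (advectVec L u w) w = 1 / 2 * ∫ p, (wderiv L ex u p
      * fderiv ℝ (fun p => g p * g p) p ey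
      - wderiv L ey u p * fderiv ℝ (fun p => g p * g p) p ex) ∂(mu L) := by
    rw [inner_eq_integral, ← integral_const_mul]
    refine integral_congr_ae ?_
    filter_upwards [hadv, hwg, hx, hy] with p h1 h2 h3 h4
    rw [h1, advect, h2, h3, h4, hd, hd]
    ring
  rw [e, h0, mul_zero]


/-! ### Linear ordinary differential equations on a compact interval -/

/-- Global solvability of linear equations with continuous coefficients. The Picard map is a
contraction for the exponentially weighted supremum norm. -/
theorem exists_solution_linear_ode {X : Type*} [NormedAddCommGroup X] [NormedSpace ℝ X]
    [CompleteSpace X] {T : ℝ} (hT : 0 < T) {A : ℝ → X →L[ℝ] X} {b : ℝ → X}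
    (hA : ContinuousOn A (Icc 0 T)) (hb : ContinuousOn b (Icc 0 T)) (x₀ : X) :
    ∃ x : ℝ → X, x 0 = x₀ ∧ ContinuousOn x (Icc 0 T) ∧
      ∀ t ∈ Ioo 0 T, HasDerivAt x (A t (x t) + b t) t := by
  obtain ⟨K, hK⟩ := isCompact_Icc.exists_bound_of_continuousOn hA
  have h0T : (0 : ℝ) ∈ Icc 0 T := ⟨le_rfl, hT.le⟩
  have hK0 : 0 ≤ K := (norm_nonneg _).trans (hK 0 h0T)
  let A' : ℝ → X →L[ℝ] X := IccExtend hT.le ((Icc 0 T).domRestrict A)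
  let b' : ℝ → X := IccExtend hT.le ((Icc 0 T).domRestrict b)
  have hA' : Continuous A' := hA.domRestrict.Icc_extend'
  have hb' : Continuous b' := hb.domRestrict.Icc_extend'
  have hAK : ∀ t, ‖A' t‖ ≤ K := fun t => hK _ (projIcc 0 T hT.le t).2
  have hAe : ∀ t ∈ Icc 0 T, A' t = A t := fun t ht => IccExtend_of_mem _ _ ht
  have hbe : ∀ t ∈ Icc 0 T, b' t = b t := fun t ht => IccExtend_of_mem _ _ ht
  let Λ := K + 1
  have hΛ : 0 < Λ := by positivity
  -- the unknown is `exp (-Λ t) x(t)`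
  let ext : C(Icc 0 T, X) → ℝ → X := fun y => IccExtend hT.le y
  have hext : ∀ y, Continuous (ext y) := fun y => y.continuous.Icc_extend'
  let rhs : C(Icc 0 T, X) → ℝ → X := fun y s => Real.exp (Λ * s) • A' s (ext y s) + b' s
  have hrhs : ∀ y, Continuous (rhs y) := by
    intro y
    have h1 := hext y
    have h2 : Continuous fun s => A' s (ext y s) := hA'.clm_apply h1
    exact ((Real.continuous_exp.comp (continuous_const.mul continuous_id)).smul h2).add hb'
  have hprim : ∀ y, Continuous fun t : ℝ => ∫ s in (0 : ℝ)..t, rhs y s := fun y =>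
    intervalIntegral.continuous_primitive (fun a c => (hrhs y).intervalIntegrable a c) 0
  let Φ : C(Icc 0 T, X) → C(Icc 0 T, X) := fun y =>
    ⟨fun t => Real.exp (-(Λ * t)) • (x₀ + ∫ s in (0 : ℝ)..t, rhs y s), by
      have h1 := (hprim y).comp (continuous_subtype_val (p := fun t => t ∈ Icc 0 T))
      exact (Real.continuous_exp.comp (by fun_prop)).smul (continuous_const.add h1)⟩
  have hcontr : ContractingWith ⟨K / Λ, div_nonneg hK0 hΛ.le⟩ Φ := by
    refine ⟨?_, LipschitzWith.of_dist_le_mul fun y z => ?_⟩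
    · change K / Λ < 1
      rw [div_lt_one hΛ]
      exact lt_add_one K
    · refine (ContinuousMap.dist_le (mul_nonneg (div_nonneg hK0 hΛ.le) dist_nonneg)).2 fun t => ?_
      have ht := t.2.1
      have hd : ∀ s, ‖rhs y s - rhs z s‖ ≤ Real.exp (Λ * s) * (K * dist y z) := by
        intro s
        have e : rhs y s - rhs z s = Real.exp (Λ * s) • A' s (ext y s - ext z s) := by
          simp only [rhs, map_sub, smul_sub]
          abel
        rw [e, norm_smul, Real.norm_of_nonneg (Real.exp_pos _).le]
        refine mul_le_mul_of_nonneg_left ?_ (Real.exp_pos _).le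
        refine ((A' s).le_opNorm _).trans (mul_le_mul (hAK s) ?_ (norm_nonneg _) hK0)
        rw [← dist_eq_norm]
        exact ContinuousMap.dist_apply_le_dist _
      have hexp : ∫ s in (0 : ℝ)..t, Real.exp (Λ * s) * (K * dist y z)
          = (Real.exp (Λ * t) / Λ - Real.exp (Λ * 0) / Λ) * (K * dist y z) := by
        rw [intervalIntegral.integral_mul_const]
        congr 1
        refine intervalIntegral.integral_eq_sub_of_hasDerivAt (f := fun s => Real.exp (Λ * s) / Λ)
          (fun s _ => ?_) (Continuous.intervalIntegrable (by fun_prop) _ _)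
        have := (((hasDerivAt_id s).const_mul Λ).exp).div_const Λ
        simpa [hΛ.ne'] using this
      have hint : ‖∫ s in (0 : ℝ)..t, (rhs y s - rhs z s)‖
          ≤ (Real.exp (Λ * t) / Λ) * (K * dist y z) := by
        refine (intervalIntegral.norm_integral_le_of_norm_le ht (ae_of_all _ fun s _ => hd s)
          (Continuous.intervalIntegrable (by fun_prop) _ _)).trans ?_
        rw [hexp]
        refine mul_le_mul_of_nonneg_right ?_ (by positivity)
        have : 0 ≤ Real.exp (Λ * 0) / Λ := by positivity
        linarith
      have e : Φ y t - Φ z t = Real.exp (-(Λ * t)) • ∫ s in (0 : ℝ)..t, (rhs y s - rhs z s) := by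
        rw [intervalIntegral.integral_sub ((hrhs y).intervalIntegrable _ _)
          ((hrhs z).intervalIntegrable _ _)]
        simp only [Φ, ContinuousMap.coe_mk, ← smul_sub]
        congr 1
        abel
      rw [dist_eq_norm, e, norm_smul, Real.norm_of_nonneg (Real.exp_pos _).le]
      refine (mul_le_mul_of_nonneg_left hint (Real.exp_pos _).le).trans (le_of_eq ?_)
      change _ = K / Λ * dist y z
      have h1 : Real.exp (-(Λ * t)) * Real.exp (Λ * t) = 1 := by rw [← Real.exp_add]; simp
      calc _ = (Real.exp (-(Λ * t)) * Real.exp (Λ * t)) * (K / Λ * dist y z) := by ring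
        _ = _ := by rw [h1, one_mul]
  obtain ⟨y, hy⟩ : ∃ y, Φ y = y := ⟨_, hcontr.fixedPoint_isFixedPt⟩
  refine ⟨fun t => x₀ + ∫ s in (0 : ℝ)..t, rhs y s, by simp,
    (continuous_const.add (hprim y)).continuousOn, fun t ht => ?_⟩
  have ht' := Ioo_subset_Icc_self ht
  have hyt : ext y t = Real.exp (-(Λ * t)) • (x₀ + ∫ s in (0 : ℝ)..t, rhs y s) := by
    have h1 : ext y t = y ⟨t, ht'⟩ := IccExtend_of_mem _ _ ht'
    rw [h1]
    exact (DFunLike.congr_fun hy ⟨t, ht'⟩).symm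
  have hval : rhs y t = A t (x₀ + ∫ s in (0 : ℝ)..t, rhs y s) + b t := by
    have h1 : Real.exp (Λ * t) * Real.exp (-(Λ * t)) = 1 := by rw [← Real.exp_add]; simp
    change Real.exp (Λ * t) • A' t (ext y t) + b' t = _
    rw [hyt, map_smul, smul_smul, h1, one_smul, hAe t ht', hbe t ht']
  rw [← hval]
  exact ((hrhs y).integral_hasStrictDerivAt 0 t).hasDerivAt.const_add x₀

/-! ### Galerkin approximations -/

theorem wderiv_add {L : ℝ} (hL : 0 < L) {f g : L2Omega L} (hf : HasPerSmoothRep L f)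
    (hg : HasPerSmoothRep L g) {e : ℝ × ℝ} (he : e ∈ ({ex, ey} : Set (ℝ × ℝ))) :
    wderiv L e (f + g) = wderiv L e f + wderiv L e g := by
  refine ext_inner_fourierVec hL fun ξ => ?_
  rw [inner_add_right, (hf.memHP1 hL).inner_wderiv hL he, (hg.memHP1 hL).inner_wderiv hL he,
    ((hf.add hg).memHP1 hL).inner_wderiv hL he, inner_add_right]
  ring

theorem wderiv_smul {L : ℝ} (hL : 0 < L) {f : L2Omega L} (hf : HasPerSmoothRep L f) (c : ℝ)
    {e : ℝ × ℝ} (he : e ∈ ({ex, ey} : Set (ℝ × ℝ))) :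
    wderiv L e (c • f) = c • wderiv L e f := by
  refine ext_inner_fourierVec hL fun ξ => ?_
  rw [inner_smul_right, (hf.memHP1 hL).inner_wderiv hL he,
    ((hf.smul c).memHP1 hL).inner_wderiv hL he, inner_smul_right]
  ring

theorem advectVec_add {L : ℝ} (hL : 0 < L) (u : L2Omega L) {v v' : L2Omega L}
    (hv : HasPerSmoothRep L v) (hv' : HasPerSmoothRep L v') :
    advectVec L u (v + v') = advectVec L u v + advectVec L u v' := by
  refine coeFn_advectVec_of_ae_eq ?_
  filter_upwards [coeFn_advectVec hL u hv, coeFn_advectVec hL u hv',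
    Lp.coeFn_add (advectVec L u v) (advectVec L u v'),
    Lp.coeFn_add (wderiv L ex v) (wderiv L ex v'),
    Lp.coeFn_add (wderiv L ey v) (wderiv L ey v')] with p h1 h2 h3 h4 h5
  rw [h3, Pi.add_apply, h1, h2, advect, advect, advect, wderiv_add hL hv hv' (by simp),
    wderiv_add hL hv hv' (by simp), h4, h5, Pi.add_apply, Pi.add_apply]
  ring

theorem advectVec_smul {L : ℝ} (hL : 0 < L) (u : L2Omega L) {v : L2Omega L}
    (hv : HasPerSmoothRep L v) (c : ℝ) :
    advectVec L u (c • v) = c • advectVec L u v := by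
  refine coeFn_advectVec_of_ae_eq ?_
  filter_upwards [coeFn_advectVec hL u hv, Lp.coeFn_smul c (advectVec L u v),
    Lp.coeFn_smul c (wderiv L ex v), Lp.coeFn_smul c (wderiv L ey v)] with p h1 h3 h4 h5
  rw [h3, Pi.smul_apply, h1, advect, advect, wderiv_smul hL hv c (by simp),
    wderiv_smul hL hv c (by simp), h4, h5, Pi.smul_apply, Pi.smul_apply]
  simp only [smul_eq_mul]
  ring

theorem MemCHP2.continuousOn_advectVec {L T : ℝ} (hL : 0 < L) {u : ℝ → L2Omega L}
    (hu : MemCHP2 L T u) {v : L2Omega L} (hv : HasPerSmoothRep L v) :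
    ContinuousOn (fun t => advectVec L (u t) v) (Icc 0 T) := by
  obtain ⟨A, B, h⟩ := exists_advect_eq hL hv
  have e : (fun t => advectVec L (u t) v)
      = fun t => A (wderiv L ex (u t)) - B (wderiv L ey (u t)) :=
    funext fun t => coeFn_advectVec_of_ae_eq (h (u t))
  rw [e]
  exact (A.continuous.comp_continuousOn (hu.2.2.1 ex (by simp))).sub
    (B.continuous.comp_continuousOn (hu.2.2.1 ey (by simp)))

theorem advectPairing_eq_inner {L : ℝ} (hL : 0 < L) (u w : ℝ → L2Omega L) {v : L2Omega L}
    (hv : HasPerSmoothRep L v) (s : ℝ) :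
    advectPairing L u w v s = inner ℝ (advectVec L (u s) v) (w s) :=
  integral_advect_mul (coeFn_advectVec hL (u s) hv) (w s)

theorem fourierVec_mem_galerkinSpace {L : ℝ} (σ : ℕ ≃ ℤ × ℤ) {N j : ℕ} (hj : j < N) :
    fourierVec L (σ j) ∈ galerkinSpace L σ N :=
  Submodule.subset_span ⟨⟨j, hj⟩, rfl⟩

theorem hasPerSmoothRep_of_mem_galerkinSpace {L : ℝ} (hL : 0 < L) {σ : ℕ ≃ ℤ × ℤ} {N : ℕ}
    {v : L2Omega L} (hv : v ∈ galerkinSpace L σ N) : HasPerSmoothRep L v := by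
  induction hv using Submodule.span_induction with
  | mem x hx => obtain ⟨j, rfl⟩ := hx; exact hasPerSmoothRep_fourierVec hL _
  | zero => exact HasPerSmoothRep.zero
  | add x y _ _ h1 h2 => exact h1.add h2
  | smul a x _ h1 => exact h1.smul a

theorem MemHP2.inner_helmholtz {L : ℝ} (hL : 0 < L) {f : L2Omega L} (hf : MemHP2 L f)
    (ξ : ℤ × ℤ) :
    inner ℝ (fourierVec L ξ) (helmholtz L f) = eigenvalue L ξ * inner ℝ (fourierVec L ξ) f := by
  rw [helmholtz, inner_sub_right, inner_add_right, hf.2.1.inner_wderiv hL (by simp),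
    hf.2.2.inner_wderiv hL (by simp), hf.1.inner_wderiv hL (by simp),
    hf.1.inner_wderiv hL (by simp), neg_neg, eigenvalue]
  simp only [ex, ey, Prod.fst_neg, Prod.snd_neg, Int.cast_neg, mul_one, mul_zero, add_zero,
    zero_add]
  field_simp
  ring

theorem inner_fourierVec_starProjection {L : ℝ} (hL : 0 < L) (σ : ℕ ≃ ℤ × ℤ) (N j : ℕ)
    (f : L2Omega L) :
    inner ℝ (fourierVec L (σ j)) ((galerkinSpace L σ N).starProjection f)
      = if j < N then inner ℝ (fourierVec L (σ j)) f else 0 := by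
  rw [← Submodule.inner_starProjection_left_eq_right]
  split_ifs with hj
  · rw [Submodule.starProjection_eq_self_iff.2 (fourierVec_mem_galerkinSpace σ hj)]
  · have : fourierVec L (σ j) ∈ (galerkinSpace L σ N)ᗮ := by
      rw [galerkinSpace, Submodule.mem_orthogonal]
      intro v hv
      induction hv using Submodule.span_induction with
      | mem x hx =>
        obtain ⟨i, rfl⟩ := hx
        refine (orthonormal_fourierVec hL).2 fun h => hj ?_
        rw [← σ.injective h]
        exact i.2
      | zero => simp
      | add x y _ _ h1 h2 => rw [inner_add_left, h1, h2, add_zero]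
      | smul a x _ h1 => rw [real_inner_smul_left, h1, mul_zero]
    rw [(Submodule.starProjection_apply_eq_zero_iff _).2 this, inner_zero_left]

/-- `I - Δ` commutes with the projection to a span of eigenfunctions. -/
theorem MemHP2.helmholtz_starProjection {L : ℝ} (hL : 0 < L) (σ : ℕ ≃ ℤ × ℤ) (N : ℕ)
    {f : L2Omega L} (hf : MemHP2 L f) :
    helmholtz L ((galerkinSpace L σ N).starProjection f)
      = (galerkinSpace L σ N).starProjection (helmholtz L f) := by
  have hP := (hasPerSmoothRep_of_mem_galerkinSpace hL
    (Submodule.starProjection_apply_mem (galerkinSpace L σ N) f)).memHP2 hL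
  refine ext_inner_fourierVec hL fun ξ => ?_
  obtain ⟨j, rfl⟩ := σ.surjective ξ
  rw [hP.inner_helmholtz hL, inner_fourierVec_starProjection hL, inner_fourierVec_starProjection hL,
    hf.inner_helmholtz hL]
  split_ifs <;> simp

/-- The Galerkin system is a linear equation in the finite-dimensional space `E_N`, written out on
the orthonormal basis of `E_N`. -/
theorem exists_isSpectralSolution {L T : ℝ} (k : ℝ) (hL : 0 < L) (hT : 0 < T)
    {u : ℝ → L2Omega L} (hu : MemCHP2 L T u) (σ : ℕ ≃ ℤ × ℤ) (N : ℕ) :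
    ∃ W, IsSpectralSolution L T k σ N u W := by
  have h0T : (0 : ℝ) ∈ Icc 0 T := ⟨le_rfl, hT.le⟩
  let E := galerkinSpace L σ N
  let φ : Fin N → E := fun j => ⟨fourierVec L (σ j), fourierVec_mem_galerkinSpace σ j.2⟩
  let A : ℝ → E →L[ℝ] E := fun t =>
    ∑ j : Fin N,
      ((innerSL ℝ (advectVec L (u t) (fourierVec L (σ j)))).comp E.subtypeL).smulRight (φ j)
  let b : ℝ → E := fun t =>
    ∑ j : Fin N, (k * inner ℝ (wderiv L ey (u t)) (fourierVec L (σ j))) • φ j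
  have hadv : ∀ j : Fin N,
      ContinuousOn (fun t => advectVec L (u t) (fourierVec L (σ j))) (Icc 0 T) := fun j =>
    hu.continuousOn_advectVec hL (hasPerSmoothRep_fourierVec hL _)
  have hA : ContinuousOn A (Icc 0 T) := by
    refine continuousOn_finsetSum _ fun j _ => ?_
    have h1 : ContinuousOn (fun t => (innerSL ℝ (advectVec L (u t) (fourierVec L (σ j)))).comp
        E.subtypeL) (Icc 0 T) :=
      ((innerSL ℝ).continuous.comp_continuousOn (hadv j)).clm_comp continuousOn_const
    have h2 : Continuous fun l : ↥E →L[ℝ] ℝ => l.smulRight (φ j) :=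
      (isBoundedBilinearMap_smulRight.isBoundedLinearMap_left (φ j)).continuous
    exact h2.comp_continuousOn h1
  have huy : ContinuousOn (fun t => wderiv L ey (u t)) (Icc 0 T) := hu.2.2.1 ey (by simp)
  have hb : ContinuousOn b (Icc 0 T) :=
    continuousOn_finsetSum _ fun j _ => by
      have h1 : ContinuousOn (fun t => k * inner ℝ (wderiv L ey (u t)) (fourierVec L (σ j)))
        (Icc 0 T) := continuousOn_const.mul (huy.inner continuousOn_const)
      exact h1.smul continuousOn_const
  have hmem0 : helmholtz L (E.starProjection (u 0)) ∈ E := by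
    rw [(hu.1 0 h0T).helmholtz_starProjection hL]
    exact Submodule.starProjection_apply_mem _ _
  obtain ⟨x, hx0, hxc, hxd⟩ := exists_solution_linear_ode hT hA hb
    (⟨helmholtz L (E.starProjection (u 0)), hmem0⟩ : E)
  have hd : ∀ t ∈ Ioo 0 T, HasDerivAt (fun t => (x t : L2Omega L))
      ((A t (x t) + b t : E) : L2Omega L) t := fun t ht =>
    E.subtypeL.hasFDerivAt.comp_hasDerivAt t (hxd t ht)
  refine ⟨fun t => x t, fun t _ => (x t).2, continuous_subtype_val.comp_continuousOn hxc,
    fun t ht => (hd t ht).differentiableAt.differentiableWithinAt, ?_, fun v hv t ht => ?_, ?_⟩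
  · have h1 : ContinuousOn (fun t => ((A t (x t) + b t : E) : L2Omega L)) (Ioo 0 T) :=
      (continuous_subtype_val.comp_continuousOn ((hA.clm_apply hxc).add hb)).mono
        Ioo_subset_Icc_self
    exact h1.congr fun t ht => (hd t ht).deriv
  · rw [(hd t ht).deriv,
      advectPairing_eq_inner hL u _ (hasPerSmoothRep_of_mem_galerkinSpace hL hv)]
    have hsum : ((A t (x t) + b t : E) : L2Omega L)
        = ∑ j : Fin N, (inner ℝ (advectVec L (u t) (fourierVec L (σ j))) (x t : L2Omega L)
          + k * inner ℝ (wderiv L ey (u t)) (fourierVec L (σ j))) • fourierVec L (σ j) := by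
      simp only [A, b, φ, Submodule.coe_add, _root_.sum_apply, Submodule.coe_sum,
        ContinuousLinearMap.smulRight_apply, Submodule.coe_smul, add_smul, Finset.sum_add_distrib]
      rfl
    rw [hsum]
    induction hv using Submodule.span_induction with
    | mem y hy =>
      obtain ⟨i, rfl⟩ := hy
      have hon : Orthonormal ℝ fun j : Fin N => fourierVec L (σ j) :=
        (orthonormal_fourierVec hL).comp _ (σ.injective.comp Fin.val_injective)
      exact hon.inner_left_fintype _ i
    | zero =>
      rw [← zero_smul ℝ (0 : L2Omega L), advectVec_smul hL _ HasPerSmoothRep.zero]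
      simp
    | add y z hy hz h1 h2 =>
      rw [advectVec_add hL _ (hasPerSmoothRep_of_mem_galerkinSpace hL hy)
        (hasPerSmoothRep_of_mem_galerkinSpace hL hz), inner_add_right, h1, h2, inner_add_left,
        inner_add_right]
      ring
    | smul a y hy h1 =>
      rw [advectVec_smul hL _ (hasPerSmoothRep_of_mem_galerkinSpace hL hy), inner_smul_right, h1,
        real_inner_smul_left, inner_smul_right]
      ring
  · simp only [hx0]
    rfl

/-- A form of Grönwall's inequality that needs no derivative at the end points. -/
theorem le_mul_exp_of_deriv_le {T c : ℝ} {f f' : ℝ → ℝ} (hc : 0 ≤ c)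
    (hf : ContinuousOn f (Icc 0 T)) (hd : ∀ t ∈ Ioo 0 T, HasDerivAt f (f' t) t)
    (hle : ∀ t ∈ Ioo 0 T, f' t ≤ f t + c) (h0 : 0 ≤ f 0) {t : ℝ} (ht : t ∈ Icc 0 T) :
    f t ≤ (f 0 + c) * Real.exp T := by
  have hcont : ContinuousOn (fun t => (f t + c) * Real.exp (-t)) (Icc 0 T) :=
    (hf.add continuousOn_const).mul (by fun_prop)
  have hder : ∀ t ∈ Ioo 0 T, HasDerivAt (fun t => (f t + c) * Real.exp (-t))
      (f' t * Real.exp (-t) + (f t + c) * (Real.exp (-t) * (-1))) t := fun t ht =>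
    ((hd t ht).add_const c).mul ((hasDerivAt_neg t).exp)
  have hanti : AntitoneOn (fun t => (f t + c) * Real.exp (-t)) (Icc 0 T) := by
    refine antitoneOn_of_deriv_nonpos (convex_Icc 0 T) hcont ?_ ?_
    · rw [interior_Icc]
      exact fun t ht => (hder t ht).differentiableAt.differentiableWithinAt
    · rw [interior_Icc]
      intro t ht
      rw [(hder t ht).deriv]
      nlinarith [hle t ht, Real.exp_pos (-t)]
  have h1 := hanti ⟨le_rfl, ht.1.trans ht.2⟩ ht ht.1
  simp only [neg_zero, Real.exp_zero, mul_one] at h1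
  have h2 : f t + c ≤ (f 0 + c) * Real.exp t := by
    have e : f t + c = (f t + c) * Real.exp (-t) * Real.exp t := by
      rw [mul_assoc, ← Real.exp_add]; simp
    rw [e]
    exact mul_le_mul_of_nonneg_right h1 (Real.exp_pos t).le
  have h3 : (f 0 + c) * Real.exp t ≤ (f 0 + c) * Real.exp T :=
    mul_le_mul_of_nonneg_left (Real.exp_le_exp.2 ht.2) (by linarith)
  linarith

namespace IsSpectralSolution

variable {L T k : ℝ} {u W : ℝ → L2Omega L} {σ : ℕ ≃ ℤ × ℤ} {N : ℕ}

/-- The energy estimate: skew-symmetry removes the advection term. -/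
theorem norm_le (hL : 0 < L) (hT : 0 < T) (hu : MemCHP2 L T u)
    (hW : IsSpectralSolution L T k σ N u W) {C : ℝ}
    (hC : ∀ t ∈ Icc 0 T, ‖wderiv L ey (u t)‖ ≤ C) {t : ℝ} (ht : t ∈ Icc 0 T) :
    ‖W t‖ ≤ √((‖helmholtz L (u 0)‖ ^ 2 + (k * C) ^ 2) * Real.exp T) := by
  have h0T : (0 : ℝ) ∈ Icc 0 T := ⟨le_rfl, hT.le⟩
  have hC0 : 0 ≤ C := (norm_nonneg _).trans (hC 0 h0T)
  refine Real.le_sqrt_of_sq_le ?_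
  have hinit : ‖W 0‖ ^ 2 ≤ ‖helmholtz L (u 0)‖ ^ 2 := by
    rw [hW.2.2.2.2.2, (hu.1 0 h0T).helmholtz_starProjection hL]
    gcongr
    exact Submodule.norm_starProjection_apply_le _ _
  have hd : ∀ t ∈ Ioo 0 T,
      HasDerivAt (fun t => ‖W t‖ ^ 2) (2 * inner ℝ (W t) (deriv W t)) t := fun t ht =>
    ((hW.2.2.1 t ht).differentiableAt (isOpen_Ioo.mem_nhds ht)).hasDerivAt.norm_sq
  have hle : ∀ t ∈ Ioo 0 T, 2 * inner ℝ (W t) (deriv W t) ≤ ‖W t‖ ^ 2 + (k * C) ^ 2 := by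
    intro t ht
    have ht' := Ioo_subset_Icc_self ht
    have hsm := hasPerSmoothRep_of_mem_galerkinSpace hL (hW.1 t ht')
    rw [real_inner_comm, hW.2.2.2.2.1 (W t) (hW.1 t ht') t ht,
      advectPairing_eq_inner hL u W hsm, inner_advectVec_self hL (hu.1 t ht').1 hsm, zero_add]
    have h1 : |inner ℝ (wderiv L ey (u t)) (W t)| ≤ C * ‖W t‖ :=
      (abs_real_inner_le_norm _ _).trans (mul_le_mul_of_nonneg_right (hC t ht') (norm_nonneg _))
    have h2 : k * inner ℝ (wderiv L ey (u t)) (W t) ≤ |k| * (C * ‖W t‖) := by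
      refine (le_abs_self _).trans ?_
      rw [abs_mul]
      exact mul_le_mul_of_nonneg_left h1 (abs_nonneg k)
    have h3 : (k * C) ^ 2 = (|k| * C) ^ 2 := by rw [mul_pow, mul_pow, sq_abs]
    nlinarith [sq_nonneg (|k| * C - ‖W t‖)]
  have hcont : ContinuousOn (fun t => ‖W t‖ ^ 2) (Icc 0 T) := hW.2.1.norm.pow 2
  refine (le_mul_exp_of_deriv_le (sq_nonneg (k * C)) hcont hd hle
    (sq_nonneg _) ht).trans ?_
  exact mul_le_mul_of_nonneg_right (by linarith) (Real.exp_pos T).le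

/-- The Galerkin equation integrated in time, for times up to and including the end points. -/
theorem inner_eq_integral (hL : 0 < L) (hu : MemCHP2 L T u)
    (hW : IsSpectralSolution L T k σ N u W) {v : L2Omega L} (hv : v ∈ galerkinSpace L σ N)
    {s t : ℝ} (hs : s ∈ Icc 0 T) (ht : t ∈ Icc 0 T) (hst : s ≤ t) :
    inner ℝ v (W t) - inner ℝ v (W s)
      = ∫ r in s..t, (inner ℝ (advectVec L (u r) v) (W r) + k * inner ℝ (wderiv L ey (u r)) v) := by
  have hsub : Icc s t ⊆ Icc 0 T := Icc_subset_Icc hs.1 ht.2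
  have hsm := hasPerSmoothRep_of_mem_galerkinSpace hL hv
  symm
  refine intervalIntegral.integral_eq_sub_of_hasDerivAt_of_le hst
    (f := fun t => inner ℝ v (W t)) ((continuousOn_const.inner hW.2.1).mono hsub)
    (fun r hr => ?_) ?_
  · have hr' : r ∈ Ioo 0 T := ⟨hs.1.trans_lt hr.1, hr.2.trans_le ht.2⟩
    have h1 := hW.2.2.2.2.1 v hv r hr'
    rw [advectPairing_eq_inner hL u W hsm] at h1
    rw [← h1, real_inner_comm]
    have hd := ((hW.2.2.1 r hr').differentiableAt (isOpen_Ioo.mem_nhds hr')).hasDerivAt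
    simpa using (hasDerivAt_const r v).inner ℝ hd
  · refine ContinuousOn.intervalIntegrable ?_
    rw [uIcc_of_le hst]
    have h1 : ContinuousOn (fun t => wderiv L ey (u t)) (Icc 0 T) := hu.2.2.1 ey (by simp)
    exact (((hu.continuousOn_advectVec hL hsm).inner hW.2.1).add
      (continuousOn_const.mul (h1.inner continuousOn_const))).mono hsub

end IsSpectralSolution


/-! ### Compactness in time -/

/-- A sequence of families of uniformly bounded, eventually equi-Lipschitz functions has a
subsequence that converges at every time: it suffices to make it converge at rational times. -/
theorem exists_subseq_tendsto_of_lipschitz {ι : Type*} [Countable ι] {T M : ℝ} (hT : 0 < T)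
    {c : ℕ → ι → ℝ → ℝ} (hb : ∀ n i, ∀ t ∈ Icc 0 T, |c n i t| ≤ M)
    (hlip : ∀ i, ∃ K, ∀ᶠ n in atTop, ∀ s ∈ Icc 0 T, ∀ t ∈ Icc 0 T,
      |c n i t - c n i s| ≤ K * |t - s|) :
    ∃ N : ℕ → ℕ, StrictMono N ∧
      ∀ i, ∀ t ∈ Icc 0 T, ∃ l, Tendsto (fun j => c (N j) i t) atTop (𝓝 l) := by
  let τ : ℚ → ℝ := fun q => projIcc 0 T hT.le q
  let x : ℕ → ι × ℚ → ℝ := fun n p => c n p.1 (τ p.2)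
  have hcpt : IsCompact (Set.pi univ fun _ : ι × ℚ => Icc (-M) M) :=
    isCompact_univ_pi fun _ => isCompact_Icc
  obtain ⟨a, -, N, hN, ha⟩ := hcpt.tendsto_subseq (x := x) fun n p _ =>
    abs_le.1 (hb n p.1 _ (projIcc 0 T hT.le p.2).2)
  refine ⟨N, hN, fun i t ht => ?_⟩
  obtain ⟨K, hK⟩ := hlip i
  refine cauchySeq_tendsto_of_complete (Metric.cauchySeq_iff'.2 fun ε hε => ?_)
  have hδ : 0 < ε / (4 * (|K| + 1)) := by positivity
  obtain ⟨q, hq1, hq2⟩ := exists_rat_btwn (lt_add_of_pos_right t hδ)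
  have hτt : |τ q - t| ≤ ε / (4 * (|K| + 1)) := by
    have h1 := (LipschitzWith.projIcc hT.le).dist_le_mul (q : ℝ) t
    rw [projIcc_of_mem hT.le ht, Subtype.dist_eq, Real.dist_eq, Real.dist_eq] at h1
    refine h1.trans ?_
    rw [NNReal.coe_one, one_mul, abs_of_nonneg (by linarith)]
    linarith
  have hcau := (tendsto_pi_nhds.1 ha (i, q)).cauchySeq
  obtain ⟨j₁, hj₁⟩ := Metric.cauchySeq_iff'.1 hcau (ε / 4) (by positivity)
  obtain ⟨j₂, hj₂⟩ := eventually_atTop.1 (hN.tendsto_atTop.eventually hK)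
  have hclose : ∀ j ≥ j₂, |c (N j) i t - c (N j) i (τ q)| ≤ ε / 4 := by
    intro j hj
    refine (hj₂ j hj (τ q) (projIcc 0 T hT.le q).2 t ht).trans ?_
    rw [abs_sub_comm]
    calc K * |τ q - t| ≤ (|K| + 1) * (ε / (4 * (|K| + 1))) := by
          gcongr
          linarith [le_abs_self K]
      _ = ε / 4 := by field_simp
  have hj₁' : ∀ j ≥ j₁, |c (N j) i (τ q) - c (N j₁) i (τ q)| < ε / 4 := fun j hj => hj₁ j hj
  refine ⟨max j₁ j₂, fun j hj => ?_⟩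
  rw [Real.dist_eq]
  have h1 := abs_le.1 (hclose j ((le_max_right _ _).trans hj))
  have h2 := abs_le.1 (hclose (max j₁ j₂) (le_max_right _ _))
  have h3 := abs_lt.1 (hj₁' j ((le_max_left _ _).trans hj))
  have h4 := abs_lt.1 (hj₁' (max j₁ j₂) (le_max_left _ _))
  rw [abs_lt]
  constructor <;> linarith [h1.1, h1.2, h2.1, h2.2, h3.1, h3.2, h4.1, h4.2]

/-- A bounded sequence with convergent Fourier coefficients has a weak limit. -/
theorem exists_weak_limit {L : ℝ} (hL : 0 < L) {F : ℕ → L2Omega L} {M : ℝ}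
    (hb : ∀ n, ‖F n‖ ≤ M)
    (hc : ∀ ξ, ∃ l, Tendsto (fun n => inner ℝ (fourierVec L ξ) (F n)) atTop (𝓝 l)) :
    ∃ f : L2Omega L, ‖f‖ ≤ M ∧ ∀ g, Tendsto (fun n => inner ℝ g (F n)) atTop (𝓝 (inner ℝ g f)) := by
  have hM : 0 ≤ M := (norm_nonneg _).trans (hb 0)
  choose l hl using hc
  have hmem : Memℓp l 2 := by
    refine memℓp_gen' (C := M ^ 2) fun s => ?_
    have h1 : Tendsto (fun n => ∑ ξ ∈ s, ‖(inner ℝ (fourierVec L ξ) (F n) : ℝ)‖ ^ 2) atTop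
        (𝓝 (∑ ξ ∈ s, ‖l ξ‖ ^ 2)) := tendsto_finsetSum _ fun ξ _ => (hl ξ).norm.pow 2
    have h2 : ∑ ξ ∈ s, ‖l ξ‖ ^ 2 ≤ M ^ 2 := by
      refine le_of_tendsto' h1 fun n => ?_
      exact ((orthonormal_fourierVec hL).sum_inner_products_le (F n)).trans
        (pow_le_pow_left₀ (norm_nonneg _) (hb n) 2)
    simpa using h2
  let f := (fourierBasis hL).repr.symm ⟨l, hmem⟩
  have hf : ∀ ξ, inner ℝ (fourierVec L ξ) f = l ξ := by
    intro ξ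
    rw [← coe_fourierBasis hL, ← HilbertBasis.repr_apply_apply,
      LinearIsometryEquiv.apply_symm_apply]
  have hweak := tendsto_inner_of_tendsto_coeff hL hb (f := f) fun ξ => by rw [hf]; exact hl ξ
  refine ⟨f, ?_, hweak⟩
  have h1 : inner ℝ f f ≤ ‖f‖ * M := le_of_tendsto' (hweak f) fun n =>
    (real_inner_le_norm _ _).trans (mul_le_mul_of_nonneg_left (hb n) (norm_nonneg f))
  rw [real_inner_self_eq_norm_sq] at h1
  by_contra! hcon
  nlinarith

/-! ### Weak solutions -/

theorem eventually_mem_galerkinSpace {L : ℝ} (σ : ℕ ≃ ℤ × ℤ) {v : L2Omega L}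
    (hv : v ∈ Submodule.span ℝ (Set.range (fourierVec L))) :
    ∀ᶠ N in atTop, v ∈ galerkinSpace L σ N := by
  induction hv using Submodule.span_induction with
  | mem x hx =>
    obtain ⟨ξ, rfl⟩ := hx
    filter_upwards [eventually_gt_atTop (σ.symm ξ)] with N hN
    simpa using fourierVec_mem_galerkinSpace (L := L) σ hN
  | zero => exact Eventually.of_forall fun N => Submodule.zero_mem _
  | add x y _ _ h1 h2 => filter_upwards [h1, h2] with N a b using Submodule.add_mem _ a b
  | smul a x _ h1 => filter_upwards [h1] with N b using Submodule.smul_mem _ a b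

theorem mollify_mem_span {L : ℝ} (n : ℕ) (f : L2Omega L) :
    mollify L n f ∈ Submodule.span ℝ (Set.range (fourierVec L)) :=
  Submodule.sum_mem _ fun ξ _ => Submodule.smul_mem _ _ (Submodule.subset_span ⟨ξ, rfl⟩)

theorem aestronglyMeasurable_Ioc_of_continuousOn {X : Type*} [NormedAddCommGroup X] {T t : ℝ}
    (htT : t ≤ T) {f : ℝ → X} (hf : ContinuousOn f (Icc 0 T)) :
    AEStronglyMeasurable f (volume.restrict (Ioc 0 t)) :=
  ((hf.mono (Icc_subset_Icc_right htT)).mono Ioc_subset_Icc_self).aestronglyMeasurable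
    measurableSet_Ioc

theorem MemCHP2.advectMemL2 {L T t : ℝ} (hL : 0 < L) {u : ℝ → L2Omega L} (hu : MemCHP2 L T u)
    (htT : t ≤ T) {v : L2Omega L} (hv : HasPerSmoothRep L v) : AdvectMemL2 L t u v := by
  have hc := hu.continuousOn_advectVec hL hv
  obtain ⟨C, hC⟩ := isCompact_Icc.exists_bound_of_continuousOn hc
  refine ⟨fun s => advectVec L (u s) v, ?_, ae_of_all _ fun s => coeFn_advectVec hL (u s) hv⟩
  refine MemLp.of_bound (aestronglyMeasurable_Ioc_of_continuousOn htT hc) C ?_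
  exact (ae_restrict_iff' measurableSet_Ioc).2 (ae_of_all _ fun s hs =>
    hC s ⟨hs.1.le, hs.2.trans htT⟩)

/-- The integral of `k (u_y, v)` is continuous in `v`. -/
theorem tendsto_integral_forcing {L T k t : ℝ} {u : ℝ → L2Omega L} (hu : MemCHP2 L T u)
    (ht : t ∈ Icc 0 T) {vs : ℕ → L2Omega L} {v : L2Omega L} (hvs : Tendsto vs atTop (𝓝 v)) :
    Tendsto (fun n => ∫ s in (0 : ℝ)..t, k * inner ℝ (wderiv L ey (u s)) (vs n)) atTop
      (𝓝 (∫ s in (0 : ℝ)..t, k * inner ℝ (wderiv L ey (u s)) v)) := by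
  have huy : ContinuousOn (fun s => k • wderiv L ey (u s)) (Icc 0 T) :=
    (hu.2.2.1 ey (by simp)).const_smul k
  have hint : IntervalIntegrable (fun s => k • wderiv L ey (u s)) volume 0 t := by
    refine ContinuousOn.intervalIntegrable ?_
    rw [uIcc_of_le ht.1]
    exact huy.mono (Icc_subset_Icc_right ht.2)
  have key : ∀ v : L2Omega L, ∫ s in (0 : ℝ)..t, k * inner ℝ (wderiv L ey (u s)) v
      = inner ℝ v (∫ s in (0 : ℝ)..t, k • wderiv L ey (u s)) := by
    intro v
    rw [← innerSL_apply_apply ℝ, ← ContinuousLinearMap.intervalIntegral_comp_comm _ hint]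
    refine intervalIntegral.integral_congr fun s _ => ?_
    simp only [innerSL_apply_apply, inner_smul_right, real_inner_comm]
  simp_rw [key]
  exact hvs.inner tendsto_const_nhds

section WeakSolution

variable {L T k M : ℝ} {u w : ℝ → L2Omega L}

/-- If the integrated equation holds for trigonometric polynomials, it holds for every
`v ∈ H_P¹(Ω)` with `V(u) · ∇v ∈ L²(0,t; L²(Ω))`. -/
theorem intervalIntegrable_and_eq_of_span (hL : 0 < L) (hu : MemCHP2 L T u)
    (hwm : AEStronglyMeasurable w (volume.restrict (Ioc 0 T))) (hwb : ∀ t, ‖w t‖ ≤ M)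
    (hid : ∀ v ∈ Submodule.span ℝ (Set.range (fourierVec L)), ∀ t ∈ Icc 0 T,
      inner ℝ v (w t - helmholtz L (u 0)) = ∫ s in (0 : ℝ)..t,
        (inner ℝ (advectVec L (u s) v) (w s) + k * inner ℝ (wderiv L ey (u s)) v))
    {v : L2Omega L} (hv : MemHP1 L v) {t : ℝ} (ht : t ∈ Ioc 0 T) (hvt : AdvectMemL2 L t u v) :
    IntervalIntegrable (advectPairing L u w v) volume 0 t ∧
      inner ℝ (w t - helmholtz L (u 0)) v
        = ∫ s in (0 : ℝ)..t, (advectPairing L u w v s + k * inner ℝ (wderiv L ey (u s)) v) := by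
  obtain ⟨G, hG, hGe⟩ := hvt
  have hM : 0 ≤ M := (norm_nonneg _).trans (hwb 0)
  have hGe' : ∀ᵐ s ∂(volume : Measure ℝ), s ∈ uIoc 0 t → G s =ᵐ[mu L] advect L (u s) v := by
    rw [uIoc_of_le ht.1.le]
    exact (ae_restrict_iff' measurableSet_Ioc).1 hGe
  have hwm' : AEStronglyMeasurable w (volume.restrict (Ioc 0 t)) :=
    hwm.mono_measure (Measure.restrict_mono (Ioc_subset_Ioc_right ht.2) le_rfl)
  have hGi : Integrable G (volume.restrict (Ioc 0 t)) := hG.integrable (by norm_num)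
  have huy : ContinuousOn (fun s => wderiv L ey (u s)) (Icc 0 T) := hu.2.2.1 ey (by simp)
  -- the constants in the uniform bound of the smoothed advection terms
  obtain ⟨C, hC⟩ := isCompact_Icc.exists_bound_of_continuousOn huy
  obtain ⟨Cxx, hxx⟩ := isCompact_Icc.exists_bound_of_continuousOn
    (hu.2.2.2 ex (by simp) ex (by simp))
  obtain ⟨Cxy, hxy⟩ := isCompact_Icc.exists_bound_of_continuousOn
    (hu.2.2.2 ex (by simp) ey (by simp))
  obtain ⟨Cyx, hyx⟩ := isCompact_Icc.exists_bound_of_continuousOn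
    (hu.2.2.2 ey (by simp) ex (by simp))
  obtain ⟨Cyy, hyy⟩ := isCompact_Icc.exists_bound_of_continuousOn
    (hu.2.2.2 ey (by simp) ey (by simp))
  set B := ‖wderiv L ex v‖ * (Cyx + Cyy) + ‖wderiv L ey v‖ * (Cxx + Cxy) with hB
  have hpair : ∀ᵐ s ∂(volume : Measure ℝ), s ∈ uIoc 0 t →
      advectPairing L u w v s = inner ℝ (G s) (w s) := by
    filter_upwards [hGe'] with s hs hst
    exact integral_advect_mul (hs hst) (w s)
  have hint : IntervalIntegrable (advectPairing L u w v) volume 0 t := by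
    rw [intervalIntegrable_iff, uIoc_of_le ht.1.le]
    have h1 : Integrable (fun s => inner ℝ (G s) (w s)) (volume.restrict (Ioc 0 t)) := by
      refine (hGi.norm.mul_const M).mono' (hGi.1.inner hwm') (ae_of_all _ fun s => ?_)
      exact (norm_inner_le_norm _ _).trans (mul_le_mul_of_nonneg_left (hwb s) (norm_nonneg _))
    refine h1.congr ?_
    rw [uIoc_of_le ht.1.le] at hpair
    filter_upwards [(ae_restrict_iff' measurableSet_Ioc).2 hpair] with s hs using hs.symm
  refine ⟨hint, ?_⟩
  have hlhs : Tendsto (fun n => inner ℝ (mollify L n v) (w t - helmholtz L (u 0))) atTop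
      (𝓝 (inner ℝ v (w t - helmholtz L (u 0)))) := (tendsto_mollify hL v).inner tendsto_const_nhds
  simp_rw [hid _ (mollify_mem_span _ v) t (Ioc_subset_Icc_self ht)] at hlhs
  have hrhs : Tendsto (fun n => ∫ s in (0 : ℝ)..t,
        (inner ℝ (advectVec L (u s) (mollify L n v)) (w s)
        + k * inner ℝ (wderiv L ey (u s)) (mollify L n v))) atTop
      (𝓝 (∫ s in (0 : ℝ)..t,
        (advectPairing L u w v s + k * inner ℝ (wderiv L ey (u s)) v))) := by
    refine intervalIntegral.tendsto_integral_filter_of_dominated_convergence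
      (fun s => (‖G s‖ + B) * M + |k| * (C * ‖v‖)) (Eventually.of_forall fun n => ?_) ?_ ?_ ?_
    · rw [uIoc_of_le ht.1.le]
      have h1 := aestronglyMeasurable_Ioc_of_continuousOn ht.2
        (hu.continuousOn_advectVec hL (hasPerSmoothRep_mollify hL n v))
      have h2 := aestronglyMeasurable_Ioc_of_continuousOn ht.2 huy
      exact (h1.inner hwm').add ((h2.inner aestronglyMeasurable_const).const_mul k)
    · filter_upwards [eventually_ge_atTop 1] with n hn
      filter_upwards [hGe'] with s hs hst
      have hs' : s ∈ Icc 0 T := by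
        rw [uIoc_of_le ht.1.le] at hst
        exact ⟨hst.1.le, hst.2.trans ht.2⟩
      have h1 := norm_advectVec_mollify_le hL (hu.1 s hs') hv (hs hst) hn
      have h2 : ‖advectVec L (u s) (mollify L n v)‖ ≤ ‖G s‖ + B := by
        refine h1.trans ?_
        rw [hB]
        gcongr
        · exact hyx s hs'
        · exact hyy s hs'
        · exact hxx s hs'
        · exact hxy s hs'
      refine (norm_add_le _ _).trans (add_le_add ?_ ?_)
      · exact (norm_inner_le_norm _ _).trans
          (mul_le_mul h2 (hwb s) (norm_nonneg _) ((norm_nonneg _).trans h2))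
      · rw [norm_mul, Real.norm_eq_abs]
        refine mul_le_mul_of_nonneg_left ((norm_inner_le_norm _ _).trans ?_) (abs_nonneg k)
        exact mul_le_mul (hC s hs') (norm_mollify_le hL n v) (norm_nonneg _)
          ((norm_nonneg _).trans (hC s hs'))
    · rw [intervalIntegrable_iff, uIoc_of_le ht.1.le]
      exact ((hGi.norm.add (integrable_const B)).mul_const M).add (integrable_const _)
    · filter_upwards [hGe', hpair] with s hs hp hst
      have hs' : s ∈ Icc 0 T := by
        rw [uIoc_of_le ht.1.le] at hst
        exact ⟨hst.1.le, hst.2.trans ht.2⟩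
      have h1 := tendsto_inner_advectVec_mollify hL (hu.1 s hs') hv (hs hst) (w s)
      rw [hp hst, real_inner_comm]
      simp_rw [real_inner_comm (w s)]
      exact h1.add ((tendsto_const_nhds.inner (tendsto_mollify hL v)).const_mul k)
  rw [real_inner_comm]
  exact tendsto_nhds_unique hlhs hrhs

/-- For general `v` the value of the advection integral is read off from the equation, whose other
terms are continuous in `v`. -/
theorem isWeakSolution_of_span (hL : 0 < L) (hu : MemCHP2 L T u)
    (hwm : AEStronglyMeasurable w (volume.restrict (Ioc 0 T))) (hwb : ∀ t, ‖w t‖ ≤ M)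
    (hid : ∀ v ∈ Submodule.span ℝ (Set.range (fourierVec L)), ∀ t ∈ Icc 0 T,
      inner ℝ v (w t - helmholtz L (u 0)) = ∫ s in (0 : ℝ)..t,
        (inner ℝ (advectVec L (u s) v) (w s) + k * inner ℝ (wderiv L ey (u s)) v)) :
    IsWeakSolution L T k u w := by
  refine ⟨MemLp.of_bound hwm M (ae_of_all _ hwb), fun v hv t ht => ⟨?_, fun hvt =>
    intervalIntegrable_and_eq_of_span hL hu hwm hwb hid hv ht hvt⟩⟩
  refine ⟨inner ℝ (w t - helmholtz L (u 0)) v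
    - ∫ s in (0 : ℝ)..t, k * inner ℝ (wderiv L ey (u s)) v, ⟨?_, ?_⟩, by ring⟩
  · refine ⟨fun n => mollify L n v, fun n => ⟨(hasPerSmoothRep_mollify hL n v).memHP1 hL,
      hu.advectMemL2 hL ht.2 (hasPerSmoothRep_mollify hL n v)⟩, tendsto_mollify hL v,
      fun e he => ?_⟩
    simp_rw [hv.wderiv_mollify hL _ he]
    exact tendsto_mollify hL _
  · rintro vs ⟨hvs, hlim, -⟩
    have huy : ContinuousOn (fun s => wderiv L ey (u s)) (Icc 0 T) := hu.2.2.1 ey (by simp)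
    have hval : ∀ n, ∫ s in (0 : ℝ)..t, advectPairing L u w (vs n) s
        = inner ℝ (w t - helmholtz L (u 0)) (vs n)
          - ∫ s in (0 : ℝ)..t, k * inner ℝ (wderiv L ey (u s)) (vs n) := by
      intro n
      obtain ⟨h1, h2⟩ := intervalIntegrable_and_eq_of_span hL hu hwm hwb hid (hvs n).1 ht (hvs n).2
      have h3 : IntervalIntegrable (fun s => k * inner ℝ (wderiv L ey (u s)) (vs n))
          volume 0 t := by
        refine ContinuousOn.intervalIntegrable ?_
        rw [uIcc_of_le ht.1.le]
        exact (continuousOn_const.mul (huy.inner continuousOn_const)).mono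
          (Icc_subset_Icc_right ht.2)
      rw [h2, intervalIntegral.integral_add h1 h3]
      ring
    simp_rw [hval]
    exact (tendsto_const_nhds.inner hlim).sub
      (tendsto_integral_forcing hu (Ioc_subset_Icc_self ht) hlim)

end WeakSolution

/-- For every enumeration of the basis, a subsequence of the Galerkin solutions converges weakly to
a weak solution. -/
theorem exists_isWeakSolution_of_galerkin {L T : ℝ} (k : ℝ) (hL : 0 < L) (hT : 0 < T)
    {u : ℝ → L2Omega L} (hu : MemCHP2 L T u) (σ : ℕ ≃ ℤ × ℤ) {W : ℕ → ℝ → L2Omega L}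
    (hW : ∀ n, IsSpectralSolution L T k σ n u (W n)) :
    ∃ (w : ℝ → L2Omega L) (N : ℕ → ℕ), IsWeakSolution L T k u w ∧ StrictMono N ∧
      WeaklyConvergesL2L2 L T (fun j => W (N j)) w := by
  have h0T : (0 : ℝ) ∈ Icc 0 T := ⟨le_rfl, hT.le⟩
  have huy : ContinuousOn (fun s => wderiv L ey (u s)) (Icc 0 T) := hu.2.2.1 ey (by simp)
  obtain ⟨C, hC⟩ := isCompact_Icc.exists_bound_of_continuousOn huy
  set M := √((‖helmholtz L (u 0)‖ ^ 2 + (k * C) ^ 2) * Real.exp T)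
  have hM0 : 0 ≤ M := Real.sqrt_nonneg _
  have hWM : ∀ n, ∀ t ∈ Icc 0 T, ‖W n t‖ ≤ M := fun n t ht => (hW n).norm_le hL hT hu hC ht
  -- the Fourier coefficients of the approximations are equi-Lipschitz in time
  have hlip : ∀ ξ, ∃ K, ∀ᶠ n in atTop, ∀ s ∈ Icc 0 T, ∀ t ∈ Icc 0 T,
      |inner ℝ (fourierVec L ξ) (W n t) - inner ℝ (fourierVec L ξ) (W n s)| ≤ K * |t - s| := by
    intro ξ
    obtain ⟨A, hA⟩ := isCompact_Icc.exists_bound_of_continuousOn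
      (hu.continuousOn_advectVec hL (hasPerSmoothRep_fourierVec hL ξ))
    refine ⟨A * M + |k| * (C * ‖fourierVec L ξ‖), ?_⟩
    filter_upwards [eventually_mem_galerkinSpace σ (v := fourierVec L ξ)
      (Submodule.subset_span ⟨ξ, rfl⟩)] with n hn
    have key : ∀ s ∈ Icc 0 T, ∀ t ∈ Icc 0 T, s ≤ t →
        |inner ℝ (fourierVec L ξ) (W n t) - inner ℝ (fourierVec L ξ) (W n s)|
          ≤ (A * M + |k| * (C * ‖fourierVec L ξ‖)) * |t - s| := by
      intro s hs t ht hst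
      rw [(hW n).inner_eq_integral hL hu hn hs ht hst, ← Real.norm_eq_abs]
      refine intervalIntegral.norm_integral_le_of_norm_le_const fun r hr => ?_
      rw [uIoc_of_le hst] at hr
      have hr' : r ∈ Icc 0 T := ⟨hs.1.trans hr.1.le, hr.2.trans ht.2⟩
      refine (norm_add_le _ _).trans (add_le_add ?_ ?_)
      · exact (norm_inner_le_norm _ _).trans (mul_le_mul (hA r hr') (hWM n r hr') (norm_nonneg _)
          ((norm_nonneg _).trans (hA r hr')))
      · rw [norm_mul, Real.norm_eq_abs]
        exact mul_le_mul_of_nonneg_left ((norm_inner_le_norm _ _).trans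
          (mul_le_mul_of_nonneg_right (hC r hr') (norm_nonneg _))) (abs_nonneg k)
    intro s hs t ht
    rcases le_total s t with h | h
    · exact key s hs t ht h
    · rw [abs_sub_comm, abs_sub_comm t]
      exact key t ht s hs h
  obtain ⟨N, hN, hlim⟩ := exists_subseq_tendsto_of_lipschitz (M := M) hT
    (c := fun n ξ t => inner ℝ (fourierVec L ξ) (W n t)) (fun n ξ t ht => by
      refine (abs_real_inner_le_norm _ _).trans ?_
      rw [(orthonormal_fourierVec hL).1 ξ, one_mul]
      exact hWM n t ht) hlip
  have hex : ∀ t, ∃ f : L2Omega L, ‖f‖ ≤ M ∧ (t ∈ Icc 0 T →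
      ∀ g, Tendsto (fun j => inner ℝ g (W (N j) t)) atTop (𝓝 (inner ℝ g f))) := by
    intro t
    by_cases ht : t ∈ Icc 0 T
    · obtain ⟨f, hf, hf'⟩ := exists_weak_limit hL (F := fun j => W (N j) t)
        (fun j => hWM (N j) t ht) fun ξ => hlim ξ t ht
      exact ⟨f, hf, fun _ => hf'⟩
    · exact ⟨0, by simpa using hM0, fun h => absurd h ht⟩
  choose w hwb hw using hex
  have hWm : ∀ j, AEStronglyMeasurable (W j) (volume.restrict (Ioc 0 T)) := fun j =>
    aestronglyMeasurable_Ioc_of_continuousOn le_rfl (hW j).2.1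
  -- the limit is measurable, because its smoothings are finite sums with measurable coefficients
  have hwm : AEStronglyMeasurable w (volume.restrict (Ioc 0 T)) := by
    have hcoef : ∀ ξ, AEStronglyMeasurable (fun t => (inner ℝ (fourierVec L ξ) (w t) : ℝ))
        (volume.restrict (Ioc 0 T)) := by
      intro ξ
      refine aestronglyMeasurable_of_tendsto_ae atTop
        (fun j => (aestronglyMeasurable_const (b := fourierVec L ξ)).inner (hWm (N j))) ?_
      exact (ae_restrict_iff' measurableSet_Ioc).2 (ae_of_all _ fun t ht =>
        hw t (Ioc_subset_Icc_self ht) _)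
    refine aestronglyMeasurable_of_tendsto_ae atTop (f := fun n t => mollify L n (w t))
      (fun n => ?_) (ae_of_all _ fun t => tendsto_mollify hL (w t))
    unfold mollify
    refine Finset.aestronglyMeasurable_fun_sum _ fun ξ _ => ?_
    exact ((hcoef ξ).const_mul _).smul_const _
  have hid : ∀ v ∈ Submodule.span ℝ (Set.range (fourierVec L)), ∀ t ∈ Icc 0 T,
      inner ℝ v (w t - helmholtz L (u 0)) = ∫ s in (0 : ℝ)..t,
        (inner ℝ (advectVec L (u s) v) (w s) + k * inner ℝ (wderiv L ey (u s)) v) := by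
    intro v hv t ht
    have hev := hN.tendsto_atTop.eventually (eventually_mem_galerkinSpace σ hv)
    obtain ⟨n₀, hn₀⟩ := (eventually_mem_galerkinSpace σ hv).exists
    have hadv := hu.continuousOn_advectVec hL (hasPerSmoothRep_of_mem_galerkinSpace hL hn₀)
    obtain ⟨A, hA⟩ := isCompact_Icc.exists_bound_of_continuousOn hadv
    have hl : Tendsto (fun j => inner ℝ v (W (N j) t) - inner ℝ v (W (N j) 0)) atTop
        (𝓝 (inner ℝ v (w t - helmholtz L (u 0)))) := by
      rw [inner_sub_right]
      refine (hw t ht v).sub (tendsto_const_nhds.congr' ?_)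
      filter_upwards [hev] with j hj
      rw [(hW (N j)).2.2.2.2.2, (hu.1 0 h0T).helmholtz_starProjection hL,
        ← Submodule.inner_starProjection_left_eq_right,
        Submodule.starProjection_eq_self_iff.2 hj]
    have hr : Tendsto (fun j => ∫ s in (0 : ℝ)..t,
          (inner ℝ (advectVec L (u s) v) (W (N j) s) + k * inner ℝ (wderiv L ey (u s)) v)) atTop
        (𝓝 (∫ s in (0 : ℝ)..t,
          (inner ℝ (advectVec L (u s) v) (w s) + k * inner ℝ (wderiv L ey (u s)) v))) := by
      have hmem : ∀ s ∈ uIoc 0 t, s ∈ Icc 0 T := fun s hs => by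
        rw [uIoc_of_le ht.1] at hs
        exact ⟨hs.1.le, hs.2.trans ht.2⟩
      refine intervalIntegral.tendsto_integral_filter_of_dominated_convergence
        (fun _ => A * M + |k| * (C * ‖v‖)) (Eventually.of_forall fun j => ?_)
        (Eventually.of_forall fun j => ae_of_all _ fun s hs => ?_) intervalIntegrable_const
        (ae_of_all _ fun s hs => (hw s (hmem s hs) _).add tendsto_const_nhds)
      · rw [uIoc_of_le ht.1]
        exact aestronglyMeasurable_Ioc_of_continuousOn ht.2 ((hadv.inner (hW (N j)).2.1).add
          (continuousOn_const.mul (huy.inner continuousOn_const)))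
      · refine (norm_add_le _ _).trans (add_le_add ?_ ?_)
        · exact (norm_inner_le_norm _ _).trans (mul_le_mul (hA s (hmem s hs))
            (hWM _ s (hmem s hs)) (norm_nonneg _) ((norm_nonneg _).trans (hA s (hmem s hs))))
        · rw [norm_mul, Real.norm_eq_abs]
          exact mul_le_mul_of_nonneg_left ((norm_inner_le_norm _ _).trans
            (mul_le_mul_of_nonneg_right (hC s (hmem s hs)) (norm_nonneg _))) (abs_nonneg k)
    refine tendsto_nhds_unique (hl.congr' ?_) hr
    filter_upwards [hev] with j hj
    exact (hW (N j)).inner_eq_integral hL hu hj h0T ht ht.1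
  refine ⟨w, N, isWeakSolution_of_span hL hu hwm hwb hid, hN, fun g hg => ?_⟩
  have hgi : Integrable g (volume.restrict (Ioc 0 T)) := hg.integrable (by norm_num)
  refine intervalIntegral.tendsto_integral_filter_of_dominated_convergence
    (fun s => M * ‖g s‖) (Eventually.of_forall fun j => ?_)
    (Eventually.of_forall fun j => ae_of_all _ fun s hs => ?_) ?_ (ae_of_all _ fun s hs => ?_)
  · rw [uIoc_of_le hT.le]
    exact (hWm (N j)).inner hgi.1
  · rw [uIoc_of_le hT.le] at hs
    exact (norm_inner_le_norm _ _).trans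
      (mul_le_mul_of_nonneg_right (hWM _ s (Ioc_subset_Icc_self hs)) (norm_nonneg _))
  · rw [intervalIntegrable_iff, uIoc_of_le hT.le]
    exact hgi.norm.const_mul M
  · rw [uIoc_of_le hT.le] at hs
    simp_rw [real_inner_comm (g s)]
    exact hw s (Ioc_subset_Icc_self hs) (g s)

end HasegawaMima

theorem mainTheorem4 (L T k : ℝ) (hL : 0 < L) (hT : 0 < T)
    (u : ℝ → HasegawaMima.L2Omega L) (hu : HasegawaMima.MemCHP2 L T u) :
    (∃ w : ℝ → HasegawaMima.L2Omega L, HasegawaMima.IsWeakSolution L T k u w) ∧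
    ∀ σ : ℕ ≃ ℤ × ℤ, HasegawaMima.IsEigenOrdering L σ →
      ∃ (w : ℝ → HasegawaMima.L2Omega L) (W : ℕ → ℝ → HasegawaMima.L2Omega L) (N : ℕ → ℕ),
        HasegawaMima.IsWeakSolution L T k u w ∧
        (∀ n, 1 ≤ n → HasegawaMima.IsSpectralSolution L T k σ n u (W n)) ∧
        StrictMono N ∧
        HasegawaMima.WeaklyConvergesL2L2 L T (fun j => W (N j)) w := by
  have key : ∀ σ : ℕ ≃ ℤ × ℤ,
      ∃ (w : ℝ → HasegawaMima.L2Omega L) (W : ℕ → ℝ → HasegawaMima.L2Omega L) (N : ℕ → ℕ),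
        HasegawaMima.IsWeakSolution L T k u w ∧
        (∀ n, 1 ≤ n → HasegawaMima.IsSpectralSolution L T k σ n u (W n)) ∧
        StrictMono N ∧
        HasegawaMima.WeaklyConvergesL2L2 L T (fun j => W (N j)) w := by
    intro σ
    choose W hW using HasegawaMima.exists_isSpectralSolution k hL hT hu σ
    obtain ⟨w, N, hw, hN, hlim⟩ := HasegawaMima.exists_isWeakSolution_of_galerkin k hL hT hu σ hW
    exact ⟨w, W, N, hw, fun n _ => hW n, hN, hlim⟩
  refine ⟨?_, fun σ _ => key σ⟩
  obtain ⟨σ, -⟩ := HasegawaMima.exists_isEigenOrdering L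
  obtain ⟨w, -, -, hw, -⟩ := key σ
  exact ⟨w, hw⟩
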